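/- **Theorem 9.3.** *Setting.* The $63$ positive roots of $E_7$ are the linear forms in $d_1,\dots,d_7$ denoted by the labels $ij:=d_i-d_j$ ($i<j$), $ijk:=d_i+d_j+d_k$ ($i<j<k$) and $i:=-d_i+\sum_{l=1}^7 d_l$. The graph $\mathcal G(E_7)$ has as vertices the following $34$ root subsystems of $E_7$, numbered $1,\dots,34$ and given by their positive roots. Type $A_1$: 1: $\{124\}$; 2: $\{126\}$; 3: $\{134\}$; 4: $\{135\}$; 5: $\{157\}$; 7: $\{235\}$; 10: $\{237\}$; 15: $\{456\}$; 20: $\{457\}$; 23: $\{367\}$. Type $A_2$: 6: $\{12,135,235\}$; 8: $\{23,124,134\}$; 12: $\{57,235,237\}$; 14: $\{37,135,157\}$; 18: $\{46,124,126\}$; 19: $\{14,157,457\}$; 24: $\{26,237,367\}$; 28: $\{45,134,135\}$; 31: $\{67,456,457\}$; 32: $\{3,126,457\}$; 33: $\{5,124,367\}$; 34: $\{1,237,456\}$. Type $A_3\times A_3$ (the semicolon separates the two components $A_3$): 13: $\{126,124,46,567,3,457 ;\ 235,135,12,137,57,237\}$; 16: $\{124,367,5,347,46,126 ;\ 135,235,12,257,37,157\}$;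 17: $\{124,134,23,136,46,126 ;\ 237,235,57,467,1,456\}$; 21: $\{237,235,57,356,26,367 ;\ 457,157,14,246,3,126\}$; 22: $\{135,157,37,147,45,134 ;\ 237,456,1,245,26,367\}$; 25: $\{157,135,37,345,14,457 ;\ 367,124,5,146,26,237\}$; 26: $\{134,124,23,125,45,135 ;\ 456,237,1,236,67,457\}$; 29: $\{124,134,23,267,5,367 ;\ 457,157,14,156,67,456\}$; 30: $\{135,235,12,234,45,134 ;\ 457,456,67,127,3,126\}$. Type $A_7$: 9: $\{126,124,134,135,235,237,456,457,567,46,136,23,125,45,234,12,137,57,467,1,236,67,127,3,13,56,2,47\}$; 11: $\{126,457,157,135,235,237,367,124,567,3,246,14,345,37,257,12,137,57,356,26,146,5,347,46,35,24,7,16\}$; 27: $\{134,135,157,457,237,456,367,124,125,45,147,37,345,14,156,67,236,1,245,26,146,5,267,23,15,36,4,27\}$. Below, a "common $A_2$", "common $A_3\times A_3$" or "common $A_7$" is one of those in this list, and a "common $A_3$" is one of the $18$ components $A_3$ in this list. Two distinct vertices are joined by an edge in exactly the following cases. $\{A_1,A_1\}$: they do not lie in a common $A_2$. $\{A_2,A_2\}$: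 they lie in a common $A_3\times A_3$ but not in a common $A_3$. $\{A_1,A_2\}$: the $A_1$ is contained in the $A_2$, or the two do not lie in a common $A_3$. $\{A_1,A_3\times A_3\}$: the $A_1$ is contained in the $A_3\times A_3$, or the two do not lie in a common $A_7$ and every $A_2$ in the list containing the $A_1$ is disjoint from the $A_3\times A_3$. $\{A_1,A_7\}$, $\{A_2,A_3\times A_3\}$, $\{A_2,A_7\}$, $\{A_3\times A_3,A_7\}$: the first is contained in the second. The vertices of $\mathcal G(E_7)$ correspond to the facets of the $E_7$ pezzotope. Let $\Delta$ be the clique complex of $\mathcal G(E_7)$; this is the simplicial complex dual to the boundary of the $E_7$ pezzotope. Consider the $34$ $u$-equations $u_{1}+u_{2}u_{3}u_{21}u_{22}u_{23}u_{24}u_{28}u_{30}u_{32}=1$, $u_{2}+u_{1}u_{8}u_{19}u_{20}u_{25}u_{26}u_{27}u_{29}u_{31}u_{33}=1$, $u_{3}+u_{1}u_{4}u_{6}u_{11}u_{13}u_{14}u_{16}u_{18}u_{25}u_{33}=1$, $u_{4}+u_{3}u_{5}u_{7}u_{8}u_{12}u_{17}u_{19}u_{21}u_{29}=1$, $u_{5}+u_{4}u_{6}u_{9}u_{13}u_{20}u_{26}u_{28}u_{30}u_{31}u_{32}=1$,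 $u_{6}+u_{3}u_{5}u_{8}u_{10}u_{12}u_{14}u_{17}u_{19}u_{21}u_{22}u_{24}u_{25}u_{26}u_{27}u_{28}u_{29}u_{34}=1$, $u_{7}+u_{4}u_{10}u_{14}u_{22}u_{24}u_{25}u_{26}u_{27}u_{28}u_{34}=1$, $u_{8}+u_{2}u_{4}u_{6}u_{11}u_{13}u_{14}u_{16}u_{18}u_{21}u_{22}u_{23}u_{24}u_{25}u_{28}u_{30}u_{32}u_{33}=1$, $u_{9}+u_{5}u_{11}u_{14}u_{16}u_{19}u_{21}u_{22}u_{23}u_{24}u_{25}u_{27}u_{29}u_{33}=1$, $u_{10}+u_{6}u_{7}u_{15}u_{16}u_{23}u_{29}u_{30}u_{31}u_{33}=1$, $u_{11}+u_{3}u_{8}u_{9}u_{15}u_{17}u_{22}u_{26}u_{27}u_{28}u_{29}u_{30}u_{31}u_{34}=1$, $u_{12}+u_{4}u_{6}u_{14}u_{15}u_{16}u_{22}u_{23}u_{24}u_{25}u_{26}u_{27}u_{28}u_{29}u_{30}u_{31}u_{33}u_{34}=1$, $u_{13}+u_{3}u_{5}u_{8}u_{14}u_{15}u_{16}u_{17}u_{19}u_{21}u_{22}u_{23}u_{24}u_{25}u_{26}u_{27}u_{28}u_{29}u_{30}u_{31}u_{33}u_{34}=1$,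 $u_{14}+u_{3}u_{6}u_{7}u_{8}u_{9}u_{12}u_{13}u_{17}u_{19}u_{20}u_{21}u_{26}u_{28}u_{29}u_{30}u_{31}u_{32}=1$, $u_{15}+u_{10}u_{11}u_{12}u_{13}u_{19}u_{20}u_{21}u_{24}u_{25}u_{32}=1$, $u_{16}+u_{3}u_{8}u_{9}u_{10}u_{12}u_{13}u_{17}u_{19}u_{20}u_{21}u_{22}u_{24}u_{25}u_{26}u_{27}u_{28}u_{29}u_{30}u_{31}u_{32}u_{34}=1$, $u_{17}+u_{4}u_{6}u_{11}u_{13}u_{14}u_{16}u_{19}u_{20}u_{21}u_{22}u_{23}u_{24}u_{25}u_{26}u_{27}u_{28}u_{29}u_{30}u_{31}u_{32}u_{33}=1$, $u_{18}+u_{3}u_{8}u_{19}u_{20}u_{21}u_{22}u_{23}u_{24}u_{25}u_{26}u_{27}u_{28}u_{29}u_{30}u_{31}u_{32}u_{33}=1$, $u_{19}+u_{2}u_{4}u_{6}u_{9}u_{13}u_{14}u_{15}u_{16}u_{17}u_{18}u_{22}u_{26}u_{28}u_{30}u_{31}u_{32}u_{34}=1$, $u_{20}+u_{2}u_{5}u_{14}u_{15}u_{16}u_{17}u_{18}u_{22}u_{34}=1$,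 $u_{21}+u_{1}u_{4}u_{6}u_{8}u_{9}u_{13}u_{14}u_{15}u_{16}u_{17}u_{18}u_{22}u_{25}u_{26}u_{27}u_{28}u_{29}u_{30}u_{31}u_{33}u_{34}=1$, $u_{22}+u_{1}u_{6}u_{7}u_{8}u_{9}u_{11}u_{12}u_{13}u_{16}u_{17}u_{18}u_{19}u_{20}u_{21}u_{25}u_{26}u_{29}u_{30}u_{31}u_{32}u_{33}=1$, $u_{23}+u_{1}u_{8}u_{9}u_{10}u_{12}u_{13}u_{17}u_{18}u_{26}u_{34}=1$, $u_{24}+u_{1}u_{6}u_{7}u_{8}u_{9}u_{12}u_{13}u_{15}u_{16}u_{17}u_{18}u_{26}u_{29}u_{30}u_{31}u_{33}u_{34}=1$, $u_{25}+u_{2}u_{3}u_{6}u_{7}u_{8}u_{9}u_{12}u_{13}u_{15}u_{16}u_{17}u_{18}u_{21}u_{22}u_{26}u_{28}u_{29}u_{30}u_{31}u_{32}u_{34}=1$, $u_{26}+u_{2}u_{5}u_{6}u_{7}u_{11}u_{12}u_{13}u_{14}u_{16}u_{17}u_{18}u_{19}u_{21}u_{22}u_{23}u_{24}u_{25}u_{29}u_{30}u_{32}u_{33}=1$,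 $u_{27}+u_{2}u_{6}u_{7}u_{9}u_{11}u_{12}u_{13}u_{16}u_{17}u_{18}u_{21}u_{30}u_{32}=1$, $u_{28}+u_{1}u_{5}u_{6}u_{7}u_{8}u_{11}u_{12}u_{13}u_{14}u_{16}u_{17}u_{18}u_{19}u_{21}u_{25}u_{29}u_{33}=1$, $u_{29}+u_{2}u_{4}u_{6}u_{9}u_{10}u_{11}u_{12}u_{13}u_{14}u_{16}u_{17}u_{18}u_{21}u_{22}u_{24}u_{25}u_{26}u_{28}u_{30}u_{32}u_{34}=1$, $u_{30}+u_{1}u_{5}u_{8}u_{10}u_{11}u_{12}u_{13}u_{14}u_{16}u_{17}u_{18}u_{19}u_{21}u_{22}u_{24}u_{25}u_{26}u_{27}u_{29}u_{33}u_{34}=1$, $u_{31}+u_{2}u_{5}u_{10}u_{11}u_{12}u_{13}u_{14}u_{16}u_{17}u_{18}u_{19}u_{21}u_{22}u_{24}u_{25}u_{32}u_{34}=1$, $u_{32}+u_{1}u_{5}u_{8}u_{14}u_{15}u_{16}u_{17}u_{18}u_{19}u_{22}u_{25}u_{26}u_{27}u_{29}u_{31}u_{33}u_{34}=1$, $u_{33}+u_{2}u_{3}u_{8}u_{9}u_{10}u_{12}u_{13}u_{17}u_{18}u_{21}u_{22}u_{24}u_{26}u_{28}u_{30}u_{32}u_{34}=1$,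 $u_{34}+u_{6}u_{7}u_{11}u_{12}u_{13}u_{16}u_{19}u_{20}u_{21}u_{23}u_{24}u_{25}u_{29}u_{30}u_{31}u_{32}u_{33}=1$. *Claims.* 1. The $u$-equations encode $\mathcal G(E_7)$, and so combinatorially the $E_7$ pezzotope: for each $i$, the $i$-th equation is $u_i+\prod_j u_j=1$, where $j$ runs over all vertices $j\neq i$ that are not adjacent to $i$ in $\mathcal G(E_7)$. Equivalently, $i\neq j$ are adjacent if and only if $u_j$ does not occur in the $i$-th equation. The graph $\mathcal G(E_7)$ has $297$ edges. 2. In $R=\mathbb Q[s_1,\dots,s_{34}]$, the Stanley–Reisner ideal of $\Delta$ is the ideal $M$ generated by the $264$ monomials $s_is_j$, $i\ne j$, such that $u_j$ occurs in the $i$-th $u$-equation. 3. The ideal of $R$ that is Alexander dual to $M$ has a linear minimal free resolution: it is generated in degree $28$, its $n$-th syzygies are generated in degree $28+n$, and its Betti numbers are $579,1737,2000,1105,297,34,1$ (and $0$ from then on). 4. $\Delta$ is Gorenstein over $\mathbb Q$, that is, $R/M$ is a Gorenstein ring. Moreover $\Delta$ is a homology sphere of dimension $5$, over $\mathbb Q$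 and also over $\mathbb Z$: for each face $\sigma$ of $\Delta$ (including $\emptyset$), the link of $\sigma$ has the reduced homology of a sphere of dimension $5-|\sigma|$. 5. $\Delta$ has $579$ facets, each with $6$ vertices. The amplitude, which is computed as the sum of the minimal monomial generators of the Alexander dual of $M$ divided by $s_1s_2\cdots s_{34}$, equals $\displaystyle\sum_{F}\prod_{i\in F}\frac1{s_i}$, the sum over the $579$ facets $F$ of $\Delta$, in the field $\mathbb Q(s_1,\dots,s_{34})$. -/

import Mathlib

namespace Pezzotope

/-! ### The graph of the `E₇` pezzotope -/

/-- The positive root of `E₇`, as a linear form in `d₁, …, d₇` (given by its coefficient vector),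
named by a decimal label: `ij` stands for `dᵢ - dⱼ`, `ijk` stands for `dᵢ + dⱼ + dₖ`, and the
one-digit label `i` stands for `-dᵢ + (d₁ + ⋯ + d₇)`.  Coordinate `k : Fin 7` belongs to `d_{k+1}`. -/
def rootOfLabel (n : ℕ) : Fin 7 → ℤ := fun k =>
  if n < 10 then
    (if (k : ℕ) + 1 = n then 0 else 1)
  else if n < 100 then
    (if (k : ℕ) + 1 = n / 10 then 1 else if (k : ℕ) + 1 = n % 10 then -1 else 0)
  else
    (if (k : ℕ) + 1 = n / 100 ∨ (k : ℕ) + 1 = n / 10 % 10 ∨ (k : ℕ) + 1 = n % 10 then 1 else 0)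

/-- The labels of the positive roots of the 34 root subsystems of `E₇` that are the vertices of the
graph: ten of type `A₁`, twelve of type `A₂`, nine of type `A₃ × A₃`, three of type `A₇`.  Every
subsystem is listed as the list of its irreducible components.  Line `k` (counted from 1) is
the subsystem that belongs to the variable `u_k`. -/
def subsystemTable : List (List (List ℕ)) := [
  [[124]],
  [[126]],
  [[134]],
  [[135]],
  [[157]],
  [[12, 135, 235]],
  [[235]],
  [[23, 124, 134]],
  [[126, 124, 134, 135, 235, 237, 456, 457, 567, 46, 136, 23, 125, 45, 234, 12, 137, 57, 467, 1, 236, 67, 127, 3, 13, 56, 2, 47]],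
  [[237]],
  [[126, 457, 157, 135, 235, 237, 367, 124, 567, 3, 246, 14, 345, 37, 257, 12, 137, 57, 356, 26, 146, 5, 347, 46, 35, 24, 7, 16]],
  [[57, 235, 237]],
  [[126, 124, 46, 567, 3, 457], [235, 135, 12, 137, 57, 237]],
  [[37, 135, 157]],
  [[456]],
  [[124, 367, 5, 347, 46, 126], [135, 235, 12, 257, 37, 157]],
  [[124, 134, 23, 136, 46, 126], [237, 235, 57, 467, 1, 456]],
  [[46, 124, 126]],
  [[14, 157, 457]],
  [[457]],
  [[237, 235, 57, 356, 26, 367], [457, 157, 14, 246, 3, 126]],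
  [[135, 157, 37, 147, 45, 134], [237, 456, 1, 245, 26, 367]],
  [[367]],
  [[26, 237, 367]],
  [[157, 135, 37, 345, 14, 457], [367, 124, 5, 146, 26, 237]],
  [[134, 124, 23, 125, 45, 135], [456, 237, 1, 236, 67, 457]],
  [[134, 135, 157, 457, 237, 456, 367, 124, 125, 45, 147, 37, 345, 14, 156, 67, 236, 1, 245, 26, 146, 5, 267, 23, 15, 36, 4, 27]],
  [[45, 134, 135]],
  [[124, 134, 23, 267, 5, 367], [457, 157, 14, 156, 67, 456]],
  [[135, 235, 12, 234, 45, 134], [457, 456, 67, 127, 3, 126]],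
  [[67, 456, 457]],
  [[3, 126, 457]],
  [[5, 124, 367]],
  [[1, 237, 456]]]

/-- The sets of positive roots of the irreducible components of the `i`-th subsystem. -/
def components (i : Fin 34) : List (Finset (Fin 7 → ℤ)) :=
  (subsystemTable.getD i []).map fun c => (c.map rootOfLabel).toFinset

/-- The set of positive roots of the `i`-th subsystem. -/
def posRoots (i : Fin 34) : Finset (Fin 7 → ℤ) :=
  (((subsystemTable.getD i []).flatten).map rootOfLabel).toFinset

/-- The four types of root subsystems that occur. -/
inductive SubsystemType
  | A1
  | A2
  | A3A3
  | A7
  deriving DecidableEq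

/-- The type of the `i`-th subsystem; it can be read off from the number of positive roots, which is
`1`, `3`, `12` and `28` for the types `A₁`, `A₂`, `A₃ × A₃` and `A₇`. -/
def subsystemType (i : Fin 34) : SubsystemType :=
  if (posRoots i).card = 1 then .A1
  else if (posRoots i).card = 3 then .A2
  else if (posRoots i).card = 12 then .A3A3
  else .A7

/-- The subsystems `i` and `j` lie in a common subsystem of type `t` from the table. -/
def InCommon (t : SubsystemType) (i j : Fin 34) : Prop :=
  ∃ m, subsystemType m = t ∧ posRoots i ⊆ posRoots m ∧ posRoots j ⊆ posRoots m

/-- The subsystems `i` and `j` lie in a common `A₃`, that is, in one of the two components of a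
subsystem of type `A₃ × A₃` from the table. -/
def InCommonA3 (i j : Fin 34) : Prop :=
  ∃ m, subsystemType m = .A3A3 ∧ ∃ c ∈ components m, posRoots i ⊆ c ∧ posRoots j ⊆ c

/-- The rule for edges between the subsystems `i` and `j`, stated for the type of `i` not after the
type of `j` in the order `A₁, A₂, A₃ × A₃, A₇`. -/
def EdgeRule (i j : Fin 34) : Prop :=
  match subsystemType i, subsystemType j with
  | .A1, .A1 => ¬ InCommon .A2 i j
  | .A2, .A2 => InCommon .A3A3 i j ∧ ¬ InCommonA3 i j
  | .A1, .A2 => posRoots i ⊆ posRoots j ∨ ¬ InCommonA3 i j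
  | .A1, .A3A3 => posRoots i ⊆ posRoots j ∨
      (¬ InCommon .A7 i j ∧
        ∀ m, subsystemType m = .A2 → posRoots i ⊆ posRoots m → Disjoint (posRoots m) (posRoots j))
  | .A1, .A7 => posRoots i ⊆ posRoots j
  | .A2, .A3A3 => posRoots i ⊆ posRoots j
  | .A2, .A7 => posRoots i ⊆ posRoots j
  | .A3A3, .A7 => posRoots i ⊆ posRoots j
  | _, _ => False

/-- The graph `𝒢(E₇)`.  Its vertices are the 34 root subsystems, that is, the facets of the
`E₇` pezzotope, and two of them are adjacent if and only if the facets meet. -/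
def graphE7 : SimpleGraph (Fin 34) := SimpleGraph.fromRel EdgeRule

/-! ### The `u`-equations -/

/-- Line `i` lists the indices `j` of the variables `u_j` in the monomial of the `i`-th
`u`-equation (everything is counted from 1). -/
def uTable : List (List ℕ) := [
  [2, 21, 22, 23, 24, 28, 3, 30, 32],
  [1, 19, 20, 25, 26, 27, 29, 31, 33, 8],
  [1, 11, 13, 14, 16, 18, 25, 33, 4, 6],
  [12, 17, 19, 21, 29, 3, 5, 7, 8],
  [13, 20, 26, 28, 30, 31, 32, 4, 6, 9],
  [10, 12, 14, 17, 19, 21, 22, 24, 25, 26, 27, 28, 29, 3, 34, 5, 8],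
  [10, 14, 22, 24, 25, 26, 27, 28, 34, 4],
  [11, 13, 14, 16, 18, 2, 21, 22, 23, 24, 25, 28, 30, 32, 33, 4, 6],
  [11, 14, 16, 19, 21, 22, 23, 24, 25, 27, 29, 33, 5],
  [15, 16, 23, 29, 30, 31, 33, 6, 7],
  [15, 17, 22, 26, 27, 28, 29, 3, 30, 31, 34, 8, 9],
  [14, 15, 16, 22, 23, 24, 25, 26, 27, 28, 29, 30, 31, 33, 34, 4, 6],
  [14, 15, 16, 17, 19, 21, 22, 23, 24, 25, 26, 27, 28, 29, 3, 30, 31, 33, 34, 5, 8],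
  [12, 13, 17, 19, 20, 21, 26, 28, 29, 3, 30, 31, 32, 6, 7, 8, 9],
  [10, 11, 12, 13, 19, 20, 21, 24, 25, 32],
  [10, 12, 13, 17, 19, 20, 21, 22, 24, 25, 26, 27, 28, 29, 3, 30, 31, 32, 34, 8, 9],
  [11, 13, 14, 16, 19, 20, 21, 22, 23, 24, 25, 26, 27, 28, 29, 30, 31, 32, 33, 4, 6],
  [19, 20, 21, 22, 23, 24, 25, 26, 27, 28, 29, 3, 30, 31, 32, 33, 8],
  [13, 14, 15, 16, 17, 18, 2, 22, 26, 28, 30, 31, 32, 34, 4, 6, 9],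
  [14, 15, 16, 17, 18, 2, 22, 34, 5],
  [1, 13, 14, 15, 16, 17, 18, 22, 25, 26, 27, 28, 29, 30, 31, 33, 34, 4, 6, 8, 9],
  [1, 11, 12, 13, 16, 17, 18, 19, 20, 21, 25, 26, 29, 30, 31, 32, 33, 6, 7, 8, 9],
  [1, 10, 12, 13, 17, 18, 26, 34, 8, 9],
  [1, 12, 13, 15, 16, 17, 18, 26, 29, 30, 31, 33, 34, 6, 7, 8, 9],
  [12, 13, 15, 16, 17, 18, 2, 21, 22, 26, 28, 29, 3, 30, 31, 32, 34, 6, 7, 8, 9],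
  [11, 12, 13, 14, 16, 17, 18, 19, 2, 21, 22, 23, 24, 25, 29, 30, 32, 33, 5, 6, 7],
  [11, 12, 13, 16, 17, 18, 2, 21, 30, 32, 6, 7, 9],
  [1, 11, 12, 13, 14, 16, 17, 18, 19, 21, 25, 29, 33, 5, 6, 7, 8],
  [10, 11, 12, 13, 14, 16, 17, 18, 2, 21, 22, 24, 25, 26, 28, 30, 32, 34, 4, 6, 9],
  [1, 10, 11, 12, 13, 14, 16, 17, 18, 19, 21, 22, 24, 25, 26, 27, 29, 33, 34, 5, 8],
  [10, 11, 12, 13, 14, 16, 17, 18, 19, 2, 21, 22, 24, 25, 32, 34, 5],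
  [1, 14, 15, 16, 17, 18, 19, 22, 25, 26, 27, 29, 31, 33, 34, 5, 8],
  [10, 12, 13, 17, 18, 2, 21, 22, 24, 26, 28, 3, 30, 32, 34, 8, 9],
  [11, 12, 13, 16, 19, 20, 21, 23, 24, 25, 29, 30, 31, 32, 33, 6, 7]]

/-- The `u`-equations are `uPoly i = 0`, where
`uPoly i = u_i + (product of the u_j with j in the i-th line of the table) - 1`.
Here the variable `u_k` is `X ⟨k - 1, _⟩`. -/
noncomputable def uPoly (i : Fin 34) : MvPolynomial (Fin 34) ℤ :=
  MvPolynomial.X i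
    + ∏ j ∈ Finset.univ.filter (fun j : Fin 34 => (j : ℕ) + 1 ∈ uTable.getD i []), MvPolynomial.X j
    - 1

/-- The pairs `(i, j)` for which `s_i * s_j` is listed as a generator of the monomial ideal `M`
(counted from 1). -/
def monomialPairs : List (ℕ × ℕ) := [
  (1, 2), (1, 21), (1, 22), (1, 23), (1, 24), (1, 28), (1, 3), (1, 30), (1, 32), (10, 15), (10,
  16), (10, 23), (10, 29), (10, 30), (10, 31), (10, 33), (11, 15), (11, 17), (11, 22), (11, 26),
  (11, 27), (11, 28), (11, 29), (11, 30), (11, 31), (11, 34), (12, 14), (12, 15), (12, 16), (12,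
  22), (12, 23), (12, 24), (12, 25), (12, 26), (12, 27), (12, 28), (12, 29), (12, 30), (12, 31),
  (12, 33), (12, 34), (13, 14), (13, 15), (13, 16), (13, 17), (13, 19), (13, 21), (13, 22), (13,
  23), (13, 24), (13, 25), (13, 26), (13, 27), (13, 28), (13, 29), (13, 30), (13, 31), (13, 33),
  (13, 34), (14, 17), (14, 19), (14, 20), (14, 21), (14, 26), (14, 28), (14, 29), (14, 30), (14,
  31), (14, 32), (15, 19), (15, 20), (15, 21), (15, 24), (15, 25), (15, 32), (16, 17), (16, 19),
  (16, 20), (16, 21), (16, 22), (16, 24), (16, 25), (16, 26), (16, 27), (16, 28), (16, 29), (16,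
  30), (16, 31), (16, 32), (16, 34), (17, 19), (17, 20), (17, 21), (17, 22), (17, 23), (17, 24),
  (17, 25), (17, 26), (17, 27), (17, 28), (17, 29), (17, 30), (17, 31), (17, 32), (17, 33), (18,
  19), (18, 20), (18, 21), (18, 22), (18, 23), (18, 24), (18, 25), (18, 26), (18, 27), (18, 28),
  (18, 29), (18, 30), (18, 31), (18, 32), (18, 33), (19, 22), (19, 26), (19, 28), (19, 30), (19,
  31), (19, 32), (19, 34), (2, 19), (2, 20), (2, 25), (2, 26), (2, 27), (2, 29), (2, 31), (2,
  33), (2, 8), (20, 22), (20, 34), (21, 22), (21, 25), (21, 26), (21, 27), (21, 28), (21, 29),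
  (21, 30), (21, 31), (21, 33), (21, 34), (22, 25), (22, 26), (22, 29), (22, 30), (22, 31), (22,
  32), (22, 33), (23, 26), (23, 34), (24, 26), (24, 29), (24, 30), (24, 31), (24, 33), (24, 34),
  (25, 26), (25, 28), (25, 29), (25, 30), (25, 31), (25, 32), (25, 34), (26, 29), (26, 30), (26,
  32), (26, 33), (27, 30), (27, 32), (28, 29), (28, 33), (29, 30), (29, 32), (29, 34), (3, 11),
  (3, 13), (3, 14), (3, 16), (3, 18), (3, 25), (3, 33), (3, 4), (3, 6), (30, 33), (30, 34), (31,
  32), (31, 34), (32, 33), (32, 34), (33, 34), (4, 12), (4, 17), (4, 19), (4, 21), (4, 29), (4,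
  5), (4, 7), (4, 8), (5, 13), (5, 20), (5, 26), (5, 28), (5, 30), (5, 31), (5, 32), (5, 6), (5,
  9), (6, 10), (6, 12), (6, 14), (6, 17), (6, 19), (6, 21), (6, 22), (6, 24), (6, 25), (6, 26),
  (6, 27), (6, 28), (6, 29), (6, 34), (6, 8), (7, 10), (7, 14), (7, 22), (7, 24), (7, 25), (7,
  26), (7, 27), (7, 28), (7, 34), (8, 11), (8, 13), (8, 14), (8, 16), (8, 18), (8, 21), (8, 22),
  (8, 23), (8, 24), (8, 25), (8, 28), (8, 30), (8, 32), (8, 33), (9, 11), (9, 14), (9, 16), (9,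
  19), (9, 21), (9, 22), (9, 23), (9, 24), (9, 25), (9, 27), (9, 29), (9, 33)]

/-- The monomial ideal `M` generated by the squarefree quadratic monomials in the list. -/
noncomputable def idealM : Ideal (MvPolynomial (Fin 34) ℚ) :=
  Ideal.span {p | ∃ i j : Fin 34, ((i : ℕ) + 1, (j : ℕ) + 1) ∈ monomialPairs ∧
    p = MvPolynomial.X i * MvPolynomial.X j}

/-! ### Simplicial complexes

A simplicial complex on the vertex set `V` is a set of subsets of `V` that is closed under passing
to subsets, i.e. a lower set; the empty face is a face of every complex other than the void one. -/

section Complexes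

variable {V : Type} [Fintype V] [DecidableEq V]

/-- The clique complex of a graph. -/
def cliqueComplex (G : SimpleGraph V) : LowerSet (Finset V) where
  carrier := {F | G.IsClique (F : Set V)}
  lower' := fun _ _ hle h => Set.Pairwise.mono (Finset.coe_subset.mpr hle) h

/-- The facets (maximal faces) of a complex. -/
def facets (Δ : LowerSet (Finset V)) : Set (Finset V) := {F | Maximal (· ∈ Δ) F}

/-- The link of `σ` in a complex. -/
def link (Δ : LowerSet (Finset V)) (σ : Finset V) : LowerSet (Finset V) where
  carrier := {τ | Disjoint τ σ ∧ τ ∪ σ ∈ Δ}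
  lower' := fun _ _ hle h =>
    ⟨Finset.disjoint_of_subset_left hle h.1, Δ.lower (Finset.union_subset_union_left hle) h.2⟩

/-- The Alexander dual of a complex: the complements of the nonfaces. -/
def alexanderDual (Δ : LowerSet (Finset V)) : LowerSet (Finset V) where
  carrier := {F | Fᶜ ∉ Δ}
  lower' := fun _ _ hle h h' => h (Δ.lower (Finset.compl_subset_compl.mpr hle) h')

/-- The Stanley–Reisner ideal: it is generated by the squarefree monomials of the nonfaces. -/
noncomputable def stanleyReisnerIdeal (k : Type) [Field k] (Δ : LowerSet (Finset V)) :
    Ideal (MvPolynomial V k) :=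
  Ideal.span {p | ∃ F : Finset V, F ∉ Δ ∧ p = ∏ i ∈ F, MvPolynomial.X i}

end Complexes

/-! ### Simplicial homology -/

section Homology

variable {V : Type} [Fintype V] [LinearOrder V]

/-- The simplicial boundary map on chains, which are functions on the set of all subsets of `V`,
including the empty one (so it is the augmented boundary map). On basis vectors it is
`∂ F = ∑ (-1)^(number of elements of F before v) (F \ {v})`, the sum being over `v` in `F`. -/
def boundary (A : Type) [CommRing A] : (Finset V → A) →ₗ[A] (Finset V → A) where
  toFun c := fun G => ∑ v ∈ Gᶜ, (-1 : A) ^ (G.filter (· < v)).card * c (insert v G)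
  map_add' c c' := by
    funext G
    simp [mul_add, Finset.sum_add_distrib]
  map_smul' a c := by
    funext G
    simp [Finset.mul_sum, mul_left_comm]

/-- The chains that are supported on the faces with exactly `n` vertices. -/
def chains (A : Type) [CommRing A] (Δ : LowerSet (Finset V)) (n : ℕ) :
    Submodule A (Finset V → A) where
  carrier := {c | ∀ F, ¬ (F ∈ Δ ∧ F.card = n) → c F = 0}
  zero_mem' := fun _ _ => rfl
  add_mem' := fun hc hc' F hF => by simp [hc F hF, hc' F hF]
  smul_mem' := fun a c hc F hF => by simp [hc F hF]

/-- The cycles among the chains on faces with `n` vertices. -/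
def cycles (A : Type) [CommRing A] (Δ : LowerSet (Finset V)) (n : ℕ) :
    Submodule A (Finset V → A) :=
  chains A Δ n ⊓ LinearMap.ker (boundary A)

/-- The boundaries of the chains on faces with `n + 1` vertices. -/
def boundaries (A : Type) [CommRing A] (Δ : LowerSet (Finset V)) (n : ℕ) :
    Submodule A (Finset V → A) :=
  (chains A Δ (n + 1)).map (boundary A)

/-- Reduced simplicial homology with coefficients in `A`.  The index `n` is the number of vertices
of the faces involved: this is the module usually written `H̃_{n-1}(Δ; A)`. -/
abbrev ReducedHomology (A : Type) [CommRing A] (Δ : LowerSet (Finset V)) (n : ℕ) :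
    Type :=
  cycles A Δ n ⧸ (boundaries A Δ n).submoduleOf (cycles A Δ n)

/-- `Δ` is a homology sphere of dimension `d` over `A`: the link of every face `σ` (including the
empty face, whose link is `Δ`) has the reduced homology of a sphere of dimension `d - |σ|`. -/
def IsHomologySphere (A : Type) [CommRing A] (Δ : LowerSet (Finset V)) (d : ℕ) :
    Prop :=
  ∅ ∈ Δ ∧ ∀ σ ∈ Δ, ∀ n : ℕ,
    (n + σ.card = d + 1 → Nonempty (ReducedHomology A (link Δ σ) n ≃ₗ[A] A)) ∧
    (n + σ.card ≠ d + 1 → Subsingleton (ReducedHomology A (link Δ σ) n))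

end Homology

/-! ### The amplitude -/

section Amplitude

variable {V : Type} [Fintype V] [DecidableEq V]

/-- The exponent vectors of the minimal monomial generators of a monomial ideal. -/
def minimalMonomials {k : Type} [Field k] (I : Ideal (MvPolynomial V k)) : Set (V →₀ ℕ) :=
  {m | Minimal (fun m' => MvPolynomial.monomial m' (1 : k) ∈ I) m}

/-- The amplitude of a complex: the sum of the minimal generators of the Alexander dual of the
Stanley–Reisner ideal, divided by the product of all variables. -/
noncomputable def amplitude (Δ : LowerSet (Finset V)) : FractionRing (MvPolynomial V ℚ) :=
  algebraMap (MvPolynomial V ℚ) (FractionRing (MvPolynomial V ℚ))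
      (∑ᶠ m ∈ minimalMonomials (stanleyReisnerIdeal ℚ (alexanderDual Δ)),
        MvPolynomial.monomial m (1 : ℚ)) /
    algebraMap (MvPolynomial V ℚ) (FractionRing (MvPolynomial V ℚ)) (∏ i, MvPolynomial.X i)

end Amplitude

/-! ### Minimal free resolutions -/

/-- A minimal graded free resolution
`⋯ → F₂ → F₁ → F₀ → I → 0` of an ideal `I` in a standard graded polynomial ring, where the free
module `F_n` has a basis indexed by `Fin (rank n)` with basis vectors in the degrees `degree n`. The
maps are given by matrices of homogeneous polynomials; minimality says that no entry of a
matrix has a constant term. -/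
structure MinimalFreeResolution {V k : Type} [Field k] (I : Ideal (MvPolynomial V k)) where
  /-- The rank of `F_n`. -/
  rank : ℕ → ℕ
  /-- The degrees of the basis vectors of `F_n`. -/
  degree : (n : ℕ) → Fin (rank n) → ℕ
  /-- The images of the basis vectors of `F₀` in `I`. -/
  gen : Fin (rank 0) → MvPolynomial V k
  /-- The matrix of the map from `F_{n+1}` to `F_n`. -/
  d : (n : ℕ) → Matrix (Fin (rank n)) (Fin (rank (n + 1))) (MvPolynomial V k)
  gen_homogeneous : ∀ j, (gen j).IsHomogeneous (degree 0 j)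
  d_homogeneous : ∀ n i j, d n i j ≠ 0 →
    ∃ e, degree n i + e = degree (n + 1) j ∧ (d n i j).IsHomogeneous e
  span_gen : Ideal.span (Set.range gen) = I
  exact_zero : ∀ v : Fin (rank 0) → MvPolynomial V k,
    ∑ j, v j * gen j = 0 ↔ ∃ w, (d 0).mulVec w = v
  exact_succ : ∀ (n : ℕ) (v : Fin (rank (n + 1)) → MvPolynomial V k),
    (d n).mulVec v = 0 ↔ ∃ w, (d (n + 1)).mulVec w = v
  minimal : ∀ n i j, MvPolynomial.constantCoeff (d n i j) = 0

/-! ### Gorenstein rings -/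

/-- A commutative ring is Gorenstein if it is Noetherian and each localization at a prime ideal has
finite injective dimension as a module over itself. -/
def IsGorensteinRing (A : Type) [CommRing A] : Prop :=
  IsNoetherianRing A ∧ ∀ (p : Ideal A) [p.IsPrime], ∃ n : ℕ,
    CategoryTheory.HasInjectiveDimensionLE
      (ModuleCat.of (Localization.AtPrime p) (Localization.AtPrime p)) n

/-- The simplicial complex dual to the boundary of the `E₇` pezzotope: its faces are the sets of
facets of the pezzotope with a common point. It is the clique complex of the graph `𝒢(E₇)`. -/
def dualComplexE7 : LowerSet (Finset (Fin 34)) := cliqueComplex graphE7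

end Pezzotope

/-!
The clique complex `Δ` of `𝒢(E₇)` has an explicit shelling `F 0, …, F 578` by sets with six vertices,
whose restriction sets `R i` are such that the reversed order is a shelling as well, with the
restriction sets `F i \ R i` (`reversibleShelling_dualComplexE7`).  That the listed facets generate
the whole clique complex and that every ridge lies in two of them follows from one check: each
clique is the intersection of the listed facets that contain it.  Everything else holds for all
complexes with such a `ReversibleShelling`.

* Homology: `Δ`, and similarly every star and every link, is stacked from the intervals
  `[R i, F i]`.  Adding an interval does not change homology if it has more than one element,
  because it is then a cone, and it adds a top-dimensional cycle otherwise.  The reversed shelling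
  shows that exactly one interval of each star and link is of the second kind.  So the links are
  homology spheres over every ring (`ReversibleShelling.isHomologySphere`).
* The linear resolution: the basis of the `n`-th free module consists of the faces with `6 - n`
  vertices, and the maps are coboundary maps with the signs multiplied by variables.  In a
  multidegree with support `W` this is the cochain complex of the star of the complement of `W`,
  which is exact but for the top degree (`ReversibleShelling.resolution`).  The face numbers come
  from the partition of `Δ` into the intervals `[R i, F i]`.
* The Gorenstein property: the Stanley–Reisner ring `A` is projective over the polynomial ring `S` in
  the six parameters `θ_j = ∑ t_i ^ j x_i`, by induction along the shelling.  There is a linear form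
  `A → S` of degree `-6` with nonzero constant values at the monomials of the facets; the linear
  relations at the ridges and the strong connectivity of the stars show that it
  generates `Hom_S(A, S)` freely over `A`.  Hence `A ≅ Hom_S(A, S)`, and coextension of scalars along
  `S → A` preserves injective dimension, which is finite over `S` by Hilbert's syzygy theorem
  (`ReversibleShelling.isGorensteinRing`).

The claims on the graph, its 297 edges and the ideal `M` are finite checks: containments of root
subsystems reduce to containments of lists of labels, because distinct labels denote distinct roots.
The minimal generators of the Alexander dual ideal are the monomials of the complements of the
facets, which gives the amplitude.
-/

namespace Pezzotope

/-! ### Shellings that can be reversed -/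

section Shelling

variable {V : Type} [DecidableEq V]

/-- A shelling `F 0, …, F (m - 1)` of a complex `Δ` all of whose facets have `d` vertices, with
restriction sets `R i`, such that the reversed order is a shelling as well, with restriction
sets `F i \ R i`.  Every ridge lies in two facets. The field `forward` says that `R i` is not
contained in an earlier facet; together with `ridge` and `backward` it makes the intervals
`[R i, F i]` a partition of `Δ`. -/
structure ReversibleShelling (Δ : LowerSet (Finset V)) (d m : ℕ) (F R : ℕ → Finset V) : Prop where
  mem_iff : ∀ σ, σ ∈ Δ ↔ ∃ i < m, σ ⊆ F i
  card_eq : ∀ i < m, (F i).card = d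
  subset : ∀ i < m, R i ⊆ F i
  forward : ∀ i j, i < j → j < m → ¬ R j ⊆ F i
  backward : ∀ i j, i < j → j < m → ¬ F i \ R i ⊆ F j
  ridge : ∀ i < m, ∀ v ∈ F i, ∃ j < m, j ≠ i ∧ (F i).erase v ⊆ F j
  pos : 0 < m

namespace ReversibleShelling

variable {Δ : LowerSet (Finset V)} {d m : ℕ} {F R : ℕ → Finset V}
  (h : ReversibleShelling Δ d m F R)
include h

lemma facet_mem {i : ℕ} (hi : i < m) : F i ∈ Δ := (h.mem_iff _).2 ⟨i, hi, subset_rfl⟩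

lemma empty_mem : ∅ ∈ Δ := (h.mem_iff _).2 ⟨0, h.pos, Finset.empty_subset _⟩

lemma facet_injOn {i j : ℕ} (hi : i < m) (hj : j < m) (hij : F i = F j) : i = j := by
  rcases lt_trichotomy i j with hlt | heq | hlt
  · exact absurd (hij ▸ h.subset j hj) (h.forward i j hlt hj)
  · exact heq
  · exact absurd (hij ▸ h.subset i hi) (h.forward j i hlt hi)

lemma card_le {σ : Finset V} (hσ : σ ∈ Δ) : σ.card ≤ d := by
  obtain ⟨i, hi, hs⟩ := (h.mem_iff σ).1 hσ
  exact h.card_eq i hi ▸ Finset.card_le_card hs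

lemma eq_facet {σ : Finset V} {i : ℕ} (hi : i < m) (hσ : σ ∈ Δ) (hs : F i ⊆ σ) : σ = F i :=
  (Finset.eq_of_subset_of_card_le hs (h.card_eq i hi ▸ h.card_le hσ)).symm

lemma exists_facet_eq {σ : Finset V} (hσ : σ ∈ Δ) (hc : σ.card = d) : ∃ i < m, F i = σ := by
  obtain ⟨i, hi, hs⟩ := (h.mem_iff σ).1 hσ
  exact ⟨i, hi, (Finset.eq_of_subset_of_card_le hs (by rw [h.card_eq i hi, hc])).symm⟩

/-- The other facet through a ridge of `F i` is earlier if the omitted vertex is in `R i`. -/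
lemma exists_lt {i : ℕ} (hi : i < m) {v : V} (hv : v ∈ R i) : ∃ j < i, (F i).erase v ⊆ F j := by
  obtain ⟨j, hj, hne, hs⟩ := h.ridge i hi v (h.subset i hi hv)
  refine ⟨j, lt_of_not_ge fun hle => ?_, hs⟩
  refine h.backward i j (lt_of_le_of_ne hle (Ne.symm hne)) hj (subset_trans (fun w hw => ?_) hs)
  rw [Finset.mem_sdiff] at hw
  exact Finset.mem_erase.2 ⟨fun e => hw.2 (e ▸ hv), hw.1⟩

lemma exists_gt {i : ℕ} (hi : i < m) {v : V} (hv : v ∈ F i) (hv' : v ∉ R i) :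
    ∃ j, i < j ∧ j < m ∧ (F i).erase v ⊆ F j := by
  obtain ⟨j, hj, hne, hs⟩ := h.ridge i hi v hv
  refine ⟨j, lt_of_not_ge fun hle => ?_, hj, hs⟩
  refine h.forward j i (lt_of_le_of_ne hle hne) hi (subset_trans (fun w hw => ?_) hs)
  exact Finset.mem_erase.2 ⟨fun e => hv' (e ▸ hw), h.subset i hi hw⟩

/-- The intervals `[R i, F i]` cover the complex: a face lies in that of the first facet that
contains it. -/
lemma exists_interval {σ : Finset V} (hσ : σ ∈ Δ) : ∃ i < m, R i ⊆ σ ∧ σ ⊆ F i := by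
  classical
  have hex := (h.mem_iff σ).1 hσ
  obtain ⟨hi, hs⟩ := Nat.find_spec hex
  refine ⟨Nat.find hex, hi, fun v hv => ?_, hs⟩
  by_contra hvσ
  obtain ⟨j, hj, hsub⟩ := h.exists_lt hi hv
  refine Nat.find_min hex hj ⟨hj.trans hi, fun w hw => hsub ?_⟩
  exact Finset.mem_erase.2 ⟨fun e => hvσ (e ▸ hw), hs hw⟩

lemma interval_unique {σ : Finset V} {i j : ℕ} (hi : i < m) (hj : j < m)
    (h1 : R i ⊆ σ) (h2 : σ ⊆ F i) (h3 : R j ⊆ σ) (h4 : σ ⊆ F j) : i = j := by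
  rcases lt_trichotomy i j with hlt | heq | hlt
  · exact absurd (h3.trans h2) (h.forward i j hlt hj)
  · exact heq
  · exact absurd (h1.trans h4) (h.forward j i hlt hi)

/-- The intervals `[F i \ R i, F i]` of the reversed shelling cover the complex: a face lies in that
of the last facet that contains it. -/
lemma exists_dual_interval {σ : Finset V} (hσ : σ ∈ Δ) : ∃ i < m, F i \ R i ⊆ σ ∧ σ ⊆ F i := by
  classical
  let P : ℕ → Prop := fun i => i < m ∧ σ ⊆ F i
  obtain ⟨i, hi, hs⟩ := (h.mem_iff σ).1 hσ
  have hP : P (Nat.findGreatest P m) := Nat.findGreatest_spec hi.le ⟨hi, hs⟩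
  refine ⟨_, hP.1, fun v hv => ?_, hP.2⟩
  by_contra hvσ
  rw [Finset.mem_sdiff] at hv
  obtain ⟨j, hij, hj, hsub⟩ := h.exists_gt hP.1 hv.1 hv.2
  refine Nat.findGreatest_is_greatest hij hj.le ⟨hj, fun w hw => hsub ?_⟩
  exact Finset.mem_erase.2 ⟨fun e => hvσ (e ▸ hw), hP.2 hw⟩

lemma dual_interval_unique {σ : Finset V} {i j : ℕ} (hi : i < m) (hj : j < m)
    (h1 : F i \ R i ⊆ σ) (h2 : σ ⊆ F i) (h3 : F j \ R j ⊆ σ) (h4 : σ ⊆ F j) : i = j := by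
  rcases lt_trichotomy i j with hlt | heq | hlt
  · exact absurd (h1.trans h4) (h.backward i j hlt hj)
  · exact heq
  · exact absurd (h3.trans h2) (h.backward j i hlt hi)

/-- At most two facets contain a ridge. -/
lemma ridge_facets {i j k : ℕ} (hi : i < m) (hj : j < m) (hk : k < m) {v : V} (hv : v ∈ F i)
    (hj' : (F i).erase v ⊆ F j) (hk' : (F i).erase v ⊆ F k) (hji : j ≠ i) (hki : k ≠ i) :
    j = k := by
  -- A facet `F l` through a ridge `ρ` has `R l ⊆ ρ` or `F l \ R l ⊆ ρ`,
  -- and either condition determines `l`.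
  have key : ∀ l < m, (F i).erase v ⊆ F l →
      R l ⊆ (F i).erase v ∨ F l \ R l ⊆ (F i).erase v := by
    intro l hl hsub
    have hc : (F l \ (F i).erase v).card = 1 := by
      rw [Finset.card_sdiff_of_subset hsub, Finset.card_erase_of_mem hv, h.card_eq l hl,
        h.card_eq i hi]
      have : 0 < d := h.card_eq i hi ▸ Finset.card_pos.2 ⟨v, hv⟩
      omega
    obtain ⟨w, hw⟩ := Finset.card_eq_one.1 hc
    have hw' : ∀ x ∈ F l, x ∉ (F i).erase v → x = w := fun x hx hx' => by
      have : x ∈ F l \ (F i).erase v := Finset.mem_sdiff.2 ⟨hx, hx'⟩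
      rw [hw] at this
      exact Finset.mem_singleton.1 this
    by_cases hwR : w ∈ R l
    · right
      intro x hx
      rw [Finset.mem_sdiff] at hx
      by_contra hx'
      exact hx.2 (hw' x hx.1 hx' ▸ hwR)
    · left
      intro x hx
      by_contra hx'
      exact hwR (hw' x (h.subset l hl hx) hx' ▸ hx)
  have hi' : (F i).erase v ⊆ F i := Finset.erase_subset _ _
  rcases key i hi hi' with hI | hI <;> rcases key j hj hj' with hJ | hJ <;>
    rcases key k hk hk' with hK | hK
  · exact h.interval_unique hj hk hJ hj' hK hk'
  · exact absurd (h.interval_unique hj hi hJ hj' hI hi') hji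
  · exact absurd (h.interval_unique hk hi hK hk' hI hi') hki
  · exact h.dual_interval_unique hj hk hJ hj' hK hk'
  · exact h.interval_unique hj hk hJ hj' hK hk'
  · exact absurd (h.dual_interval_unique hk hi hK hk' hI hi') hki
  · exact absurd (h.dual_interval_unique hj hi hJ hj' hI hi') hji
  · exact h.dual_interval_unique hj hk hJ hj' hK hk'

/-- The vertices that complete a ridge to a face. -/
lemma exists_neighbour {i j : ℕ} (hi : i < m) (hj : j < m) (hij : i ≠ j) {v : V} (hv : v ∈ F i)
    (hs : (F i).erase v ⊆ F j) :
    ∃ w ∈ F j, w ≠ v ∧ (F j).erase w = (F i).erase v ∧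
      ∀ u ∉ (F i).erase v, insert u ((F i).erase v) ∈ Δ → u = v ∨ u = w := by
  have hd : ((F i).erase v).card + 1 = d := by
    rw [Finset.card_erase_add_one hv, h.card_eq i hi]
  have hc : (F j \ (F i).erase v).card = 1 := by
    rw [Finset.card_sdiff_of_subset hs, h.card_eq j hj]
    omega
  obtain ⟨w, hw⟩ := Finset.card_eq_one.1 hc
  have hwj : w ∈ F j ∧ w ∉ (F i).erase v := by
    rw [← Finset.mem_sdiff, hw]
    exact Finset.mem_singleton_self w
  have hins : insert w ((F i).erase v) = F j := by
    refine Finset.eq_of_subset_of_card_le (Finset.insert_subset hwj.1 hs) ?_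
    rw [Finset.card_insert_of_notMem hwj.2, h.card_eq j hj, hd]
  refine ⟨w, hwj.1, fun e => ?_, by rw [← hins, Finset.erase_insert hwj.2], fun u hu hu' => ?_⟩
  · rw [e, Finset.insert_erase hv] at hins
    exact hij (h.facet_injOn hi hj hins)
  · obtain ⟨l, hl, hle⟩ := h.exists_facet_eq hu' (by rw [Finset.card_insert_of_notMem hu, hd])
    by_cases hli : l = i
    · left
      subst hli
      have : u ∈ F l := hle ▸ Finset.mem_insert_self _ _
      by_contra hne
      exact hu (Finset.mem_erase.2 ⟨hne, this⟩)
    · right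
      have hlj : l = j := h.ridge_facets hi hl hj hv (hle ▸ Finset.subset_insert _ _) hs hli
        (Ne.symm hij)
      subst hlj
      have : u ∈ F l \ (F i).erase v := Finset.mem_sdiff.2 ⟨hle ▸ Finset.mem_insert_self _ _, hu⟩
      rw [hw] at this
      exact Finset.mem_singleton.1 this

/-- Stars are strongly connected: a property of the facets containing `σ` that is inherited from a
facet to its neighbours through ridges containing `σ` holds for all of them if it holds for one. -/
lemma star_connected {σ : Finset V} (P : ℕ → Prop)
    (step : ∀ i < m, ∀ j < m, ∀ v ∈ F i, v ∉ σ → i ≠ j → (F i).erase v ⊆ F j → σ ⊆ F i → σ ⊆ F j →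
      (P i ↔ P j))
    {i j : ℕ} (hi : i < m) (hj : j < m) (hiσ : σ ⊆ F i) (hjσ : σ ⊆ F j) (hP : P i) : P j := by
  classical
  have hex : ∃ k, k < m ∧ σ ⊆ F k := ⟨i, hi, hiσ⟩
  have key : ∀ k, k < m → σ ⊆ F k → (P (Nat.find hex) ↔ P k) := by
    intro k
    induction k using Nat.strong_induction_on with
    | _ k ih =>
      intro hk hkσ
      -- The first facet that contains `σ` is the only one with `R k ⊆ σ`; any other facet has
      -- an earlier neighbour in the star, through the ridge opposite to a vertex of `R k \ σ`.
      by_cases hR : R k ⊆ σ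
      · rcases (Nat.find_min' hex ⟨hk, hkσ⟩).eq_or_lt with he | hlt
        · rw [he]
        · exact absurd (hR.trans (Nat.find_spec hex).2) (h.forward _ k hlt hk)
      · obtain ⟨v, hv, hvσ⟩ := Finset.not_subset.1 hR
        obtain ⟨l, hl, hsub⟩ := h.exists_lt hk hv
        have hlσ : σ ⊆ F l := fun w hw =>
          hsub (Finset.mem_erase.2 ⟨fun e => hvσ (e ▸ hw), hkσ hw⟩)
        exact (ih l hl (hl.trans hk) hlσ).trans
          (step k hk l (hl.trans hk) v (h.subset k hk hv) hvσ hl.ne' hsub hkσ hlσ).symm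
  exact (key j hj hjσ).1 ((key i hi hiσ).2 hP)

/-- All ridges of the last facet lie in earlier facets. -/
lemma restriction_last : R (m - 1) = F (m - 1) := by
  have hm : m - 1 < m := Nat.sub_lt h.pos one_pos
  refine Finset.Subset.antisymm (h.subset _ hm) fun v hv => ?_
  by_contra hv'
  obtain ⟨j, h1, h2, -⟩ := h.exists_gt hm hv hv'
  omega

end ReversibleShelling

end Shelling

/-! ### Homology of families of faces that are stacked from intervals -/

section Homology

set_option linter.unusedSectionVars false

variable {V : Type} [Fintype V] [LinearOrder V] {A : Type} [CommRing A]

lemma boundary_apply (c : Finset V → A) (G : Finset V) :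
    boundary A c G = ∑ v ∈ Gᶜ, (-1 : A) ^ (G.filter (· < v)).card * c (insert v G) := rfl

lemma neg_one_pow_mul_self (n : ℕ) (a : A) : (-1 : A) ^ n * ((-1) ^ n * a) = a := by
  rw [← mul_assoc, ← mul_pow]; simp

lemma card_filter_insert {G : Finset V} {v : V} (hv : v ∉ G) (u : V) :
    ((insert v G).filter (· < u)).card = (G.filter (· < u)).card + if v < u then 1 else 0 := by
  rw [Finset.filter_insert]
  split_ifs with hlt
  · rw [Finset.card_insert_of_notMem (by simp [hv])]
  · rfl

theorem boundary_boundary (c : Finset V → A) : boundary A (boundary A c) = 0 := by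
  funext G
  simp only [boundary_apply, Finset.mul_sum, Pi.zero_apply]
  rw [Finset.sum_sigma']
  -- The terms for `(v, u)` and `(u, v)` cancel.
  refine Finset.sum_involution (fun p _ => ⟨p.2, p.1⟩) ?_ ?_ ?_ ?_
  · rintro ⟨v, u⟩ hp
    simp only [Finset.mem_sigma, Finset.mem_compl, Finset.mem_insert, not_or] at hp
    obtain ⟨hv, huv, hu⟩ := hp
    simp only
    rw [card_filter_insert hv, card_filter_insert hu, Finset.insert_comm u v]
    rcases lt_or_gt_of_ne huv with hlt | hlt
    · rw [if_neg (not_lt.2 hlt.le), if_pos hlt]; ring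
    · rw [if_pos hlt, if_neg (not_lt.2 hlt.le)]; ring
  · rintro ⟨v, u⟩ hp _ he
    simp only [Finset.mem_sigma, Finset.mem_compl, Finset.mem_insert, not_or] at hp
    simp only [Sigma.mk.injEq, heq_eq_eq] at he
    exact hp.2.1 he.1
  · rintro ⟨v, u⟩ hp
    simp only [Finset.mem_sigma, Finset.mem_compl, Finset.mem_insert, not_or] at hp ⊢
    exact ⟨hp.2.2, fun e => hp.2.1 e.symm, hp.1⟩
  · rintro ⟨v, u⟩ _
    rfl

/-- The chain `c` is supported on the members of `𝓕` with `n` elements. -/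
def SupportedOn (𝓕 : Set (Finset V)) (n : ℕ) (c : Finset V → A) : Prop :=
  ∀ τ, ¬ (τ ∈ 𝓕 ∧ τ.card = n) → c τ = 0

/-- The cycles of the chain complex spanned by `𝓕`, in which the members of the boundary outside
`𝓕` are dropped.  If `𝓕` is a difference of complexes, this is the relative chain complex. -/
def IsRelCycle (𝓕 : Set (Finset V)) (n : ℕ) (c : Finset V → A) : Prop :=
  SupportedOn 𝓕 n c ∧ ∀ τ ∈ 𝓕, boundary A c τ = 0

/-- The family of sets that lie in one of the first `k` intervals `[lo i, hi i]` selected by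
`P`. -/
def intervalFamily (P : ℕ → Prop) (lo hi : ℕ → Finset V) (k : ℕ) : Set (Finset V) :=
  {τ | ∃ i < k, P i ∧ lo i ⊆ τ ∧ τ ⊆ hi i}

/-- The `m` intervals `[lo i, hi i]` selected by `P` have tops with `d` elements, each of their
initial unions is closed under subsets in the next one, and their union is convex. -/
structure IsStacked (P : ℕ → Prop) (lo hi : ℕ → Finset V) (d m : ℕ) : Prop where
  subset : ∀ i < m, P i → lo i ⊆ hi i
  card_eq : ∀ i < m, P i → (hi i).card = d
  forward : ∀ i j, i < j → j < m → P i → P j → ¬ lo j ⊆ hi i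
  convex : ∀ τ ∈ intervalFamily P lo hi m, ∀ τ'' ∈ intervalFamily P lo hi m, ∀ τ', τ ⊆ τ' →
    τ' ⊆ τ'' → τ' ∈ intervalFamily P lo hi m

/-- The boundary of a chain of a convex family, cut down to the family, has no boundary in it. -/
lemma boundary_cut {𝓕 : Set (Finset V)} [DecidablePred (· ∈ 𝓕)] {n : ℕ} {b : Finset V → A}
    (hc : ∀ τ ∈ 𝓕, ∀ τ'' ∈ 𝓕, ∀ τ', τ ⊆ τ' → τ' ⊆ τ'' → τ' ∈ 𝓕) (hb : SupportedOn 𝓕 n b)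
    {τ : Finset V} (hτ : τ ∈ 𝓕) :
    boundary A (fun G => if G ∈ 𝓕 then boundary A b G else 0) τ = 0 := by
  have hbb : boundary A (boundary A b) τ = 0 := by rw [boundary_boundary]; rfl
  rw [boundary_apply] at hbb ⊢
  refine Eq.trans ?_ hbb
  refine Finset.sum_congr rfl fun v _ => ?_
  congr 1
  split_ifs with hm
  · rfl
  · rw [boundary_apply]
    refine (Finset.sum_eq_zero fun u _ => ?_).symm
    rw [hb _, mul_zero]
    intro hu
    refine hm ?_
    exact hc τ hτ _ hu.1 _ (Finset.subset_insert _ _) (Finset.subset_insert _ _)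

lemma SupportedOn.boundary_of_card_ne {𝓕 : Set (Finset V)} {n : ℕ} {b : Finset V → A}
    (hb : SupportedOn 𝓕 (n + 1) b) {τ : Finset V} (hτ : τ.card ≠ n) :
    boundary A b τ = 0 := by
  rw [boundary_apply]
  refine Finset.sum_eq_zero fun v hv => ?_
  rw [hb, mul_zero]
  rintro ⟨-, hu⟩
  rw [Finset.card_insert_of_notMem (Finset.mem_compl.1 hv)] at hu
  omega

lemma SupportedOn.mono {𝓕 𝓖 : Set (Finset V)} {n : ℕ} {b : Finset V → A}
    (hb : SupportedOn 𝓕 n b) (h : 𝓕 ⊆ 𝓖) : SupportedOn 𝓖 n b :=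
  fun τ hτ => hb τ fun h' => hτ ⟨h h'.1, h'.2⟩

namespace IsStacked

variable {P : ℕ → Prop} {lo hi : ℕ → Finset V} {d m : ℕ} (h : IsStacked P lo hi d m)
include h

lemma convex_initial {k : ℕ} (hk : k ≤ m) : ∀ τ ∈ intervalFamily P lo hi k,
    ∀ τ'' ∈ intervalFamily P lo hi k, ∀ τ', τ ⊆ τ' → τ' ⊆ τ'' →
    τ' ∈ intervalFamily P lo hi k := by
  rintro τ ⟨i, hik, hPi, hi⟩ τ'' ⟨j, hjk, hPj, hj⟩ τ' h1 h2
  obtain ⟨l, hl, hPl, hl'⟩ := h.convex τ ⟨i, hik.trans_le hk, hPi, hi⟩ τ''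
    ⟨j, hjk.trans_le hk, hPj, hj⟩ τ' h1 h2
  refine ⟨l, lt_of_not_ge fun hkl => ?_, hPl, hl'⟩
  exact h.forward j l (hjk.trans_le hkl) hl hPj hPl (hl'.1.trans (h2.trans hj.2))

omit h in
lemma family_succ_of_not {k : ℕ} (hP : ¬ P k) :
    intervalFamily P lo hi (k + 1) = intervalFamily P lo hi k := by
  ext τ
  constructor
  · rintro ⟨i, hik, hPi, hi⟩
    rcases Nat.lt_succ_iff_lt_or_eq.1 hik with hlt | rfl
    · exact ⟨i, hlt, hPi, hi⟩
    · exact absurd hPi hP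
  · rintro ⟨i, hik, hPi, hi⟩
    exact ⟨i, hik.trans k.lt_succ_self, hPi, hi⟩

omit h in
lemma family_mono (k : ℕ) : intervalFamily P lo hi k ⊆ intervalFamily P lo hi (k + 1) :=
  fun _ ⟨i, hik, h'⟩ => ⟨i, hik.trans k.lt_succ_self, h'⟩

omit h in
lemma mem_family_succ {k : ℕ} {τ : Finset V} (hτ : τ ∈ intervalFamily P lo hi (k + 1)) :
    τ ∈ intervalFamily P lo hi k ∨ (P k ∧ lo k ⊆ τ ∧ τ ⊆ hi k) := by
  obtain ⟨i, hik, hPi, hi⟩ := hτ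
  rcases Nat.lt_succ_iff_lt_or_eq.1 hik with hlt | rfl
  · exact Or.inl ⟨i, hlt, hPi, hi⟩
  · exact Or.inr ⟨hPi, hi⟩

lemma notMem_of_lo_subset {k : ℕ} (hk : k < m) (hP : P k) {τ : Finset V} (hτ : lo k ⊆ τ) :
    τ ∉ intervalFamily P lo hi k := fun ⟨i, hik, hPi, hi⟩ =>
  h.forward i k hik hk hPi hP (hτ.trans hi.2)

/-- A chain of the first `k` intervals has no boundary in the next interval. -/
lemma boundary_eq_zero {k n : ℕ} (hk : k < m) (hP : P k) {b : Finset V → A}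
    (hb : SupportedOn (intervalFamily P lo hi k) n b) {τ : Finset V} (hτ : lo k ⊆ τ) :
    boundary A b τ = 0 := by
  rw [boundary_apply]
  refine Finset.sum_eq_zero fun u _ => ?_
  rw [hb _ fun hu => h.notMem_of_lo_subset hk hP (hτ.trans (Finset.subset_insert u τ)) hu.1,
    mul_zero]

/-- Modulo a boundary, a cycle avoids the last interval unless this is a single set: the interval
is a cone over any vertex of `hi k` that is not in `lo k`. -/
lemma exists_boundary_of_ne {k n : ℕ} (hk : k < m) (hP : P k) (hne : lo k ≠ hi k)
    {c : Finset V → A} (hc : IsRelCycle (intervalFamily P lo hi (k + 1)) n c) :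
    ∃ b c' : Finset V → A, SupportedOn (intervalFamily P lo hi (k + 1)) (n + 1) b ∧
      IsRelCycle (intervalFamily P lo hi k) n c' ∧
      ∀ τ ∈ intervalFamily P lo hi (k + 1), c τ = boundary A b τ + c' τ := by
  classical
  obtain ⟨v, hv, hv'⟩ := Finset.exists_of_ssubset ((h.subset k hk hP).ssubset_of_ne hne)
  -- `b` is the cone with apex `v` over the faces of the interval that do not contain `v`.
  let b : Finset V → A := fun τ => if v ∈ τ ∧ lo k ⊆ τ ∧ τ ⊆ hi k then
    (-1) ^ ((τ.erase v).filter (· < v)).card * c (τ.erase v) else 0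
  have hb : SupportedOn (intervalFamily P lo hi (k + 1)) (n + 1) b := by
    intro τ hτ
    simp only [b]
    split_ifs with hif
    · rw [hc.1, mul_zero]
      rintro ⟨-, hcard⟩
      refine hτ ⟨⟨k, k.lt_succ_self, hP, hif.2⟩, ?_⟩
      rw [← hcard, Finset.card_erase_add_one hif.1]
    · rfl
  have hbb : ∀ τ, lo k ⊆ τ → τ ⊆ hi k → v ∉ τ → boundary A b τ = c τ := by
    intro τ h1 h2 h3
    rw [boundary_apply, Finset.sum_eq_single v]
    · simp only [b]
      rw [if_pos ⟨Finset.mem_insert_self _ _, h1.trans (Finset.subset_insert _ _),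
        Finset.insert_subset hv h2⟩, Finset.erase_insert h3, neg_one_pow_mul_self]
    · intro u _ huv
      simp only [b]
      rw [if_neg, mul_zero]
      rintro ⟨h4, -⟩
      rcases Finset.mem_insert.1 h4 with h5 | h5
      · exact huv h5.symm
      · exact h3 h5
    · intro h4
      exact absurd (Finset.mem_compl.2 h3) h4
  let e : Finset V → A := fun τ =>
    if τ ∈ intervalFamily P lo hi (k + 1) then boundary A b τ else 0
  have hcyc : IsRelCycle (intervalFamily P lo hi (k + 1)) n (c - e) := by
    constructor
    · intro τ hτ
      simp only [Pi.sub_apply, hc.1 τ hτ, e, zero_sub, neg_eq_zero]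
      split_ifs with hm
      · exact hb.boundary_of_card_ne fun hcard => hτ ⟨hm, hcard⟩
      · rfl
    · intro τ hτ
      rw [map_sub, Pi.sub_apply, hc.2 τ hτ, boundary_cut (h.convex_initial hk) hb hτ, sub_zero]
  -- Off `v` the cycle `c - e` vanishes by the choice of `b`, and its coefficient at a face `τ` that
  -- contains `v` is, up to sign, its boundary at `τ \ {v}`.
  have hint : ∀ τ, lo k ⊆ τ → τ ⊆ hi k → (c - e) τ = 0 := by
    have hfirst : ∀ τ, lo k ⊆ τ → τ ⊆ hi k → v ∉ τ → (c - e) τ = 0 := by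
      intro τ h1 h2 h3
      have hm : τ ∈ intervalFamily P lo hi (k + 1) := ⟨k, k.lt_succ_self, hP, h1, h2⟩
      simp only [Pi.sub_apply, e]
      rw [if_pos hm, hbb τ h1 h2 h3, sub_self]
    intro τ h1 h2
    by_cases h3 : v ∈ τ
    · have h1' : lo k ⊆ τ.erase v := fun w hw => Finset.mem_erase.2
        ⟨fun e => hv' (e ▸ hw), h1 hw⟩
      have h2' : τ.erase v ⊆ hi k := (Finset.erase_subset _ _).trans h2
      have hz := hcyc.2 (τ.erase v) ⟨k, k.lt_succ_self, hP, h1', h2'⟩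
      rw [boundary_apply, Finset.sum_eq_single v] at hz
      · rw [Finset.insert_erase h3] at hz
        rw [← neg_one_pow_mul_self ((τ.erase v).filter (· < v)).card ((c - e) τ), hz, mul_zero]
      · intro u hu huv
        rw [Finset.mem_compl] at hu
        by_cases hm : insert u (τ.erase v) ∈ intervalFamily P lo hi (k + 1)
        · rcases mem_family_succ hm with hm | ⟨-, hm⟩
          · exact absurd hm
              (h.notMem_of_lo_subset hk hP (h1'.trans (Finset.subset_insert _ _)))
          · rw [hfirst _ hm.1 hm.2, mul_zero]
            simp [huv.symm]
        · rw [hcyc.1 _ fun hh => hm hh.1, mul_zero]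
      · intro h4
        simp at h4
    · exact hfirst τ h1 h2 h3
  refine ⟨b, c - e, hb, ⟨fun τ hτ => ?_, fun τ hτ => hcyc.2 τ (family_mono k hτ)⟩,
    fun τ hτ => ?_⟩
  · by_cases hm : τ ∈ intervalFamily P lo hi (k + 1) ∧ τ.card = n
    · rcases mem_family_succ hm.1 with hm' | ⟨-, hm'⟩
      · exact absurd ⟨hm', hm.2⟩ hτ
      · exact hint τ hm'.1 hm'.2
    · exact hcyc.1 τ hm
  · simp only [Pi.sub_apply, e]
    rw [if_pos hτ]
    ring

/-- A top-dimensional cycle avoids the last interval unless this is a single set. -/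
lemma relCycle_of_ne {k : ℕ} (hk : k < m) (hP : P k) (hne : lo k ≠ hi k)
    {c : Finset V → A} (hc : IsRelCycle (intervalFamily P lo hi (k + 1)) d c) :
    IsRelCycle (intervalFamily P lo hi k) d c := by
  obtain ⟨b, c', hb, hc', hcc⟩ := h.exists_boundary_of_ne hk hP hne hc
  have hb0 : b = 0 := by
    funext τ
    refine hb τ ?_
    rintro ⟨⟨i, hi, hPi, hh⟩, hcard⟩
    have := Finset.card_le_card hh.2
    rw [h.card_eq i (by omega) hPi] at this
    omega
  have : c = c' := by
    funext τ
    by_cases hm : τ ∈ intervalFamily P lo hi (k + 1)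
    · simp [hcc τ hm, hb0]
    · rw [hc.1 τ fun hh => hm hh.1, hc'.1 τ fun hh => hm (family_mono k hh.1)]
  rwa [this]

/-- Shelling computes homology: the homology of the union is concentrated in the top degree, and
there it has one generator for each interval that is a single set. -/
lemma homology_initial : ∀ k ≤ m,
    (∀ n ≠ d, ∀ c : Finset V → A, IsRelCycle (intervalFamily P lo hi k) n c →
      ∃ b : Finset V → A, SupportedOn (intervalFamily P lo hi k) (n + 1) b ∧
        ∀ τ ∈ intervalFamily P lo hi k, boundary A b τ = c τ) ∧
    ((∀ i < k, P i → lo i ≠ hi i) →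
      ∀ c : Finset V → A, IsRelCycle (intervalFamily P lo hi k) d c → c = 0) ∧
    (∀ J < k, P J → lo J = hi J → (∀ i < k, P i → lo i = hi i → i = J) →
      ∃ z : Finset V → A, IsRelCycle (intervalFamily P lo hi k) d z ∧ z (hi J) = 1 ∧
        ∀ c, IsRelCycle (intervalFamily P lo hi k) d c → c = c (hi J) • z) := by
  classical
  intro k
  induction k with
  | zero =>
    intro _
    refine ⟨fun n _ c hc => ⟨0, fun _ _ => rfl, ?_⟩, fun _ c hc => ?_, ?_⟩
    · rintro τ ⟨i, hi, -⟩
      omega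
    · funext τ
      exact hc.1 τ fun ⟨⟨i, hi, _⟩, _⟩ => by omega
    · intro J hJ
      omega
  | succ k ih =>
    intro hk
    have hk' : k < m := hk
    obtain ⟨ih1, ih2, ih3⟩ := ih (Nat.le_of_succ_le hk)
    by_cases hP : P k
    swap
    · -- The `k`-th interval is not selected.
      rw [family_succ_of_not hP]
      have aux : ∀ J < k + 1, P J → J < k := fun J hJ hPJ =>
        lt_of_le_of_ne (Nat.le_of_lt_succ hJ) fun e => hP (e ▸ hPJ)
      exact ⟨ih1, fun hi => ih2 fun i hik => hi i (hik.trans k.lt_succ_self),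
        fun J hJ hPJ he hu => ih3 J (aux J hJ hPJ) hPJ he
          fun i hik => hu i (hik.trans k.lt_succ_self)⟩
    have hsub := family_mono (P := P) (lo := lo) (hi := hi) k
    by_cases hne : lo k = hi k
    · -- The last interval is the single set `hi k`, which closes a new cycle.
      have hnew : ∀ τ, lo k ⊆ τ → τ ⊆ hi k → τ = hi k := fun τ h1 h2 =>
        Finset.Subset.antisymm h2 (hne ▸ h1)
      have hcard := h.card_eq k hk' hP
      have hrestrict : ∀ n (c : Finset V → A),
          IsRelCycle (intervalFamily P lo hi (k + 1)) n c → c (hi k) = 0 →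
          IsRelCycle (intervalFamily P lo hi k) n c := by
        refine fun n c hc h0 => ⟨fun τ hτ => ?_, fun τ hτ => hc.2 τ (hsub hτ)⟩
        by_cases hm : τ ∈ intervalFamily P lo hi (k + 1) ∧ τ.card = n
        · rcases mem_family_succ hm.1 with hm' | ⟨-, hm'⟩
          · exact absurd ⟨hm', hm.2⟩ hτ
          · rw [hnew τ hm'.1 hm'.2, h0]
        · exact hc.1 τ hm
      have hlo : lo k ⊆ hi k := hne.le
      refine ⟨fun n hn c hc => ?_, fun hi => absurd hne (hi k k.lt_succ_self hP), ?_⟩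
      · have h0 : c (hi k) = 0 := hc.1 _ fun hh => hn (hh.2 ▸ hcard)
        obtain ⟨b, hb, hbc⟩ := ih1 n hn c (hrestrict n c hc h0)
        refine ⟨b, hb.mono hsub, fun τ hτ => ?_⟩
        rcases mem_family_succ hτ with hτ | ⟨-, h1, h2⟩
        · exact hbc τ hτ
        · rw [h.boundary_eq_zero hk' hP hb h1, hnew τ h1 h2, h0]
      · intro J hJ hPJ he hu
        obtain rfl : k = J := hu k k.lt_succ_self hP hne
        -- The boundary of the new set `hi k` is a cycle below the top degree, hence the boundary of
        -- a chain `b` of the earlier intervals, and `hi k - b` is the fundamental cycle.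
        let e : Finset V → A := Pi.single (hi k) 1
        have hfam : intervalFamily P lo hi (k + 1) = insert (hi k) (intervalFamily P lo hi k) := by
          ext τ
          refine ⟨fun hτ => ?_, fun hτ => ?_⟩
          · rcases mem_family_succ hτ with hτ | ⟨-, h1, h2⟩
            · exact Or.inr hτ
            · exact Or.inl (hnew τ h1 h2)
          · rcases hτ with rfl | hτ
            · exact ⟨k, k.lt_succ_self, hP, hlo, subset_rfl⟩
            · exact hsub hτ
        have hesupp : SupportedOn (intervalFamily P lo hi (k + 1)) d e := by
          intro τ hτ
          refine Pi.single_eq_of_ne (fun he' => hτ ?_) _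
          rw [he', hfam]
          exact ⟨Or.inl rfl, hcard⟩
        have hb0 : ∃ b : Finset V → A, SupportedOn (intervalFamily P lo hi k) d b ∧
            ∀ τ ∈ intervalFamily P lo hi k, boundary A b τ = boundary A e τ := by
          cases d with
          | zero =>
            refine ⟨0, fun _ _ => rfl, fun τ hτ => ?_⟩
            rw [map_zero, Pi.zero_apply, boundary_apply]
            refine (Finset.sum_eq_zero fun u _ => ?_).symm
            rw [hesupp, mul_zero]
            rintro ⟨-, hcard⟩
            simp at hcard
          | succ n =>
            obtain ⟨b, hb, hbc⟩ := ih1 n (by omega)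
              (fun τ => if τ ∈ intervalFamily P lo hi k then boundary A e τ else 0) <| by
              refine ⟨fun τ hτ => ?_, fun τ hτ => ?_⟩
              · dsimp only
                split_ifs with hm
                · exact hesupp.boundary_of_card_ne fun hh => hτ ⟨hm, hh⟩
                · rfl
              · refine Eq.trans ?_ (boundary_cut (h.convex_initial hk) hesupp (hsub hτ))
                rw [boundary_apply, boundary_apply]
                refine Finset.sum_congr rfl fun u hu => ?_
                have hbound : boundary A e (hi k) = 0 :=
                  hesupp.boundary_of_card_ne (by rw [hcard]; omega)
                congr 1
                by_cases hm : insert u τ ∈ intervalFamily P lo hi k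
                · rw [if_pos hm, if_pos (hsub hm)]
                · rw [if_neg hm]
                  split_ifs with hm'
                  · rw [hfam] at hm'
                    rcases hm' with hm' | hm'
                    · rw [hm', hbound]
                    · exact absurd hm' hm
                  · rfl
            exact ⟨b, hb, fun τ hτ => (hbc τ hτ).trans (if_pos hτ)⟩
        obtain ⟨b, hb, hbe⟩ := hb0
        have hz : IsRelCycle (intervalFamily P lo hi (k + 1)) d (e - b) := by
          refine ⟨fun τ hτ => ?_, fun τ hτ => ?_⟩
          · rw [Pi.sub_apply, hesupp τ hτ, hb.mono hsub τ hτ, sub_zero]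
          · rw [map_sub, Pi.sub_apply]
            rcases mem_family_succ hτ with hτ | ⟨-, h1, h2⟩
            · rw [hbe τ hτ, sub_self]
            · rw [h.boundary_eq_zero hk' hP hb h1, hnew τ h1 h2, sub_zero, boundary_apply]
              refine Finset.sum_eq_zero fun u hu => ?_
              rw [hesupp, mul_zero]
              rintro ⟨-, hc'⟩
              rw [Finset.card_insert_of_notMem (Finset.mem_compl.1 hu), hcard] at hc'
              omega
        have hz1 : (e - b) (hi k) = 1 := by
          rw [Pi.sub_apply, hb _ fun hh => h.notMem_of_lo_subset hk' hP hlo hh.1, sub_zero]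
          exact Pi.single_eq_same _ _
        refine ⟨e - b, hz, hz1, fun c hc => ?_⟩
        have hnone : ∀ i < k, P i → lo i ≠ hi i := fun i hik hPi he' =>
          hik.ne (hu i (hik.trans k.lt_succ_self) hPi he')
        have hzero := ih2 hnone (c - c (hi k) • (e - b)) <| by
          refine hrestrict _ _ ⟨fun τ hτ => ?_, fun τ hτ => ?_⟩ ?_
          · rw [Pi.sub_apply, Pi.smul_apply, hc.1 τ hτ, hz.1 τ hτ, smul_zero, sub_zero]
          · rw [map_sub, map_smul, Pi.sub_apply, Pi.smul_apply, hc.2 τ hτ, hz.2 τ hτ, smul_zero,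
              sub_zero]
          · rw [Pi.sub_apply, Pi.smul_apply, hz1, smul_eq_mul, mul_one, sub_self]
        exact sub_eq_zero.1 hzero
    · -- The last interval is a cone and does not contribute.
      refine ⟨fun n hn c hc => ?_, fun hi c hc => ?_, ?_⟩
      · obtain ⟨b, c', hb, hc', hcc⟩ := h.exists_boundary_of_ne hk' hP hne hc
        obtain ⟨b', hb', hbc'⟩ := ih1 n hn c' hc'
        refine ⟨b + b', fun τ hτ => ?_, fun τ hτ => ?_⟩
        · rw [Pi.add_apply, hb τ hτ, hb'.mono hsub τ hτ, add_zero]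
        · rw [map_add, Pi.add_apply, hcc τ hτ]
          congr 1
          rcases mem_family_succ hτ with hτ | ⟨-, h1, h2⟩
          · exact hbc' τ hτ
          · rw [h.boundary_eq_zero hk' hP hb' h1,
              hc'.1 τ fun hh => h.notMem_of_lo_subset hk' hP h1 hh.1]
      · exact ih2 (fun i hik => hi i (hik.trans k.lt_succ_self)) c
          (h.relCycle_of_ne hk' hP hne hc)
      · intro J hJ hPJ he hu
        have hJk : J < k := lt_of_le_of_ne (Nat.le_of_lt_succ hJ) fun e => hne (e ▸ he)
        obtain ⟨z, hz, hz1, hz2⟩ := ih3 J hJk hPJ he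
          fun i hik => hu i (hik.trans k.lt_succ_self)
        refine ⟨z, ⟨hz.1.mono hsub, fun τ hτ => ?_⟩, hz1,
          fun c hc => hz2 c (h.relCycle_of_ne hk' hP hne hc)⟩
        rcases mem_family_succ hτ with hτ | ⟨-, h1, h2⟩
        · exact hz.2 τ hτ
        · exact h.boundary_eq_zero hk' hP hz.1 h1

/-- Below the top degree, cycles are boundaries. -/
theorem exists_boundary_eq {n : ℕ} (hn : n ≠ d) {c : Finset V → A}
    (hc : IsRelCycle (intervalFamily P lo hi m) n c) :
    ∃ b : Finset V → A, SupportedOn (intervalFamily P lo hi m) (n + 1) b ∧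
      ∀ τ ∈ intervalFamily P lo hi m, boundary A b τ = c τ :=
  (h.homology_initial m le_rfl).1 n hn c hc

/-- If exactly one interval is a single set, the top-dimensional cycles are the multiples of a
cycle that has the coefficient `1` at this set. -/
theorem exists_fundamental_cycle {J : ℕ} (hJ : J < m) (hP : P J) (he : lo J = hi J)
    (hu : ∀ i < m, P i → lo i = hi i → i = J) :
    ∃ z : Finset V → A, IsRelCycle (intervalFamily P lo hi m) d z ∧ z (hi J) = 1 ∧
      ∀ c, IsRelCycle (intervalFamily P lo hi m) d c → c = c (hi J) • z :=
  (h.homology_initial m le_rfl).2.2 J hJ hP he hu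

end IsStacked

end Homology

/-! ### Links and stars in a shelled sphere -/

section Links

set_option linter.unusedSectionVars false

variable {V : Type} [Fintype V] [LinearOrder V]

/-- The faces of `Δ` that contain `σ`. -/
def star (Δ : LowerSet (Finset V)) (σ : Finset V) : Set (Finset V) := {τ | τ ∈ Δ ∧ σ ⊆ τ}

/-- The coboundary of a cochain, the transpose of `boundary`. -/
def coboundary {A : Type} [CommRing A] (c : Finset V → A) (G : Finset V) : A :=
  ∑ v ∈ G, (-1 : A) ^ (G.filter (· < v)).card * c (G.erase v)

lemma filter_lt_insert (G : Finset V) (v : V) :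
    (insert v G).filter (· < v) = G.filter (· < v) := by
  rw [Finset.filter_insert, if_neg (lt_irrefl v)]

/-- The coboundary is adjoint to the boundary. -/
theorem sum_mul_boundary {A : Type} [CommRing A] (c b : Finset V → A) :
    ∑ τ, c τ * boundary A b τ = ∑ G, coboundary c G * b G := by
  simp only [boundary_apply, coboundary, Finset.mul_sum, Finset.sum_mul]
  rw [Finset.sum_sigma', Finset.sum_sigma']
  refine Finset.sum_bij' (fun p _ => ⟨insert p.2 p.1, p.2⟩) (fun p _ => ⟨p.1.erase p.2, p.2⟩)
    ?_ ?_ ?_ ?_ ?_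
  · rintro ⟨τ, v⟩ _
    simp
  · rintro ⟨G, v⟩ _
    simp
  · rintro ⟨τ, v⟩ hp
    simp only [Finset.mem_sigma, Finset.mem_univ, true_and, Finset.mem_compl] at hp
    simp [Finset.erase_insert hp]
  · rintro ⟨G, v⟩ hp
    simp only [Finset.mem_sigma, Finset.mem_univ, true_and] at hp
    simp [Finset.insert_erase hp]
  · rintro ⟨τ, v⟩ hp
    simp only [Finset.mem_sigma, Finset.mem_univ, true_and, Finset.mem_compl] at hp
    simp only [filter_lt_insert, Finset.erase_insert hp]
    ring

namespace ReversibleShelling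

variable {Δ : LowerSet (Finset V)} {d m : ℕ} {F R : ℕ → Finset V}
  (h : ReversibleShelling Δ d m F R)
include h

lemma star_eq (σ : Finset V) :
    intervalFamily (fun i => σ ⊆ F i) (fun i => R i ∪ σ) F m = star Δ σ := by
  ext τ
  constructor
  · rintro ⟨i, hi, _, h1, h2⟩
    exact ⟨(h.mem_iff τ).2 ⟨i, hi, h2⟩, Finset.union_subset_right h1⟩
  · rintro ⟨hτ, hσ⟩
    obtain ⟨i, hi, h1, h2⟩ := h.exists_interval hτ
    exact ⟨i, hi, hσ.trans h2, Finset.union_subset h1 hσ, h2⟩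

lemma link_eq (σ : Finset V) :
    intervalFamily (fun i => σ ⊆ F i) (fun i => R i \ σ) (fun i => F i \ σ) m =
      (link Δ σ : Set (Finset V)) := by
  ext τ
  constructor
  · rintro ⟨i, hi, hσ, -, h2⟩
    refine ⟨Finset.disjoint_of_subset_left h2 Finset.sdiff_disjoint, ?_⟩
    exact (h.mem_iff _).2 ⟨i, hi, Finset.union_subset (h2.trans Finset.sdiff_subset) hσ⟩
  · rintro ⟨hd, hτ⟩
    obtain ⟨i, hi, h1, h2⟩ := h.exists_interval hτ
    refine ⟨i, hi, Finset.union_subset_right h2, fun v hv => ?_, fun v hv => ?_⟩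
    · rw [Finset.mem_sdiff] at hv
      exact (Finset.mem_union.1 (h1 hv.1)).resolve_right hv.2
    · exact Finset.mem_sdiff.2 ⟨h2 (Finset.mem_union_left _ hv),
        fun hv' => Finset.disjoint_left.1 hd hv hv'⟩

/-- The star of `σ` is stacked from the intervals of the facets that contain `σ`. -/
lemma star_stacked (σ : Finset V) :
    IsStacked (fun i => σ ⊆ F i) (fun i => R i ∪ σ) F d m where
  subset i hi hσ := Finset.union_subset (h.subset i hi) hσ
  card_eq i hi _ := h.card_eq i hi
  forward i j hij hj _ _ hsub := h.forward i j hij hj (Finset.union_subset_left hsub)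
  convex := by
    rw [h.star_eq]
    exact fun τ hτ τ'' hτ'' τ' h1 h2 => ⟨Δ.lower h2 hτ''.1, hτ.2.trans h1⟩

/-- The link of `σ` inherits the shelling of its star. -/
lemma link_stacked (σ : Finset V) :
    IsStacked (fun i => σ ⊆ F i) (fun i => R i \ σ) (fun i => F i \ σ) (d - σ.card) m where
  subset i hi _ := Finset.sdiff_subset_sdiff (h.subset i hi) subset_rfl
  card_eq i hi hσ := by rw [Finset.card_sdiff_of_subset hσ, h.card_eq i hi]
  forward i j hij hj hσ _ hsub := by
    refine h.forward i j hij hj fun v hv => ?_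
    by_cases hvσ : v ∈ σ
    · exact hσ hvσ
    · exact (Finset.mem_sdiff.1 (hsub (Finset.mem_sdiff.2 ⟨hv, hvσ⟩))).1
  convex := by
    rw [h.link_eq]
    exact fun _ _ τ'' hτ'' τ' _ h2 => (link Δ σ).lower h2 hτ''

/-- The star of a face has a fundamental cycle: the intervals of the reversed shelling show that
exactly one of its intervals is a single set. -/
lemma star_fundamental_cycle (A : Type) [CommRing A] {σ : Finset V} (hσ : σ ∈ Δ) :
    ∃ z : Finset V → A, ∃ i < m, IsRelCycle (star Δ σ) d z ∧ z (F i) = 1 ∧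
      ∀ c, IsRelCycle (star Δ σ) d c → c = c (F i) • z := by
  obtain ⟨i, hi, h1, h2⟩ := h.exists_dual_interval hσ
  have hcrit : ∀ j, σ ⊆ F j → R j ∪ σ = F j → F j \ R j ⊆ σ := fun j _ he v hv => by
    rw [Finset.mem_sdiff, ← he, Finset.mem_union] at hv
    exact hv.1.resolve_left hv.2
  obtain ⟨z, hz⟩ := (h.star_stacked σ).exists_fundamental_cycle (A := A) hi h2
    (Finset.Subset.antisymm (Finset.union_subset (h.subset i hi) h2) fun v hv => by
      by_cases hvR : v ∈ R i
      · exact Finset.mem_union_left _ hvR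
      · exact Finset.mem_union_right _ (h1 (Finset.mem_sdiff.2 ⟨hv, hvR⟩)))
    fun j hj hPj he => h.dual_interval_unique hj hi (hcrit j hPj he) hPj h1 h2
  rw [h.star_eq] at hz
  exact ⟨z, i, hi, hz⟩

lemma link_fundamental_cycle (A : Type) [CommRing A] {σ : Finset V} (hσ : σ ∈ Δ) :
    ∃ (z : Finset V → A) (T : Finset V), IsRelCycle (link Δ σ : Set (Finset V)) (d - σ.card) z ∧
      z T = 1 ∧
      ∀ c, IsRelCycle (link Δ σ : Set (Finset V)) (d - σ.card) c → c = c T • z := by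
  obtain ⟨i, hi, h1, h2⟩ := h.exists_dual_interval hσ
  have hcrit : ∀ j < m, R j \ σ = F j \ σ → F j \ R j ⊆ σ := fun j _ he v hv => by
    by_contra hvσ
    rw [Finset.mem_sdiff] at hv
    have : v ∈ R j \ σ := he ▸ Finset.mem_sdiff.2 ⟨hv.1, hvσ⟩
    exact hv.2 (Finset.mem_sdiff.1 this).1
  obtain ⟨z, hz⟩ := (h.link_stacked σ).exists_fundamental_cycle (A := A) hi h2
    (Finset.Subset.antisymm (Finset.sdiff_subset_sdiff (h.subset i hi) subset_rfl) fun v hv => by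
      rw [Finset.mem_sdiff] at hv ⊢
      refine ⟨?_, hv.2⟩
      by_contra hvR
      exact hv.2 (h1 (Finset.mem_sdiff.2 ⟨hv.1, hvR⟩)))
    fun j hj hPj he => h.dual_interval_unique hj hi (hcrit j hj he) hPj h1 h2
  rw [h.link_eq] at hz
  exact ⟨z, _, hz⟩

end ReversibleShelling

/-- The chain complex of a subcomplex is the one of its set of faces. -/
lemma mem_cycles_iff {A : Type} [CommRing A] {Γ : LowerSet (Finset V)} {n : ℕ}
    {c : Finset V → A} : c ∈ cycles A Γ n ↔ IsRelCycle (Γ : Set (Finset V)) n c := by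
  constructor
  · rintro ⟨h1, h2⟩
    exact ⟨h1, fun τ _ => congrFun (LinearMap.mem_ker.1 h2) τ⟩
  · rintro ⟨h1, h2⟩
    refine ⟨h1, LinearMap.mem_ker.2 (funext fun τ => ?_)⟩
    by_cases hτ : τ ∈ Γ
    · exact h2 τ hτ
    · rw [boundary_apply]
      refine Finset.sum_eq_zero fun v _ => ?_
      rw [h1 _ fun hv => hτ (Γ.lower (Finset.subset_insert v τ) hv.1), mul_zero]

/-- A complex with a reversible shelling is a homology sphere over every ring, since its links are
stacked and have a fundamental cycle. -/
theorem ReversibleShelling.isHomologySphere {Δ : LowerSet (Finset V)} {d m : ℕ}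
    {F R : ℕ → Finset V} (h : ReversibleShelling Δ (d + 1) m F R) (A : Type) [CommRing A] :
    IsHomologySphere A Δ d := by
  refine ⟨h.empty_mem, fun σ hσ n => ⟨fun hn => ?_, fun hn => ?_⟩⟩
  · obtain ⟨z, T, hz, hz1, hz2⟩ := h.link_fundamental_cycle A hσ
    rw [show d + 1 - σ.card = n by omega] at hz hz2
    have hbot : (boundaries A (link Δ σ) n).submoduleOf (cycles A (link Δ σ) n) = ⊥ := by
      rw [eq_bot_iff]
      rintro ⟨c, hc⟩ hcb
      obtain ⟨b, hb, rfl⟩ := Submodule.mem_map.1 (Submodule.mem_comap.1 hcb)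
      have hb0 : b = 0 := by
        funext τ
        refine hb τ ?_
        rintro ⟨⟨hd, hτ⟩, hcard⟩
        have := h.card_le hτ
        rw [Finset.card_union_of_disjoint hd] at this
        omega
      simp [hb0]
    let e : cycles A (link Δ σ) n ≃ₗ[A] A :=
      LinearEquiv.ofLinearMap ((LinearMap.proj T).comp (Submodule.subtype _))
        (LinearMap.toSpanSingleton A _ ⟨z, mem_cycles_iff.2 hz⟩) (by ext; simp [hz1])
        (LinearMap.ext fun c => Subtype.ext (hz2 c (mem_cycles_iff.1 c.2)).symm)
    exact ⟨(Submodule.quotEquivOfEqBot _ hbot).trans e⟩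
  · rw [Submodule.Quotient.subsingleton_iff, eq_top_iff]
    rintro ⟨c, hc⟩ -
    have hle := h.card_le hσ
    have hcyc := mem_cycles_iff.1 hc
    rw [← h.link_eq] at hcyc
    obtain ⟨b, hb, hbc⟩ := (h.link_stacked σ).exists_boundary_eq (by omega) hcyc
    rw [h.link_eq] at hb hbc hcyc
    refine Submodule.mem_comap.2 (Submodule.mem_map.2 ⟨b, hb, funext fun τ => ?_⟩)
    by_cases hτ : τ ∈ (link Δ σ : Set (Finset V))
    · exact hbc τ hτ
    · change boundary A b τ = c τ
      rw [hcyc.1 τ fun hh => hτ hh.1, boundary_apply]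
      refine Finset.sum_eq_zero fun v _ => ?_
      rw [hb _ fun hv => hτ ((link Δ σ).lower (Finset.subset_insert v τ) hv.1), mul_zero]

section Cochains

variable {k : Type} [Field k]

/-- By duality, a cochain of a family of faces is a coboundary if it vanishes on all cycles. -/
theorem exists_coboundary_eq_of_sum_eq_zero (𝓕 : Set (Finset V)) (n : ℕ) (c : Finset V → k)
    (hc : ∀ z : Finset V → k, IsRelCycle 𝓕 n z → ∑ τ, c τ * z τ = 0) :
    ∃ b : Finset V → k, (∀ G ∉ 𝓕, b G = 0) ∧
      ∀ τ ∈ 𝓕, τ.card = n → coboundary b τ = c τ := by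
  classical
  -- The functional `φ` given by `c` vanishes on the kernel of the differential `D` of the family,
  -- so it factors through `D`.
  let cut : (Finset V → k) →ₗ[k] (Finset V → k) := LinearMap.pi fun τ =>
    if τ ∈ 𝓕 ∧ τ.card = n then LinearMap.proj τ else 0
  let cut' : (Finset V → k) →ₗ[k] (Finset V → k) := LinearMap.pi fun τ =>
    if τ ∈ 𝓕 then LinearMap.proj τ else 0
  have hcut : ∀ x τ, cut x τ = if τ ∈ 𝓕 ∧ τ.card = n then x τ else 0 := fun x τ => by
    simp only [cut, LinearMap.pi_apply]
    split_ifs <;> rfl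
  have hcut' : ∀ x τ, cut' x τ = if τ ∈ 𝓕 then x τ else 0 := fun x τ => by
    simp only [cut', LinearMap.pi_apply]
    split_ifs <;> rfl
  let D : (Finset V → k) →ₗ[k] (Finset V → k) := cut' ∘ₗ boundary k ∘ₗ cut
  let φ : Module.Dual k (Finset V → k) := (∑ τ, c τ • LinearMap.proj τ) ∘ₗ cut
  have hφ : ∀ x, φ x = ∑ τ, c τ * cut x τ := fun x => by
    simp [φ]
  have hmem : φ ∈ (LinearMap.ker D).dualAnnihilator := by
    rw [Submodule.mem_dualAnnihilator]
    intro x hx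
    rw [hφ]
    refine hc _ ⟨fun τ hτ => by rw [hcut, if_neg hτ], fun τ hτ => ?_⟩
    have := congrFun (LinearMap.mem_ker.1 hx) τ
    simp only [D, LinearMap.comp_apply] at this
    rwa [hcut', if_pos hτ] at this
  rw [← LinearMap.range_dualMap_eq_dualAnnihilator_ker] at hmem
  obtain ⟨β, hβ⟩ := hmem
  let b : Finset V → k := fun G => if G ∈ 𝓕 then β (Pi.single G 1) else 0
  refine ⟨b, fun G hG => if_neg hG, fun τ hτ hτn => ?_⟩
  have hβsum : ∀ x : Finset V → k, β x = ∑ G, x G * β (Pi.single G 1) := fun x => by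
    conv_lhs => rw [pi_eq_sum_univ' x]
    simp [map_sum]
  have h1 := LinearMap.congr_fun hβ (Pi.single τ 1)
  have h2 : cut (Pi.single τ 1) = Pi.single τ 1 := by
    funext G
    rw [hcut]
    by_cases hG : G = τ
    · subst hG
      rw [if_pos ⟨hτ, hτn⟩]
    · simp [Pi.single_eq_of_ne hG]
  rw [LinearMap.dualMap_apply, hφ, h2, hβsum] at h1
  have h3 : ∑ G, D (Pi.single τ 1) G * β (Pi.single G 1) =
      ∑ G, b G * boundary k (Pi.single τ 1) G := by
    refine Finset.sum_congr rfl fun G _ => ?_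
    simp only [D, LinearMap.comp_apply, h2, hcut', b]
    split_ifs
    · ring
    · simp
  rw [h3, sum_mul_boundary] at h1
  simpa [Pi.single_apply] using h1

namespace ReversibleShelling

variable {Δ : LowerSet (Finset V)} {d m : ℕ} {F R : ℕ → Finset V}
  (h : ReversibleShelling Δ d m F R)
include h

/-- Below the top degree, cocycles of stars are coboundaries. -/
theorem exists_coboundary_eq (σ : Finset V) {n : ℕ} (hn : n ≠ d) (c : Finset V → k)
    (hsupp : SupportedOn (star Δ σ) n c)
    (hc : ∀ τ ∈ star Δ σ, τ.card = n + 1 → coboundary c τ = 0) :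
    ∃ b : Finset V → k, (∀ G ∉ star Δ σ, b G = 0) ∧
      ∀ τ ∈ star Δ σ, τ.card = n → coboundary b τ = c τ := by
  refine exists_coboundary_eq_of_sum_eq_zero _ n c fun z hz => ?_
  rw [← h.star_eq] at hz
  obtain ⟨b, hb, hbz⟩ := (h.star_stacked σ).exists_boundary_eq hn hz
  rw [h.star_eq] at hb hbz
  have h1 : ∑ τ, c τ * z τ = ∑ τ, c τ * boundary k b τ := by
    refine Finset.sum_congr rfl fun τ _ => ?_
    by_cases hτ : τ ∈ star Δ σ
    · rw [hbz τ hτ]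
    · rw [hsupp τ fun hh => hτ hh.1, zero_mul, zero_mul]
  rw [h1, sum_mul_boundary]
  refine Finset.sum_eq_zero fun G _ => ?_
  by_cases hG : G ∈ star Δ σ ∧ G.card = n + 1
  · rw [hc G hG.1 hG.2, zero_mul]
  · rw [hb G hG, mul_zero]

/-- An orientation: a cycle none of whose coefficients on the facets vanishes. -/
theorem exists_orientation (k : Type) [Field k] :
    ∃ ε : Finset V → k, SupportedOn (Δ : Set (Finset V)) d ε ∧ boundary k ε = 0 ∧
      ∀ i < m, ε (F i) ≠ 0 := by
  obtain ⟨ε, i₀, hi₀, hε, h1, -⟩ := h.star_fundamental_cycle k h.empty_mem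
  have hstar : star Δ ∅ = (Δ : Set (Finset V)) := by
    ext τ
    simp [star]
  rw [hstar] at hε
  have hbd : boundary k ε = 0 := LinearMap.mem_ker.1 (mem_cycles_iff.2 hε).2
  refine ⟨ε, hε.1, hbd, fun i hi => ?_⟩
  -- The boundary of `ε` at the common ridge of two facets involves only these two coefficients.
  have one_dir : ∀ i < m, ∀ j < m, ∀ v ∈ F i, i ≠ j → (F i).erase v ⊆ F j →
      ε (F i) = 0 → ε (F j) = 0 := by
    intro i hi j hj v hv hij hs h0
    obtain ⟨w, hw, hwv, he, hu⟩ := h.exists_neighbour hi hj hij hv hs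
    have hb := congrFun hbd ((F i).erase v)
    rw [boundary_apply, Finset.sum_eq_single w] at hb
    · rw [← he, Finset.insert_erase hw, Pi.zero_apply] at hb
      rw [← neg_one_pow_mul_self (((F j).erase w).filter (· < w)).card (ε (F j)), hb, mul_zero]
    · intro u huc huw
      rw [Finset.mem_compl] at huc
      by_cases hm : insert u ((F i).erase v) ∈ Δ
      · rw [(hu u huc hm).resolve_right huw, Finset.insert_erase hv, h0, mul_zero]
      · rw [hε.1 _ fun hh => hm hh.1, mul_zero]
    · intro hwc
      rw [Finset.mem_compl, not_not, ← he] at hwc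
      simp at hwc
  refine h.star_connected (σ := ∅) (fun i => ε (F i) ≠ 0) ?_ hi₀ hi (Finset.empty_subset _)
    (Finset.empty_subset _) (by rw [h1]; exact one_ne_zero)
  intro i hi j hj v hv _ hij hs _ _
  obtain ⟨w, hw, -, he, -⟩ := h.exists_neighbour hi hj hij hv hs
  exact not_congr ⟨one_dir i hi j hj v hv hij hs,
    one_dir j hj i hi w hw hij.symm (he ▸ Finset.erase_subset _ _)⟩

/-- In the top degree, a cochain of a star is a coboundary if it vanishes on the orientation. -/
theorem exists_coboundary_eq_top (σ : Finset V) {ε : Finset V → k}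
    (hε : SupportedOn (Δ : Set (Finset V)) d ε) (hbd : boundary k ε = 0)
    (hne : ∀ i < m, ε (F i) ≠ 0) (c : Finset V → k)
    (hsupp : SupportedOn (star Δ σ) d c) (hc : ∑ τ, c τ * ε τ = 0) :
    ∃ b : Finset V → k, (∀ G ∉ star Δ σ, b G = 0) ∧
      ∀ τ ∈ star Δ σ, τ.card = d → coboundary b τ = c τ := by
  classical
  by_cases hσ : σ ∈ Δ
  swap
  · exact ⟨0, fun _ _ => rfl, fun τ hτ => absurd (Δ.lower hτ.2 hτ.1) hσ⟩
  refine exists_coboundary_eq_of_sum_eq_zero _ d c fun z hz => ?_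
  obtain ⟨z₀, i, hi, -, -, hz₀⟩ := h.star_fundamental_cycle k hσ
  -- The fundamental cycle of the star is the restriction of the orientation, up to a factor.
  let ε' : Finset V → k := fun τ => if τ ∈ star Δ σ then ε τ else 0
  have hε' : IsRelCycle (star Δ σ) d ε' := by
    refine ⟨fun τ hτ => ?_, fun τ hτ => ?_⟩
    · simp only [ε']
      split_ifs with hm
      · exact hε τ fun hh => hτ ⟨hm, hh.2⟩
      · rfl
    · refine Eq.trans ?_ (congrFun hbd τ)
      rw [boundary_apply, boundary_apply]
      refine Finset.sum_congr rfl fun v _ => ?_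
      congr 1
      simp only [ε']
      split_ifs with hm
      · rfl
      · refine (hε _ fun hh => hm ⟨hh.1, hτ.2.trans (Finset.subset_insert _ _)⟩).symm
  have hsum : ∑ τ, c τ * ε' τ = 0 := by
    rw [← hc]
    refine Finset.sum_congr rfl fun τ _ => ?_
    simp only [ε']
    split_ifs with hm
    · rfl
    · rw [hsupp τ fun hh => hm hh.1, zero_mul, zero_mul]
  have hi' : ε' (F i) ≠ 0 := by
    intro h0
    have h1 := hz₀ ε' hε'
    rw [h0, zero_smul] at h1
    obtain ⟨j, hj, hs⟩ := (h.mem_iff σ).1 hσ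
    have h2 := congrFun h1 (F j)
    simp only [ε', if_pos (show F j ∈ star Δ σ from ⟨h.facet_mem hj, hs⟩), Pi.zero_apply] at h2
    exact hne j hj h2
  have hzε : z = (z (F i) / ε' (F i)) • ε' := by
    rw [hz₀ z hz]
    conv_rhs => rw [hz₀ ε' hε']
    rw [smul_smul]
    have h1 : z₀ (F i) = 1 := by
      have := congrFun (hz₀ ε' hε') (F i)
      simp only [Pi.smul_apply, smul_eq_mul] at this
      exact (mul_left_cancel₀ hi' ((mul_one _).trans this)).symm
    simp [h1, hi']
  rw [hzε]
  have : ∀ x, c x * (z (F i) / ε' (F i) * ε' x) = z (F i) / ε' (F i) * (c x * ε' x) :=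
    fun x => mul_left_comm _ _ _
  simp only [Pi.smul_apply, smul_eq_mul, this]
  rw [← Finset.mul_sum, hsum, mul_zero]

end ReversibleShelling

end Cochains

end Links

/-! ### The linear resolution of the Alexander dual ideal -/

section Resolution

set_option linter.unusedSectionVars false

open MvPolynomial

variable {V : Type} [Fintype V] [LinearOrder V] {k : Type} [Field k]

/-- The product of the variables outside `σ`. -/
noncomputable def coMonomial (k : Type) [Field k] (σ : Finset V) : MvPolynomial V k :=
  ∏ i ∈ σᶜ, X i

lemma prod_X_eq_monomial (s : Finset V) :
    ∏ i ∈ s, (X i : MvPolynomial V k) = monomial (∑ i ∈ s, Finsupp.single i 1) 1 := by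
  rw [monomial_sum_one]
  rfl

lemma sum_single_one_le (s : Finset V) (b : V →₀ ℕ) :
    ∑ i ∈ s, Finsupp.single i 1 ≤ b ↔ s ⊆ b.support := by
  have happ : ∀ v, (∑ i ∈ s, Finsupp.single i 1 : V →₀ ℕ) v = if v ∈ s then 1 else 0 := fun v => by
    simp [Finsupp.finsetSum_apply, Finsupp.single_apply]
  constructor
  · intro hle v hv
    have := hle v
    rw [happ, if_pos hv] at this
    rw [Finsupp.mem_support_iff]
    omega
  · intro hs v
    rw [happ]
    split_ifs with hv
    · exact Nat.one_le_iff_ne_zero.2 (Finsupp.mem_support_iff.1 (hs hv))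
    · exact Nat.zero_le _

lemma coMonomial_ne_zero (σ : Finset V) : coMonomial k σ ≠ 0 :=
  Finset.prod_ne_zero_iff.2 fun i _ => X_ne_zero i

lemma coMonomial_mul_X {σ : Finset V} {v : V} (hv : v ∈ σ) :
    coMonomial k σ * X v = coMonomial k (σ.erase v) := by
  rw [coMonomial, coMonomial, Finset.compl_erase, Finset.prod_insert (by simpa using hv), mul_comm]

lemma compl_subset_support {σ : Finset V} {p : MvPolynomial V k} {b : V →₀ ℕ}
    (hb : coeff b (coMonomial k σ * p) ≠ 0) : σᶜ ⊆ b.support := by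
  rw [coMonomial, prod_X_eq_monomial, coeff_monomial_mul'] at hb
  exact (sum_single_one_le _ _).1 (by_contra fun h => hb (if_neg h))

lemma coMonomial_dvd {σ : Finset V} {p : MvPolynomial V k}
    (hp : ∀ b, coeff b p ≠ 0 → σᶜ ⊆ b.support) : coMonomial k σ ∣ p := by
  rw [p.as_sum]
  refine Finset.dvd_sum fun b hb => ?_
  rw [coMonomial, prod_X_eq_monomial, monomial_dvd_monomial]
  exact ⟨Or.inr ((sum_single_one_le _ _).2 (hp b (mem_support_iff.1 hb))), one_dvd _⟩

lemma coboundary_coboundary {A : Type} [CommRing A] (c : Finset V → A) :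
    coboundary (coboundary c) = 0 := by
  funext G
  have h1 := sum_mul_boundary (coboundary c) (Pi.single G 1)
  rw [← sum_mul_boundary, boundary_boundary] at h1
  simpa [Pi.single_apply] using h1.symm

lemma coeff_coboundary (c : Finset V → MvPolynomial V k) (G : Finset V) (b : V →₀ ℕ) :
    coeff b (coboundary c G) = coboundary (fun τ => coeff b (c τ)) G := by
  simp only [coboundary, coeff_sum]
  refine Finset.sum_congr rfl fun v _ => ?_
  rw [show (-1 : MvPolynomial V k) = C (-1) by simp, ← C_pow, coeff_C_mul]

lemma boundary_C (c : Finset V → k) (G : Finset V) :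
    boundary (MvPolynomial V k) (fun τ => C (c τ)) G = C (boundary k c G) := by
  simp [boundary_apply, map_sum]

/-- A cochain with polynomial coefficients, the coefficient of `τ` being divisible by `x^(V \ τ)`,
is a coboundary of such a cochain if this is true for each of its coefficient vectors. -/
lemma exists_lift_coboundary {Δ : LowerSet (Finset V)} {q : ℕ} (c : Finset V → MvPolynomial V k)
    (hsupp : ∀ τ, ∀ b, coeff b (c τ) ≠ 0 → τᶜ ⊆ b.support)
    (hb : ∀ b : V →₀ ℕ, ∃ β : Finset V → k, (∀ G ∉ star Δ b.supportᶜ, β G = 0) ∧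
      ∀ τ ∈ star Δ b.supportᶜ, τ.card = q → coboundary β τ = coeff b (c τ)) :
    ∃ w : Finset V → MvPolynomial V k,
      ∀ τ ∈ Δ, τ.card = q → coboundary (fun G => coMonomial k G * w G) τ = c τ := by
  classical
  choose β hβ1 hβ2 using hb
  let B : Finset (V →₀ ℕ) := Finset.univ.biUnion fun τ => (c τ).support
  let w' : Finset V → MvPolynomial V k := fun G => ∑ b ∈ B, monomial b (β b G)
  have hw' : ∀ b G, coeff b (w' G) = if b ∈ B then β b G else 0 := fun b G => by
    simp [w', coeff_sum, coeff_monomial]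
  have hdvd : ∀ G, coMonomial k G ∣ w' G := by
    refine fun G => coMonomial_dvd fun b hb => ?_
    rw [hw'] at hb
    split_ifs at hb with hB
    · have : G ∈ star Δ b.supportᶜ := by_contra fun hG => hb (hβ1 b G hG)
      exact compl_le_iff_compl_le.1 this.2
    · exact absurd rfl hb
  choose w hw using hdvd
  refine ⟨w, fun τ hτ hq => ?_⟩
  simp only [← hw]
  ext b
  rw [coeff_coboundary]
  simp only [hw']
  by_cases hB : b ∈ B
  · simp only [hB, if_true]
    by_cases hs : b.supportᶜ ⊆ τ
    · exact hβ2 b τ ⟨hτ, hs⟩ hq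
    · have h0 : coeff b (c τ) = 0 := by_contra fun hne =>
        hs (compl_le_iff_compl_le.1 (hsupp τ b hne))
      rw [h0, coboundary]
      refine Finset.sum_eq_zero fun v _ => ?_
      rw [hβ1 b _ fun hm => hs (hm.2.trans (Finset.erase_subset _ _)), mul_zero]
  · have h0 : coeff b (c τ) = 0 := by_contra fun hne =>
      hB (Finset.mem_biUnion.2 ⟨τ, Finset.mem_univ _, mem_support_iff.2 hne⟩)
    simp [hB, h0, coboundary]

variable {Δ : LowerSet (Finset V)} {d m : ℕ} {F R : ℕ → Finset V}

section Maps

variable {rank : ℕ → ℕ} (e : ∀ n, Fin (rank n) ≃ {σ : Finset V // σ ∈ Δ ∧ σ.card + n = d})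

/-- The matrix whose entry at a face `σ` and a face `τ = σ \ {v}` is `± x_v`. -/
noncomputable def faceMatrix (k : Type) [Field k] (n : ℕ) :
    Matrix (Fin (rank n)) (Fin (rank (n + 1))) (MvPolynomial V k) := fun i j =>
  ∑ v ∈ (e n i).1, if (e n i).1.erase v = (e (n + 1) j).1 then
    (-1) ^ ((e n i).1.filter (· < v)).card * X v else 0

lemma faceMatrix_isHomogeneous (n : ℕ) (i : Fin (rank n)) (j : Fin (rank (n + 1))) :
    (faceMatrix e k n i j).IsHomogeneous 1 := by
  refine IsHomogeneous.sum _ _ _ fun v _ => ?_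
  split_ifs
  · rw [show (-1 : MvPolynomial V k) = C (-1) by simp, ← C_pow]
    have := (isHomogeneous_C V ((-1 : k) ^ ((e n i).1.filter (· < v)).card)).mul
      (isHomogeneous_X k v)
    rwa [zero_add] at this
  · exact isHomogeneous_zero _ _ _

open Classical in
/-- A vector indexed by faces, as a cochain whose value at `σ` is multiplied by
`x^(V \ σ)`.  This turns `faceMatrix` into the coboundary map. -/
noncomputable def weighted (n : ℕ) (v : Fin (rank n) → MvPolynomial V k) (σ : Finset V) :
    MvPolynomial V k :=
  coMonomial k σ * if hσ : σ ∈ Δ ∧ σ.card + n = d then v ((e n).symm ⟨σ, hσ⟩) else 0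

lemma weighted_apply (n : ℕ) (v : Fin (rank n) → MvPolynomial V k) (i : Fin (rank n)) :
    weighted e n v (e n i).1 = coMonomial k (e n i).1 * v i := by
  rw [weighted, dif_pos (e n i).2]
  simp

lemma weighted_of_not (n : ℕ) (v : Fin (rank n) → MvPolynomial V k) {σ : Finset V}
    (hσ : ¬ (σ ∈ Δ ∧ σ.card + n = d)) : weighted e n v σ = 0 := by
  rw [weighted, dif_neg hσ, mul_zero]

/-- Multiplication by `faceMatrix` is the coboundary of weighted cochains. -/
lemma weighted_mulVec (n : ℕ) (w : Fin (rank (n + 1)) → MvPolynomial V k) {σ : Finset V}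
    (hσ : σ ∈ Δ ∧ σ.card + n = d) :
    weighted e n ((faceMatrix e k n).mulVec w) σ = coboundary (weighted e (n + 1) w) σ := by
  obtain ⟨i, hi⟩ := (e n).surjective ⟨σ, hσ⟩
  obtain rfl : (e n i).1 = σ := by rw [hi]
  rw [weighted_apply, Matrix.mulVec, dotProduct, coboundary]
  simp only [faceMatrix, Finset.sum_mul]
  rw [Finset.sum_comm, Finset.mul_sum]
  refine Finset.sum_congr rfl fun v hv => ?_
  have hface : (e n i).1.erase v ∈ Δ ∧ ((e n i).1.erase v).card + (n + 1) = d := by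
    refine ⟨Δ.lower (Finset.erase_subset _ _) hσ.1, ?_⟩
    have := Finset.card_erase_add_one hv
    have := hσ.2
    omega
  obtain ⟨j, hj⟩ := (e (n + 1)).surjective ⟨_, hface⟩
  have hj' : (e (n + 1) j).1 = (e n i).1.erase v := by rw [hj]
  rw [Finset.sum_eq_single j]
  · rw [if_pos hj'.symm, ← hj', weighted_apply, hj', ← coMonomial_mul_X hv]
    ring
  · intro l _ hl
    rw [if_neg, zero_mul]
    intro he
    exact hl ((e (n + 1)).injective (Subtype.ext (he.symm.trans hj'.symm)))
  · simp

lemma weighted_injective (n : ℕ) {v w : Fin (rank n) → MvPolynomial V k}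
    (hvw : ∀ σ, σ ∈ Δ ∧ σ.card + n = d → weighted e n v σ = weighted e n w σ) : v = w := by
  funext i
  have := hvw _ (e n i).2
  rw [weighted_apply, weighted_apply] at this
  exact mul_left_cancel₀ (coMonomial_ne_zero _) this

/-- Lifting a cochain back to a vector. -/
lemma exists_mulVec_eq (n : ℕ) (v : Fin (rank n) → MvPolynomial V k)
    {w : Finset V → MvPolynomial V k}
    (hw : ∀ τ, τ ∈ Δ ∧ τ.card + n = d →
      coboundary (fun G => coMonomial k G * w G) τ = weighted e n v τ) :
    ∃ u, (faceMatrix e k n).mulVec u = v := by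
  refine ⟨fun j => w (e (n + 1) j).1, weighted_injective e n fun σ hσ => ?_⟩
  rw [weighted_mulVec e n _ hσ, ← hw σ hσ]
  refine Finset.sum_congr rfl fun v hv => ?_
  have hface : σ.erase v ∈ Δ ∧ (σ.erase v).card + (n + 1) = d := by
    refine ⟨Δ.lower (Finset.erase_subset _ _) hσ.1, ?_⟩
    have := Finset.card_erase_add_one hv
    have := hσ.2
    omega
  rw [weighted, dif_pos hface]
  simp

lemma coeff_weighted_support (n : ℕ) (v : Fin (rank n) → MvPolynomial V k) (τ : Finset V)
    (b : V →₀ ℕ) (hb : coeff b (weighted e n v τ) ≠ 0) : τᶜ ⊆ b.support :=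
  compl_subset_support hb

lemma supportedOn_coeff_weighted (n : ℕ) (v : Fin (rank n) → MvPolynomial V k) (b : V →₀ ℕ)
    {q : ℕ} (hq : q + n = d) :
    SupportedOn (star Δ b.supportᶜ) q fun τ => coeff b (weighted e n v τ) := by
  intro τ hτ
  change coeff b (weighted e n v τ) = 0
  by_contra hne
  refine hτ ⟨⟨?_, compl_le_iff_compl_le.1 (coeff_weighted_support e n v τ b hne)⟩, ?_⟩
  all_goals
    by_contra hcon
    refine hne ?_
    rw [weighted_of_not, coeff_zero]
    rintro ⟨h1, h2⟩
    first
      | exact hcon h1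
      | omega

end Maps

/-- The Eagon–Reiner resolution of the Alexander dual ideal of a shelled sphere.  The basis of
the `n`-th module consists of the faces with `d - n` vertices, and the maps are coboundary maps with
the signs multiplied by variables. In a multidegree with support `W`, the complex is the cochain
complex of the star of `V \ W`. -/
noncomputable def ReversibleShelling.resolution (h : ReversibleShelling Δ d m F R)
    {ε : Finset V → k} (hε : SupportedOn (Δ : Set (Finset V)) d ε) (hbd : boundary k ε = 0)
    (hne : ∀ i < m, ε (F i) ≠ 0) {rank : ℕ → ℕ}
    (e : ∀ n, Fin (rank n) ≃ {σ : Finset V // σ ∈ Δ ∧ σ.card + n = d}) :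
    MinimalFreeResolution (stanleyReisnerIdeal k (alexanderDual Δ)) where
  rank := rank
  degree n _ := Fintype.card V - d + n
  -- The signs of the orientation make the sum over the facets vanish on coboundaries.
  gen j := C (ε (e 0 j).1) * coMonomial k (e 0 j).1
  d := faceMatrix e k
  gen_homogeneous j := by
    have hcard : ((e 0 j).1ᶜ).card = Fintype.card V - d + 0 := by
      have := (e 0 j).2.2
      rw [Finset.card_compl]
      omega
    have h1 : (coMonomial k (e 0 j).1).IsHomogeneous (∑ _i ∈ (e 0 j).1ᶜ, 1) :=
      IsHomogeneous.prod _ _ _ fun i _ => isHomogeneous_X k i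
    rw [Finset.sum_const, smul_eq_mul, mul_one, hcard] at h1
    simpa using (isHomogeneous_C V (ε (e 0 j).1)).mul h1
  d_homogeneous n i j _ := ⟨1, rfl, faceMatrix_isHomogeneous e n i j⟩
  span_gen := by
    apply le_antisymm
    · rw [Ideal.span_le]
      rintro _ ⟨j, rfl⟩
      refine Ideal.mul_mem_left _ _ (Ideal.subset_span ⟨_, fun hmem => ?_, rfl⟩)
      have hmem' : ((e 0 j).1ᶜ)ᶜ ∉ Δ := hmem
      rw [compl_compl] at hmem'
      exact hmem' (e 0 j).2.1
    · rw [stanleyReisnerIdeal, Ideal.span_le]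
      rintro _ ⟨G, hG, rfl⟩
      have hG' : Gᶜ ∈ Δ := by_contra fun hn => hG hn
      obtain ⟨i, hi, hs⟩ := (h.mem_iff _).1 hG'
      obtain ⟨j, hj⟩ := (e 0).surjective ⟨F i, h.facet_mem hi, by rw [h.card_eq i hi, add_zero]⟩
      have hj' : (e 0 j).1 = F i := by rw [hj]
      have hsub : (F i)ᶜ ⊆ G := compl_le_iff_compl_le.1 hs
      have hgen : coMonomial k (F i) ∈
          Ideal.span (Set.range fun j => C (ε (e 0 j).1) * coMonomial k (e 0 j).1) := by
        have h1 : coMonomial k (F i) =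
            C (ε (F i))⁻¹ * (C (ε (e 0 j).1) * coMonomial k (e 0 j).1) := by
          rw [hj', ← mul_assoc, ← C_mul, inv_mul_cancel₀ (hne i hi), C_1, one_mul]
        rw [h1]
        exact Ideal.mul_mem_left _ _ (Ideal.subset_span ⟨j, rfl⟩)
      change ∏ i ∈ G, (X i : MvPolynomial V k) ∈ _
      rw [← Finset.prod_sdiff hsub]
      exact Ideal.mul_mem_left _ _ hgen
  exact_zero v := by
    have hsum : ∀ v : Fin (rank 0) → MvPolynomial V k,
        ∑ j, v j * (C (ε (e 0 j).1) * coMonomial k (e 0 j).1) =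
          ∑ τ, weighted e 0 v τ * C (ε τ) := by
      intro v
      have h1 : ∀ τ ∉ Finset.univ.map ((e 0).toEmbedding.trans (Function.Embedding.subtype _)),
          weighted e 0 v τ * C (ε τ) = 0 := by
        intro τ hτ
        rw [weighted_of_not, zero_mul]
        intro hτ'
        obtain ⟨j, hj⟩ := (e 0).surjective ⟨τ, hτ'⟩
        exact hτ (Finset.mem_map.2 ⟨j, Finset.mem_univ _, by simp [hj]⟩)
      rw [← Finset.sum_subset (Finset.subset_univ _) fun τ _ hτ => h1 τ hτ, Finset.sum_map]
      refine Finset.sum_congr rfl fun j _ => ?_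
      simp only [Function.Embedding.trans_apply, Equiv.coe_toEmbedding,
        Function.Embedding.subtype_apply, weighted_apply]
      ring
    rw [hsum]
    constructor
    · intro hv
      obtain ⟨w, hw⟩ := exists_lift_coboundary (Δ := Δ) (q := d) (weighted e 0 v)
        (coeff_weighted_support e 0 v) fun b =>
          h.exists_coboundary_eq_top _ hε hbd hne _
            (supportedOn_coeff_weighted e 0 v b (add_zero d)) <| by
              have hcoeff := congrArg (coeff b) hv
              rw [coeff_sum, coeff_zero] at hcoeff
              rw [← hcoeff]
              refine Finset.sum_congr rfl fun τ _ => ?_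
              rw [mul_comm (weighted e 0 v τ), coeff_C_mul, mul_comm]
      exact exists_mulVec_eq e 0 v fun τ hτ => hw τ hτ.1 (by simpa using hτ.2)
    · rintro ⟨w, rfl⟩
      have h1 : ∀ τ, weighted e 0 ((faceMatrix e k 0).mulVec w) τ * C (ε τ) =
          coboundary (weighted e 1 w) τ * C (ε τ) := by
        intro τ
        by_cases hτ : τ ∈ Δ ∧ τ.card = d
        · rw [weighted_mulVec e 0 w (by simpa using hτ)]
        · rw [hε τ hτ, C_0, mul_zero, mul_zero]
      rw [Finset.sum_congr rfl fun τ _ => h1 τ, ← sum_mul_boundary]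
      refine Finset.sum_eq_zero fun τ _ => ?_
      rw [boundary_C, hbd, Pi.zero_apply, C_0, mul_zero]
  exact_succ n v := by
    constructor
    · intro hv
      by_cases hn : n + 1 ≤ d
      · have hq : d - (n + 1) + (n + 1) = d := Nat.sub_add_cancel hn
        obtain ⟨w, hw⟩ := exists_lift_coboundary (Δ := Δ) (q := d - (n + 1))
          (weighted e (n + 1) v) (coeff_weighted_support e (n + 1) v) fun b =>
            h.exists_coboundary_eq _ (by omega) _
              (supportedOn_coeff_weighted e (n + 1) v b hq) <| by
              intro τ hτ hcard
              rw [← coeff_coboundary, ← weighted_mulVec e n v ⟨hτ.1, by omega⟩, hv]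
              simp [weighted]
        exact exists_mulVec_eq e (n + 1) v fun τ hτ => hw τ hτ.1 (by omega)
      · refine ⟨0, funext fun j => ?_⟩
        exact absurd (e (n + 1) j).2.2 (by omega)
    · rintro ⟨w, rfl⟩
      refine weighted_injective e n fun σ hσ => ?_
      rw [weighted_mulVec e n _ hσ]
      have h1 : coboundary (weighted e (n + 1) ((faceMatrix e k (n + 1)).mulVec w)) σ =
          coboundary (coboundary (weighted e (n + 1 + 1) w)) σ := by
        refine Finset.sum_congr rfl fun v hv => ?_
        rw [weighted_mulVec e (n + 1) w]
        refine ⟨Δ.lower (Finset.erase_subset _ _) hσ.1, ?_⟩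
        have := Finset.card_erase_add_one hv
        have := hσ.2
        omega
      rw [h1, coboundary_coboundary]
      simp [weighted]
  minimal n i j := by
    simp only [faceMatrix, map_sum]
    refine Finset.sum_eq_zero fun v _ => ?_
    split_ifs <;> simp

end Resolution

/-! ### Homological dimensions -/

section GlobalDimension

open CategoryTheory Polynomial TensorProduct

/-- All modules over the ring have projective dimension at most `n`. -/
def GlobalDimensionLE (B : Type) [CommRing B] (n : ℕ) : Prop :=
  ∀ M : ModuleCat.{0} B, HasProjectiveDimensionLE M n

lemma GlobalDimensionLE.of_ringEquiv {B B' : Type} [CommRing B] [CommRing B'] (e : B ≃+* B')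
    {n : ℕ} (h : GlobalDimensionLE B n) : GlobalDimensionLE B' n := by
  intro M
  let N : ModuleCat.{0} B := (ModuleCat.restrictScalars e.toRingHom).obj M
  have := h N
  let _ := RingHomInvPair.of_ringEquiv e
  let _ := RingHomInvPair.of_ringEquiv e.symm
  let e' : N ≃ₛₗ[RingHomClass.toRingHom e] M :=
    { AddEquiv.refl M with
      map_smul' := fun _ _ => rfl }
  exact ModuleCat.hasProjectiveDimensionLE_of_semiLinearEquiv e e' n

lemma globalDimensionLE_field (k : Type) [Field k] : GlobalDimensionLE k 0 := by
  intro M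
  rw [← projective_iff_hasProjectiveDimensionLE_zero, ← IsProjective.iff_projective]
  have := Module.Free.of_divisionRing k M
  exact Module.Projective.of_free

variable {B : Type} [CommRing B]

/-- Extension of scalars to the polynomial ring does not increase projective dimension. -/
lemma hasProjectiveDimensionLE_polynomial_tensor {n : ℕ} (N : ModuleCat.{0} B)
    (hN : HasProjectiveDimensionLE N n) :
    HasProjectiveDimensionLE (ModuleCat.of B[X] (B[X] ⊗[B] N)) n := by
  induction n generalizing N with
  | zero =>
    rw [← projective_iff_hasProjectiveDimensionLE_zero, ← IsProjective.iff_projective] at hN ⊢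
    infer_instance
  | succ n ih =>
    let T := N.projectiveShortComplex
    have hT := N.shortExact_projectiveShortComplex
    have hK : HasProjectiveDimensionLE T.X₁ n :=
      (hT.hasProjectiveDimensionLT_X₃_iff n inferInstance).1 hN
    have hK' := ih T.X₁ hK
    have hexact : Function.Exact T.f.hom T.g.hom :=
      (ShortComplex.ShortExact.moduleCat_exact_iff_function_exact T).1 hT.exact
    have hcomp : T.g.hom.baseChange B[X] ∘ₗ T.f.hom.baseChange B[X] = 0 := by
      rw [← LinearMap.baseChange_comp, hexact.linearMap_comp_eq_zero, LinearMap.baseChange_zero]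
    let T' : ShortComplex (ModuleCat.{0} B[X]) := ModuleCat.shortComplexOfCompEqZero
      (T.f.hom.baseChange B[X]) (T.g.hom.baseChange B[X]) hcomp
    have hT' : T'.ShortExact := by
      refine ModuleCat.shortComplex_shortExact _ ?_ ?_ ?_
      · exact lTensor_exact B[X] hexact hT.moduleCat_surjective_g
      · exact Module.Flat.lTensor_preserves_injective_linearMap _ hT.moduleCat_injective_f
      · exact LinearMap.lTensor_surjective _ hT.moduleCat_surjective_g
    have hP : Projective T'.X₂ := by
      have : Projective T.X₂ := inferInstance
      rw [← IsProjective.iff_projective] at this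
      change Projective (ModuleCat.of B[X] (B[X] ⊗[B] T.X₂))
      rw [← IsProjective.iff_projective]
      infer_instance
    exact (hT'.hasProjectiveDimensionLT_X₃_iff n hP).2 hK'

section Koszul

set_option linter.unusedSectionVars false

variable (N : Type) [AddCommGroup N] [Module B N] [Module B[X] N] [IsScalarTower B B[X] N]

/-- The endomorphism `X ⊗ 1 - 1 ⊗ X` of `B[X] ⊗ N`, for a module `N` over `B[X]`. -/
noncomputable def koszulMap : B[X] ⊗[B] N →ₗ[B[X]] B[X] ⊗[B] N :=
  (X : B[X]) • LinearMap.id -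
    ((LinearMap.lsmul B[X] N X).restrictScalars B : N →ₗ[B] N).baseChange B[X]

/-- The multiplication `B[X] ⊗ N → N`. -/
noncomputable def actionMap : B[X] ⊗[B] N →ₗ[B[X]] N :=
  (LinearMap.id : N →ₗ[B] N).liftBaseChange B[X]

variable {N}

@[simp] lemma koszulMap_tmul (f : B[X]) (x : N) :
    koszulMap N (f ⊗ₜ[B] x) = (X * f) ⊗ₜ x - f ⊗ₜ ((X : B[X]) • x) := by
  simp [koszulMap, smul_tmul']

@[simp] lemma actionMap_tmul (f : B[X]) (x : N) : actionMap N (f ⊗ₜ[B] x) = f • x := by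
  simp [actionMap]

/-- The coefficient of `X ^ i` of an element of `B[X] ⊗ N`. -/
noncomputable def tensorCoeff (N : Type) [AddCommGroup N] [Module B N] (i : ℕ) :
    B[X] ⊗[B] N →ₗ[B] N :=
  (TensorProduct.lid B N).toLinearMap ∘ₗ (Polynomial.lcoeff B i).rTensor N

@[simp] lemma tensorCoeff_tmul (i : ℕ) (f : B[X]) (x : N) :
    tensorCoeff N i (f ⊗ₜ[B] x) = f.coeff i • x := by
  simp [tensorCoeff]

lemma tensorCoeff_finite (t : B[X] ⊗[B] N) : ∃ D, ∀ i, D ≤ i → tensorCoeff N i t = 0 := by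
  induction t using TensorProduct.induction_on with
  | zero => exact ⟨0, fun i _ => map_zero _⟩
  | tmul f x =>
    refine ⟨f.natDegree + 1, fun i hi => ?_⟩
    rw [tensorCoeff_tmul, coeff_eq_zero_of_natDegree_lt (by omega), zero_smul]
  | add a b ha hb =>
    obtain ⟨D, hD⟩ := ha
    obtain ⟨D', hD'⟩ := hb
    refine ⟨max D D', fun i hi => ?_⟩
    rw [map_add, hD i (le_of_max_le_left hi), hD' i (le_of_max_le_right hi), add_zero]

lemma eq_zero_of_tensorCoeff (t : B[X] ⊗[B] N) (ht : ∀ i, tensorCoeff N i t = 0) : t = 0 := by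
  have key : ∃ D, ∀ D' ≥ D,
      t = ∑ i ∈ Finset.range D', (X ^ i : B[X]) ⊗ₜ[B] tensorCoeff N i t := by
    clear ht
    induction t using TensorProduct.induction_on with
    | zero => exact ⟨0, fun D _ => by simp⟩
    | tmul f x =>
      refine ⟨f.natDegree + 1, fun D hD => ?_⟩
      conv_lhs => rw [f.as_sum_range' D (by omega), sum_tmul]
      refine Finset.sum_congr rfl fun i _ => ?_
      rw [← C_mul_X_pow_eq_monomial, ← smul_eq_C_mul, tensorCoeff_tmul, smul_tmul]
    | add a b ha hb =>
      obtain ⟨D, hD⟩ := ha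
      obtain ⟨D', hD'⟩ := hb
      refine ⟨max D D', fun E hE => ?_⟩
      simp only [map_add, tmul_add, Finset.sum_add_distrib]
      rw [← hD E (le_of_max_le_left hE), ← hD' E (le_of_max_le_right hE)]
  obtain ⟨D, hD⟩ := key
  rw [hD D le_rfl]
  exact Finset.sum_eq_zero fun i _ => by rw [ht, tmul_zero]

lemma tensorCoeff_koszulMap (i : ℕ) (t : B[X] ⊗[B] N) :
    tensorCoeff N (i + 1) (koszulMap N t) =
      tensorCoeff N i t - (X : B[X]) • tensorCoeff N (i + 1) t := by
  induction t using TensorProduct.induction_on with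
  | zero => simp
  | tmul f x =>
    rw [koszulMap_tmul, map_sub, tensorCoeff_tmul, tensorCoeff_tmul, tensorCoeff_tmul,
      tensorCoeff_tmul, coeff_X_mul, smul_comm (f.coeff (i + 1))]
  | add a b ha hb =>
    rw [map_add, map_add, ha, hb, map_add, map_add, smul_add]
    abel

/-- The kernel is trivial: by `tensorCoeff_koszulMap`, the coefficients of an element of the kernel
determine those of lower degree, and those of high degree are zero. -/
lemma koszulMap_injective : Function.Injective (koszulMap N : B[X] ⊗[B] N → B[X] ⊗[B] N) := by
  rw [injective_iff_map_eq_zero]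
  intro t ht
  have hrec : ∀ i, tensorCoeff N i t = (X : B[X]) • tensorCoeff N (i + 1) t := fun i => by
    have := tensorCoeff_koszulMap i t
    rw [ht, map_zero] at this
    exact (sub_eq_zero.1 this.symm)
  obtain ⟨D, hD⟩ := tensorCoeff_finite t
  refine eq_zero_of_tensorCoeff t fun i => ?_
  have key : ∀ j i, i + j ≥ D → tensorCoeff N i t = 0 := by
    intro j
    induction j with
    | zero => exact fun i hi => hD i hi
    | succ j ih =>
      intro i hi
      rw [hrec, ih (i + 1) (by omega), smul_zero]
  exact key D i (by omega)

/-- The sequence `0 → B[X] ⊗ N → B[X] ⊗ N → N → 0` is exact in the middle. -/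
lemma koszul_exact : Function.Exact (koszulMap N : B[X] ⊗[B] N → B[X] ⊗[B] N) (actionMap N) := by
  have hmod : ∀ t : B[X] ⊗[B] N,
      t - (1 : B[X]) ⊗ₜ[B] actionMap N t ∈ LinearMap.range (koszulMap N) := by
    intro t
    induction t using TensorProduct.induction_on with
    | zero => simp
    | tmul f x =>
      rw [actionMap_tmul]
      induction f using Polynomial.induction_on generalizing x with
      | C a =>
        have : (C a : B[X]) ⊗ₜ[B] x = (1 : B[X]) ⊗ₜ[B] (C a • x) := by
          rw [← algebraMap_eq, algebraMap_smul, tmul_smul, smul_tmul', Algebra.algebraMap_eq_smul_one]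
        rw [this, sub_self]
        exact zero_mem _
      | add p q hp hq =>
        have := add_mem (hp x) (hq x)
        rw [add_smul, add_tmul, tmul_add]
        convert this using 1
        abel
      | monomial n a ih =>
        have h1 := ih ((X : B[X]) • x)
        have h2 : koszulMap N ((C a * X ^ n : B[X]) ⊗ₜ[B] x) ∈ LinearMap.range (koszulMap N) :=
          ⟨_, rfl⟩
        rw [koszulMap_tmul] at h2
        have := add_mem h1 h2
        rw [smul_smul] at this
        have e1 : (C a * X ^ n * X : B[X]) = C a * X ^ (n + 1) := by ring
        have e2 : (X * (C a * X ^ n) : B[X]) = C a * X ^ (n + 1) := by ring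
        rw [e1, e2] at this
        convert this using 1
        abel
    | add a b ha hb =>
      have := add_mem ha hb
      rw [map_add, tmul_add]
      convert this using 1
      abel
  intro t
  constructor
  · intro ht
    have := hmod t
    rwa [ht, tmul_zero, sub_zero] at this
  · rintro ⟨u, rfl⟩
    induction u using TensorProduct.induction_on with
    | zero => simp
    | tmul f x =>
      rw [koszulMap_tmul, map_sub, actionMap_tmul, actionMap_tmul, smul_smul, mul_comm, sub_self]
    | add a b ha hb => rw [map_add, map_add, ha, hb, add_zero]

end Koszul

/-- A variable raises the global dimension by at most one. -/
lemma GlobalDimensionLE.polynomial {n : ℕ} (h : GlobalDimensionLE B n) :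
    GlobalDimensionLE B[X] (n + 1) := by
  intro N
  let _ : Module B N := Module.compHom N (C : B →+* B[X])
  have : IsScalarTower B B[X] N := ⟨fun b f x => by
    rw [smul_eq_C_mul, mul_smul]
    rfl⟩
  have hT := hasProjectiveDimensionLE_polynomial_tensor (ModuleCat.of B N) (h _)
  have hcomp : actionMap (B := B) N ∘ₗ koszulMap N = 0 := koszul_exact.linearMap_comp_eq_zero
  have hS := ModuleCat.shortComplex_shortExact
    (ModuleCat.shortComplexOfCompEqZero (koszulMap (B := B) N) (actionMap N) hcomp)
    koszul_exact koszulMap_injective fun x => ⟨1 ⊗ₜ x, by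
      change actionMap (B := B) N _ = x
      rw [actionMap_tmul, one_smul]⟩
  refine hS.hasProjectiveDimensionLT_X₃ (n + 1) hT ?_
  have : HasProjectiveDimensionLT (ModuleCat.of B[X] (B[X] ⊗[B] N)) (n + 1) := hT
  exact hasProjectiveDimensionLT_of_ge (ModuleCat.of B[X] (B[X] ⊗[B] N)) (n + 1) (n + 1 + 1)
    (by omega)

/-- Hilbert's syzygy theorem. -/
theorem globalDimensionLE_mvPolynomial (k : Type) [Field k] (n : ℕ) :
    GlobalDimensionLE (MvPolynomial (Fin n) k) n := by
  induction n with
  | zero =>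
    exact (globalDimensionLE_field k).of_ringEquiv
      (MvPolynomial.isEmptyAlgEquiv k (Fin 0)).symm.toRingEquiv
  | succ n ih =>
    exact ih.polynomial.of_ringEquiv (MvPolynomial.finSuccEquiv k n).symm.toRingEquiv

lemma GlobalDimensionLE.hasInjectiveDimensionLE {n : ℕ} (h : GlobalDimensionLE B n)
    (M : ModuleCat.{0} B) : HasInjectiveDimensionLE M n := by
  let _ := HasExt.standard (ModuleCat.{0} B)
  refine (hasInjectiveDimensionLT_iff _ _).2 fun i hi Y e => ?_
  have : HasProjectiveDimensionLT Y (n + 1) := h Y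
  exact e.eq_zero_of_hasProjectiveDimensionLT (n + 1) hi

end GlobalDimension

/-! ### Frobenius extensions of rings of finite global dimension are Gorenstein -/

section Frobenius

open CategoryTheory

variable {S A : Type} [CommRing S] [CommRing A]

/-- Coextension of scalars along a projective extension preserves injective dimension: it is
exact, and it is right adjoint to the exact restriction of scalars. -/
lemma hasInjectiveDimensionLE_coextendScalars (f : S →+* A)
    (hproj : Module.Projective S ((ModuleCat.restrictScalars f).obj (ModuleCat.of A A))) {n : ℕ}
    (M : ModuleCat.{0} S) (hM : HasInjectiveDimensionLE M n) :
    HasInjectiveDimensionLE ((ModuleCat.coextendScalars.{0, 0, 0} f).obj M) n := by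
  induction n generalizing M with
  | zero =>
    have hinj : Injective M := injective_iff_hasInjectiveDimensionLT_one.2 hM
    have := Functor.preservesInjectiveObjects_of_adjunction_of_preservesMonomorphisms
      (ModuleCat.restrictCoextendScalarsAdj.{0, 0, 0} f)
    have : Injective ((ModuleCat.coextendScalars.{0, 0, 0} f).obj M) :=
      (ModuleCat.coextendScalars.{0, 0, 0} f).injective_obj M
    exact injective_iff_hasInjectiveDimensionLT_one.1 this
  | succ n ih =>
    let ⟨I, _, g, _⟩ := EnoughInjectives.presentation M
    have hg : Function.Injective g.hom := (ModuleCat.mono_iff_injective g).1 ‹_›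
    let T : ShortComplex (ModuleCat.{0} S) :=
      ModuleCat.shortComplexOfCompEqZero _ _ g.hom.exact_map_mkQ_range.linearMap_comp_eq_zero
    have hT : T.ShortExact := ModuleCat.shortComplex_shortExact T
      g.hom.exact_map_mkQ_range hg (Submodule.mkQ_surjective _)
    have hQ := ih T.X₃ ((hT.hasInjectiveDimensionLT_X₃_iff n ‹_›).2 hM)
    let co := ModuleCat.coextendScalars.{0, 0, 0} f
    let E := ModuleCat.CoextendScalars.equiv.{0, 0, 0} f
    have hI : Injective (co.obj T.X₂) := by
      have := Functor.preservesInjectiveObjects_of_adjunction_of_preservesMonomorphisms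
        (ModuleCat.restrictCoextendScalarsAdj.{0, 0, 0} f)
      have hI' : Injective T.X₂ := ‹Injective I›
      exact co.injective_obj T.X₂
    have hT' : (T.map co).ShortExact := by
      have hf : Function.Injective T.f.hom := hg
      have hex : Function.Exact T.f.hom T.g.hom := g.hom.exact_map_mkQ_range
      have hsurj : Function.Surjective T.g.hom := Submodule.mkQ_surjective _
      have hcof : ∀ x, E T.X₂ (co.map T.f x) = T.f.hom ∘ₗ E T.X₁ x := fun _ => rfl
      have hcog : ∀ x, E T.X₃ (co.map T.g x) = T.g.hom ∘ₗ E T.X₂ x := fun _ => rfl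
      refine ModuleCat.shortComplex_shortExact _ ?_ ?_ ?_
      · intro (y : co.obj T.X₂)
        change co.map T.g y = 0 ↔ ∃ x, co.map T.f x = y
        constructor
        · intro hy
          have hy' : ∀ a, T.g.hom (E T.X₂ y a) = 0 := fun a => by
            have := LinearMap.congr_fun (hcog y) a
            rw [hy, map_zero] at this
            exact this.symm
          let y' := (E T.X₂ y).codRestrict (LinearMap.range T.f.hom) fun a => (hex _).1 (hy' a)
          refine ⟨(E T.X₁).symm ((LinearEquiv.ofInjective T.f.hom hf).symm.toLinearMap ∘ₗ y'),
            (E T.X₂).injective ?_⟩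
          rw [hcof, LinearEquiv.apply_symm_apply]
          ext a
          exact congrArg Subtype.val ((LinearEquiv.ofInjective T.f.hom hf).apply_symm_apply (y' a))
        · rintro ⟨x, rfl⟩
          refine (E T.X₃).injective ?_
          rw [hcog, hcof, ← LinearMap.comp_assoc, hex.linearMap_comp_eq_zero, LinearMap.zero_comp,
            map_zero]
      · intro (x : co.obj T.X₁) (x' : co.obj T.X₁) hx
        change co.map T.f x = co.map T.f x' at hx
        refine (E T.X₁).injective ?_
        have := congrArg (E T.X₂) hx
        rw [hcof, hcof] at this
        exact (LinearMap.cancel_left hf).1 this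
      · intro (z : co.obj T.X₃)
        obtain ⟨y, hy⟩ := Module.projective_lifting_property T.g.hom (E T.X₃ z) hsurj
        refine ⟨(E T.X₂).symm y, (E T.X₃).injective ?_⟩
        exact hy
    exact (hT'.hasInjectiveDimensionLT_X₃_iff n hI).1 hQ

/-- A Frobenius extension `f : S → A`, with `A` projective over `S` and a linear form `φ` that
generates `Hom_S(A, S)` freely over `A`, inherits finite self-injective dimension from `S`. -/
theorem isGorensteinRing_of_frobenius [IsNoetherianRing A] (f : S →+* A) {n : ℕ}
    (hS : GlobalDimensionLE S n)
    (hproj : Module.Projective S ((ModuleCat.restrictScalars f).obj (ModuleCat.of A A)))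
    (φ : A →+ S) (hφ : ∀ s a, φ (f s * a) = s * φ a)
    (hinj : ∀ a, (∀ b, φ (a * b) = 0) → a = 0)
    (hsurj : ∀ g : A →+ S, (∀ s a, g (f s * a) = s * g a) → ∃ a, ∀ b, g b = φ (a * b)) :
    IsGorensteinRing A := by
  refine ⟨inferInstance, fun p _ => ⟨n, ?_⟩⟩
  have h1 := hasInjectiveDimensionLE_coextendScalars f hproj (ModuleCat.of S S)
    (hS.hasInjectiveDimensionLE _)
  let E := ModuleCat.CoextendScalars.equiv.{0, 0, 0} f (ModuleCat.of S S)
  let ψ : A →ₗ[A] (ModuleCat.coextendScalars.{0, 0, 0} f).obj (ModuleCat.of S S) :=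
    { toFun a := E.symm
        { toFun := fun b : A => φ (a * b)
          map_add' := fun b c : A => by rw [← map_add, ← mul_add]; rfl
          map_smul' := fun (s : S) (b : A) => by
            change φ (a * (f s * b)) = s * φ (a * b)
            rw [← hφ, mul_left_comm] }
      map_add' a a' := E.injective <| LinearMap.ext fun b : A => by
        change φ ((a + a') * b) = φ (a * b) + φ (a' * b)
        rw [← map_add, add_mul]
      map_smul' c a := E.injective <| LinearMap.ext fun b : A => by
        change φ (c * a * b) = φ (a * (b * c))
        congr 1
        ring }
  have hψ : ∀ a (b : A), E (ψ a) b = φ (a * b) := fun _ _ => rfl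
  let e : A ≃ₗ[A] (ModuleCat.coextendScalars.{0, 0, 0} f).obj (ModuleCat.of S S) := by
    refine LinearEquiv.ofBijective ψ ⟨(injective_iff_map_eq_zero ψ).2 fun a ha => ?_, fun g => ?_⟩
    · refine hinj a fun b => ?_
      rw [← hψ, ha, map_zero]
      rfl
    · let g' : A →+ S := (E g).toAddMonoidHom
      obtain ⟨a, ha⟩ := hsurj g' fun s b => (E g).map_smul s b
      exact ⟨a, E.injective (LinearMap.ext fun b => (ha b).symm)⟩
  have h2 : HasInjectiveDimensionLE (ModuleCat.of A A) n :=
    (ModuleCat.hasInjectiveDimensionLE_iff_of_linearEquiv (M := ModuleCat.of A A) e n).2 h1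
  have h3 := ModuleCat.localizedModule_hasInjectiveDimensionLE n p.primeCompl (ModuleCat.of A A)
  let e2 : (ModuleCat.of A A).localizedModule p.primeCompl ≃ₗ[Localization.AtPrime p]
      Localization.AtPrime p :=
    (Shrink.linearEquiv _ (LocalizedModule p.primeCompl A)).trans
      ((IsLocalizedModule.linearEquiv p.primeCompl (LocalizedModule.mkLinearMap p.primeCompl A)
        (Algebra.linearMap A (Localization.AtPrime p))).extendScalarsOfIsLocalization
          p.primeCompl _)
  exact (ModuleCat.hasInjectiveDimensionLE_iff_of_linearEquiv
    (N := ModuleCat.of _ (Localization.AtPrime p)) e2 n).1 h3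

end Frobenius

/-! ### Stanley–Reisner rings over a linear system of parameters -/

section Frobenius

set_option linter.unusedSectionVars false

open MvPolynomial

/-- If `J' / J` is free of rank one over `S`, with generator `x`, and `B / J'` is projective, then
the extension `B / J` is projective, and `x` generates a direct summand. -/
lemma projective_quotient_step {S B : Type} [CommRing S] [CommRing B] [Algebra S B]
    {J J' : Ideal B} (hle : J ≤ J') {x : B} (hx : x ∈ J')
    (hinj : ∀ s : S, algebraMap S B s * x ∈ J → s = 0)
    (hex : ∀ p ∈ J', ∃ s : S, p - algebraMap S B s * x ∈ J)
    (hproj : Module.Projective S (B ⧸ J')) :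
    Module.Projective S (B ⧸ J) ∧
      ∃ r : (B ⧸ J) →ₗ[S] S, r (Ideal.Quotient.mk J x) = 1 := by
  let g : (B ⧸ J) →ₗ[S] (B ⧸ J') := (Ideal.Quotient.factorₐ S hle).toLinearMap
  let f : S →ₗ[S] (B ⧸ J) := LinearMap.toSpanSingleton S (B ⧸ J) (Ideal.Quotient.mk J x)
  have hf : ∀ s, f s = Ideal.Quotient.mk J (algebraMap S B s * x) := fun s => by
    rw [map_mul, LinearMap.toSpanSingleton_apply, Algebra.smul_def]
    rfl
  have hg : ∀ p, g (Ideal.Quotient.mk J p) = Ideal.Quotient.mk J' p := fun _ => rfl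
  have hexact : Function.Exact f g := by
    intro y
    obtain ⟨p, rfl⟩ := Ideal.Quotient.mk_surjective y
    rw [hg, Ideal.Quotient.eq_zero_iff_mem]
    constructor
    · intro hp
      obtain ⟨s, hs⟩ := hex p hp
      exact ⟨s, by rw [hf]; exact (Ideal.Quotient.eq.2 hs).symm⟩
    · rintro ⟨s, hs⟩
      rw [hf, Ideal.Quotient.eq] at hs
      have := sub_mem (J'.mul_mem_left (algebraMap S B s) hx) (hle hs)
      rwa [sub_sub_cancel] at this
  have hfinj : Function.Injective f := by
    rw [injective_iff_map_eq_zero]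
    intro s hs
    rw [hf, Ideal.Quotient.eq_zero_iff_mem] at hs
    exact hinj s hs
  have hgsurj : Function.Surjective g := by
    intro y
    obtain ⟨p, rfl⟩ := Ideal.Quotient.mk_surjective y
    exact ⟨_, hg p⟩
  have tfae := hexact.split_tfae hfinj hgsurj
  have hsplit := Module.projective_lifting_property g LinearMap.id hgsurj
  obtain ⟨r, hr⟩ := (tfae.out 0 1).1 hsplit
  obtain ⟨e, -⟩ := (tfae.out 0 2).1 hsplit
  refine ⟨Module.Projective.of_equiv e.symm, r, ?_⟩
  have := LinearMap.congr_fun hr 1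
  rw [LinearMap.comp_apply, hf, map_one, one_mul] at this
  exact this

variable {V : Type} [Fintype V] [LinearOrder V] {k : Type} [Field k]

/-- A Stanley–Reisner ideal is spanned by the monomials whose support is not a face. -/
theorem mem_stanleyReisnerIdeal {Γ : LowerSet (Finset V)} {p : MvPolynomial V k} :
    p ∈ stanleyReisnerIdeal k Γ ↔ ∀ b ∈ p.support, b.support ∉ Γ := by
  have h1 : stanleyReisnerIdeal k Γ = Ideal.span ((fun s => monomial s (1 : k)) ''
      {s | ∃ G : Finset V, G ∉ Γ ∧ s = ∑ i ∈ G, Finsupp.single i 1}) := by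
    rw [stanleyReisnerIdeal]
    congr 1
    ext p
    constructor
    · rintro ⟨G, hG, rfl⟩
      exact ⟨_, ⟨G, hG, rfl⟩, (prod_X_eq_monomial G).symm⟩
    · rintro ⟨_, ⟨G, hG, rfl⟩, rfl⟩
      exact ⟨G, hG, (prod_X_eq_monomial G).symm⟩
  rw [h1, mem_ideal_span_monomial_image]
  refine forall₂_congr fun b _ => ⟨?_, fun hb => ?_⟩
  · rintro ⟨_, ⟨G, hG, rfl⟩, hle⟩ hb
    exact hG (Γ.lower ((sum_single_one_le G b).1 hle) hb)
  · exact ⟨_, ⟨b.support, hb, rfl⟩, (sum_single_one_le _ b).2 subset_rfl⟩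

lemma monomial_mem_stanleyReisnerIdeal {Γ : LowerSet (Finset V)} {b : V →₀ ℕ} :
    monomial b (1 : k) ∈ stanleyReisnerIdeal k Γ ↔ b.support ∉ Γ := by
  rw [mem_stanleyReisnerIdeal]
  simp [mem_support_iff, coeff_monomial]

/-- The squarefree monomial of a set of vertices. -/
noncomputable def faceMonomial (k : Type) [Field k] (σ : Finset V) : MvPolynomial V k :=
  ∏ i ∈ σ, X i

lemma faceMonomial_eq (σ : Finset V) :
    faceMonomial k σ = monomial (∑ i ∈ σ, Finsupp.single i 1) 1 := prod_X_eq_monomial σ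

lemma support_sum_single (σ : Finset V) :
    (∑ i ∈ σ, Finsupp.single i 1 : V →₀ ℕ).support = σ := by
  ext v
  simp [Finsupp.finsetSum_apply, Finsupp.single_apply]

lemma faceMonomial_mem {Γ : LowerSet (Finset V)} {σ : Finset V} (hσ : σ ∉ Γ) :
    faceMonomial k σ ∈ stanleyReisnerIdeal k Γ := Ideal.subset_span ⟨σ, hσ, rfl⟩

lemma faceMonomial_insert {σ : Finset V} {v : V} (hv : v ∉ σ) :
    faceMonomial k σ * X v = faceMonomial k (insert v σ) := by
  rw [faceMonomial, faceMonomial, Finset.prod_insert hv, mul_comm]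

/-- If `F` contains all `c` for which `σ ∪ c` is in `Γ`, then `x^σ` times a polynomial that vanishes
on the coordinate subspace of `F` is in the ideal of `Γ`. -/
lemma faceMonomial_mul_mem {Γ : LowerSet (Finset V)} {σ F : Finset V}
    (hF : ∀ c, σ ∪ c ∈ Γ → c ⊆ F) {p : MvPolynomial V k}
    (hp : p ∈ stanleyReisnerIdeal k (LowerSet.Iic F)) :
    faceMonomial k σ * p ∈ stanleyReisnerIdeal k Γ := by
  rw [mem_stanleyReisnerIdeal] at hp ⊢
  intro b hb hΓ
  rw [mem_support_iff, faceMonomial_eq, coeff_monomial_mul'] at hb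
  split_ifs at hb with hle
  · rw [one_mul] at hb
    refine hp _ (mem_support_iff.2 hb) (hF _ (Γ.lower ?_ hΓ))
    refine Finset.union_subset ((sum_single_one_le σ b).1 hle) fun v hv => ?_
    rw [Finsupp.mem_support_iff, Finsupp.tsub_apply] at hv
    rw [Finsupp.mem_support_iff]
    omega
  · exact hb rfl

section Parameters

variable (d : ℕ) (t : V → k)

/-- The linear form of the polynomial ring in `d` variables whose coefficients are those of
a polynomial of degree less than `d`. -/
noncomputable def linearForm : Polynomial k →ₗ[k] MvPolynomial (Fin d) k :=
  ∑ j : Fin d, (LinearMap.toSpanSingleton k _ (X j)) ∘ₗ Polynomial.lcoeff k j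

/-- The parameters `θ_j = ∑ t_i ^ j x_i`.  By the Vandermonde determinant, any `d` of
the `x_i` can be expressed by the parameters modulo the others. -/
noncomputable def parameterMap : MvPolynomial (Fin d) k →ₐ[k] MvPolynomial V k :=
  aeval fun j => ∑ i, C (t i ^ (j : ℕ)) * X i

/-- The restriction to the coordinate subspace of a facet `F`, whose coordinate ring is identified
with the ring of the parameters by Lagrange interpolation. -/
noncomputable def restrictFacet (F : Finset V) : MvPolynomial V k →ₐ[k] MvPolynomial (Fin d) k :=
  aeval fun i => if i ∈ F then linearForm d (Lagrange.basis F t i) else 0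

variable {d t}

lemma linearForm_apply (p : Polynomial k) :
    linearForm d p = ∑ j : Fin d, C (p.coeff j) * X j := by
  simp [linearForm, smul_eq_C_mul]

lemma linearForm_X_pow (j : Fin d) : linearForm d (Polynomial.X ^ (j : ℕ)) = (X j :
    MvPolynomial (Fin d) k) := by
  rw [linearForm_apply, Finset.sum_eq_single j]
  · simp
  · intro i _ hij
    rw [Polynomial.coeff_X_pow, if_neg fun e => hij (Fin.ext e), C_0, zero_mul]
  · simp

lemma linearForm_ne_zero {p : Polynomial k} (hp : p.degree < d) (h0 : p ≠ 0) :
    linearForm d p ≠ 0 := by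
  intro h
  refine h0 (Polynomial.ext fun j => ?_)
  by_cases hj : j < d
  · have h1 := congrArg (coeff (Finsupp.single (⟨j, hj⟩ : Fin d) 1)) h
    rw [linearForm_apply, coeff_sum, Finset.sum_eq_single ⟨j, hj⟩] at h1
    · simpa using h1
    · intro i _ hij
      rw [coeff_C_mul, coeff_X, if_neg, mul_zero]
      intro e
      exact hij (Finsupp.single_left_injective one_ne_zero e)
    · simp
  · rw [Polynomial.coeff_zero]
    exact Polynomial.coeff_eq_zero_of_degree_lt (hp.trans_le (by exact_mod_cast not_lt.1 hj))

lemma constantCoeff_linearForm (p : Polynomial k) : constantCoeff (linearForm d p) = 0 := by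
  simp [linearForm_apply]

lemma parameterMap_linearForm {p : Polynomial k} (hp : p.degree < d) :
    parameterMap d t (linearForm d p) = ∑ i, C (p.eval (t i)) * X i := by
  rw [linearForm_apply, map_sum]
  simp only [map_mul, parameterMap, algHom_C, aeval_X, algebraMap_eq, Finset.mul_sum]
  rw [Finset.sum_comm]
  refine Finset.sum_congr rfl fun i _ => ?_
  simp only [← mul_assoc, ← C_mul]
  rw [← Finset.sum_mul, ← map_sum]
  congr 2
  rcases eq_or_ne p 0 with rfl | h0
  · simp
  · rw [Polynomial.eval_eq_sum_range' ((Polynomial.natDegree_lt_iff_degree_lt h0).2 hp),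
      Finset.sum_range]

/-- The restriction to a facet is a retraction of the parameters. -/
lemma restrictFacet_parameterMap (ht : Function.Injective t) {F : Finset V} (hF : F.card = d)
    (s : MvPolynomial (Fin d) k) : restrictFacet d t F (parameterMap d t s) = s := by
  have : (restrictFacet d t F).comp (parameterMap d t) = AlgHom.id k _ := by
    ext1 j
    rw [AlgHom.comp_apply, parameterMap, aeval_X, map_sum, AlgHom.id_apply]
    simp only [map_mul, algHom_C, algebraMap_eq, restrictFacet, aeval_X, mul_ite, mul_zero]
    rw [Finset.sum_ite_mem, Finset.univ_inter]
    have hdeg : (Polynomial.X ^ (j : ℕ) : Polynomial k).degree < F.card := by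
      rw [Polynomial.degree_X_pow, hF]
      exact_mod_cast j.2
    have hint := Lagrange.eq_interpolate (v := t) ht.injOn hdeg
    rw [Lagrange.interpolate_apply] at hint
    conv_rhs => rw [← linearForm_X_pow, hint, map_sum]
    refine Finset.sum_congr rfl fun i _ => ?_
    rw [← Polynomial.smul_eq_C_mul, map_smul, smul_eq_C_mul, Polynomial.eval_pow,
      Polynomial.eval_X]
  exact AlgHom.congr_fun this s

lemma X_mem_of_notMem {F : Finset V} {i : V} (hi : i ∉ F) :
    (X i : MvPolynomial V k) ∈ stanleyReisnerIdeal k (LowerSet.Iic F) := by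
  have h1 : faceMonomial k {i} ∈ stanleyReisnerIdeal k (LowerSet.Iic F) :=
    faceMonomial_mem fun hm => hi (Finset.singleton_subset_iff.1 (LowerSet.mem_Iic_iff.1 hm))
  rwa [faceMonomial, Finset.prod_singleton] at h1

/-- On the coordinate subspace of a facet, every polynomial is a polynomial in the parameters. -/
lemma sub_parameterMap_mem (ht : Function.Injective t) {F : Finset V} (hF : F.card = d)
    (p : MvPolynomial V k) : p - parameterMap d t (restrictFacet d t F p) ∈
      stanleyReisnerIdeal k (LowerSet.Iic F) := by
  rw [← Ideal.Quotient.eq]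
  have : Ideal.Quotient.mkₐ k (stanleyReisnerIdeal k (LowerSet.Iic F)) =
      (Ideal.Quotient.mkₐ k (stanleyReisnerIdeal k (LowerSet.Iic F))).comp
        ((parameterMap d t).comp (restrictFacet d t F)) := by
    ext1 i
    simp only [AlgHom.comp_apply, restrictFacet, aeval_X, Ideal.Quotient.mkₐ_eq_mk]
    split_ifs with hi
    · have hdeg : (Lagrange.basis F t i).degree < d := by
        rw [Lagrange.degree_basis ht.injOn hi, hF]
        have : 0 < d := hF ▸ Finset.card_pos.2 ⟨i, hi⟩
        exact_mod_cast Nat.sub_lt this one_pos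
      rw [parameterMap_linearForm hdeg, Ideal.Quotient.eq, ← Finset.add_sum_erase _ _
        (Finset.mem_univ i), Lagrange.eval_basis_self ht.injOn hi, C_1, one_mul, sub_add_cancel_left]
      refine neg_mem (sum_mem fun j hj => ?_)
      by_cases hjF : j ∈ F
      · rw [Lagrange.eval_basis_of_ne (Finset.ne_of_mem_erase hj).symm hjF, C_0, zero_mul]
        exact zero_mem _
      · exact Ideal.mul_mem_left _ _ (X_mem_of_notMem hjF)
    · rw [map_zero, map_zero, Ideal.Quotient.eq_zero_iff_mem]
      exact X_mem_of_notMem hi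
  exact AlgHom.congr_fun this p

lemma restrictFacet_eq_zero {F : Finset V} {p : MvPolynomial V k}
    (hp : p ∈ stanleyReisnerIdeal k (LowerSet.Iic F)) : restrictFacet d t F p = 0 := by
  have : stanleyReisnerIdeal k (LowerSet.Iic F) ≤ RingHom.ker (restrictFacet d t F) := by
    rw [stanleyReisnerIdeal, Ideal.span_le]
    rintro _ ⟨G, hG, rfl⟩
    obtain ⟨i, hiG, hiF⟩ := Finset.not_subset.1 fun hs => hG (LowerSet.mem_Iic_iff.2 hs)
    rw [SetLike.mem_coe, RingHom.mem_ker, map_prod]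
    refine Finset.prod_eq_zero hiG ?_
    rw [restrictFacet, aeval_X, if_neg hiF]
  exact this hp

lemma stanleyReisnerIdeal_anti {Γ Γ' : LowerSet (Finset V)} (h : Γ ≤ Γ') :
    stanleyReisnerIdeal k Γ' ≤ stanleyReisnerIdeal k Γ := fun p hp => by
  rw [mem_stanleyReisnerIdeal] at hp ⊢
  exact fun b hb hΓ => hp b hb (h hΓ)

lemma restrictFacet_faceMonomial_ne_zero (ht : Function.Injective t) {F G : Finset V}
    (hF : F.card = d) (hG : G ⊆ F) : restrictFacet d t F (faceMonomial k G) ≠ 0 := by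
  rw [faceMonomial, map_prod]
  refine Finset.prod_ne_zero_iff.2 fun i hi => ?_
  rw [restrictFacet, aeval_X, if_pos (hG hi)]
  refine linearForm_ne_zero ?_ (Lagrange.basis_ne_zero ht.injOn (hG hi))
  rw [Lagrange.degree_basis ht.injOn (hG hi), hF]
  have : 0 < d := hF ▸ Finset.card_pos.2 ⟨i, hG hi⟩
  exact_mod_cast Nat.sub_lt this one_pos

end Parameters

namespace ReversibleShelling

variable {Δ : LowerSet (Finset V)} {d m : ℕ} {F R : ℕ → Finset V}
  (h : ReversibleShelling Δ d m F R) {t : V → k} (ht : Function.Injective t)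

/-- The complex generated by the first `j` facets. -/
def initial (F : ℕ → Finset V) (j : ℕ) : LowerSet (Finset V) where
  carrier := {τ | ∃ i < j, τ ⊆ F i}
  lower' := fun _ _ hle ⟨i, hi, hs⟩ => ⟨i, hi, subset_trans hle hs⟩

include h

lemma initial_eq : initial F m = Δ := by
  ext τ
  exact (h.mem_iff τ).symm

include ht

/-- The Stanley–Reisner rings of the initial parts of a shelling are projective over the ring of
parameters, by induction: the ideal that is killed in the step from `j + 1` to `j` is generated by
the monomial of `R j`, and it is free of rank one. -/
lemma projective_step {j : ℕ} (hj : j < m) :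
    let _ : Algebra (MvPolynomial (Fin d) k) (MvPolynomial V k) :=
      (parameterMap d t).toRingHom.toAlgebra
    Module.Projective (MvPolynomial (Fin d) k)
      (MvPolynomial V k ⧸ stanleyReisnerIdeal k (initial F j)) →
    Module.Projective (MvPolynomial (Fin d) k)
      (MvPolynomial V k ⧸ stanleyReisnerIdeal k (initial F (j + 1))) ∧
    ∃ r : (MvPolynomial V k ⧸ stanleyReisnerIdeal k (initial F (j + 1)))
        →ₗ[MvPolynomial (Fin d) k] MvPolynomial (Fin d) k,
      r (Ideal.Quotient.mk _ (faceMonomial k (R j))) = 1 := by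
  intro _ hproj
  have hle : initial F j ≤ initial F (j + 1) := fun τ ⟨i, hi, hs⟩ =>
    ⟨i, hi.trans j.lt_succ_self, hs⟩
  have hcard := h.card_eq j hj
  have hR : ∀ c, R j ∪ c ∈ initial F (j + 1) → c ⊆ F j := by
    rintro c ⟨i, hi, hs⟩
    rcases Nat.lt_succ_iff_lt_or_eq.1 hi with hlt | rfl
    · exact absurd (Finset.union_subset_left hs) (h.forward i j hlt hj)
    · exact Finset.union_subset_right hs
  have hmem : ∀ p : MvPolynomial V k, faceMonomial k (R j) * p -
      parameterMap d t (restrictFacet d t (F j) p) * faceMonomial k (R j) ∈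
        stanleyReisnerIdeal k (initial F (j + 1)) := fun p => by
    have := faceMonomial_mul_mem hR (sub_parameterMap_mem ht hcard p)
    rwa [mul_sub, mul_comm _ (parameterMap d t _)] at this
  refine projective_quotient_step (stanleyReisnerIdeal_anti hle) ?_ ?_ ?_ hproj
  · exact faceMonomial_mem fun ⟨i, hi, hs⟩ => h.forward i j hi hj hs
  · intro s hs
    have hle' : LowerSet.Iic (F j) ≤ initial F (j + 1) := fun τ hτ =>
      ⟨j, j.lt_succ_self, LowerSet.mem_Iic_iff.1 hτ⟩
    have hs' : parameterMap d t s * faceMonomial k (R j) ∈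
        stanleyReisnerIdeal k (LowerSet.Iic (F j)) :=
      stanleyReisnerIdeal_anti hle' hs
    have h0 := restrictFacet_eq_zero (d := d) (t := t) hs'
    rw [map_mul, restrictFacet_parameterMap ht hcard] at h0
    exact (mul_eq_zero.1 h0).resolve_right
      (restrictFacet_faceMonomial_ne_zero ht hcard (h.subset j hj))
  · -- A face of the new complex that is not in the old one lies between `R j` and `F j`.
    intro p hp
    rw [mem_stanleyReisnerIdeal] at hp
    have hmono : ∀ b ∈ p.support, ∃ s : MvPolynomial (Fin d) k,
        monomial b (coeff b p) - parameterMap d t s * faceMonomial k (R j) ∈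
          stanleyReisnerIdeal k (initial F (j + 1)) := by
      intro b hb
      by_cases hbj : b.support ∈ initial F (j + 1)
      · have hbF : b.support ⊆ F j := by
          obtain ⟨i, hi, hs⟩ := hbj
          rcases Nat.lt_succ_iff_lt_or_eq.1 hi with hlt | rfl
          · exact absurd ⟨i, hlt, hs⟩ (hp b hb)
          · exact hs
        have hbR : R j ⊆ b.support := by
          intro v hv
          by_contra hvb
          obtain ⟨i, hi, hs⟩ := h.exists_lt hj hv
          exact hp b hb ⟨i, hi, fun w hw => hs (Finset.mem_erase.2
            ⟨fun e => hvb (e ▸ hw), hbF hw⟩)⟩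
        have hdvd : faceMonomial k (R j) ∣ monomial b (coeff b p) := by
          rw [faceMonomial_eq, monomial_dvd_monomial]
          exact ⟨Or.inr ((sum_single_one_le _ b).2 hbR), one_dvd _⟩
        obtain ⟨q, hq⟩ := hdvd
        exact ⟨restrictFacet d t (F j) q, hq ▸ hmem q⟩
      · refine ⟨0, ?_⟩
        rw [map_zero, zero_mul, sub_zero, mem_stanleyReisnerIdeal]
        intro c hc
        have hbc : b = c := by
          by_contra hne
          rw [mem_support_iff, coeff_monomial, if_neg hne] at hc
          exact hc rfl
        rwa [← hbc]
    choose! s hs using hmono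
    refine ⟨∑ b ∈ p.support, s b, ?_⟩
    change p - parameterMap d t _ * _ ∈ _
    have : p - parameterMap d t (∑ b ∈ p.support, s b) * faceMonomial k (R j) =
        ∑ b ∈ p.support,
          (monomial b (coeff b p) - parameterMap d t (s b) * faceMonomial k (R j)) := by
      rw [Finset.sum_sub_distrib, ← p.as_sum, map_sum, Finset.sum_mul]
    rw [this]
    exact sum_mem hs

/-- The Stanley–Reisner ring is a projective module over the parameters: it is Cohen–Macaulay. -/
lemma projective_initial {j : ℕ} (hj : j ≤ m) :
    let _ : Algebra (MvPolynomial (Fin d) k) (MvPolynomial V k) :=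
      (parameterMap d t).toRingHom.toAlgebra
    Module.Projective (MvPolynomial (Fin d) k)
      (MvPolynomial V k ⧸ stanleyReisnerIdeal k (initial F j)) := by
  intro _
  induction j with
  | zero =>
    have : Subsingleton (MvPolynomial V k ⧸ stanleyReisnerIdeal k (initial F 0)) := by
      rw [Ideal.Quotient.subsingleton_iff, Ideal.eq_top_iff_one]
      refine mem_stanleyReisnerIdeal.2 fun b _ ⟨i, hi, _⟩ => ?_
      omega
    infer_instance
  | succ j ih => exact (h.projective_step ht hj (ih (Nat.le_of_succ_le hj))).1

end ReversibleShelling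

end Frobenius

/-! ### The Frobenius form on the Stanley–Reisner ring -/

section FrobeniusForm

set_option linter.unusedSectionVars false

open MvPolynomial

variable {V : Type} [Fintype V] [LinearOrder V] {k : Type} [Field k]

/-- The linear form in the parameters whose image `∑ p(t_i) x_i`, where `p` is the polynomial with
the roots `t_i` for `i` in `ρ`, does not involve the variables of `ρ`. -/
noncomputable def ridgeForm (d : ℕ) (t : V → k) (ρ : Finset V) : MvPolynomial (Fin d) k :=
  linearForm d (Lagrange.nodal ρ t)

/-- An additive map that is linear over the parameters and vanishes on the Stanley–Reisner ideal,
i.e. a linear functional on the Stanley–Reisner ring as a module over the parameters. -/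
structure IsFunctional (Δ : LowerSet (Finset V)) (d : ℕ) (t : V → k)
    (g : MvPolynomial V k →+ MvPolynomial (Fin d) k) : Prop where
  map_ideal : ∀ p ∈ stanleyReisnerIdeal k Δ, g p = 0
  apply_mul : ∀ s p, g (parameterMap d t s * p) = s * g p

lemma IsFunctional.eq_of_sub_mem {Δ : LowerSet (Finset V)} {d : ℕ} {t : V → k}
    {g : MvPolynomial V k →+ MvPolynomial (Fin d) k} (hg : IsFunctional Δ d t g)
    {p q : MvPolynomial V k} (hpq : p - q ∈ stanleyReisnerIdeal k Δ) : g p = g q := by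
  rw [← sub_eq_zero, ← map_sub, hg.map_ideal _ hpq]

lemma IsFunctional.map_C_mul {Δ : LowerSet (Finset V)} {d : ℕ} {t : V → k}
    {g : MvPolynomial V k →+ MvPolynomial (Fin d) k} (hg : IsFunctional Δ d t g)
    (c : k) (p : MvPolynomial V k) : g (C c * p) = C c * g p := by
  rw [← hg.apply_mul, ← algebraMap_eq, ← algebraMap_eq, AlgHom.commutes]

lemma homogeneousComponent_X_mul {ι : Type} (n : ℕ) (j : ι) (q : MvPolynomial ι k) :
    homogeneousComponent (n + 1) (X j * q) = X j * homogeneousComponent n q := by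
  classical
  ext b
  rw [coeff_homogeneousComponent, coeff_X_mul', coeff_X_mul', coeff_homogeneousComponent]
  by_cases hj : j ∈ b.support
  · have hb : (b - Finsupp.single j 1).degree + 1 = b.degree := by
      have hle : Finsupp.single j 1 ≤ b :=
        Finsupp.single_le_iff.2 (Nat.one_le_iff_ne_zero.2 (Finsupp.mem_support_iff.1 hj))
      conv_rhs => rw [← tsub_add_cancel_of_le hle, map_add, Finsupp.degree_single]
    simp only [if_pos hj, ← hb, add_left_inj]
  · simp only [if_neg hj, ite_self]

lemma homogeneousComponent_zero_X_mul {ι : Type} (j : ι) (q : MvPolynomial ι k) :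
    homogeneousComponent 0 (X j * q) = 0 := by
  rw [homogeneousComponent_zero, ← constantCoeff_eq, map_mul, constantCoeff_X, zero_mul, C_0]

/-- The homogeneous component of degree `-d` of a functional, defined on the basis of
monomials. -/
noncomputable def lowestComponent {d : ℕ} (g : MvPolynomial V k →+ MvPolynomial (Fin d) k) :
    MvPolynomial V k →ₗ[k] MvPolynomial (Fin d) k :=
  (basisMonomials V k).constr k fun b =>
    if d ≤ b.degree then homogeneousComponent (b.degree - d) (g (monomial b 1)) else 0

lemma lowestComponent_monomial {d : ℕ} (g : MvPolynomial V k →+ MvPolynomial (Fin d) k)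
    (b : V →₀ ℕ) : lowestComponent g (monomial b 1) =
      if d ≤ b.degree then homogeneousComponent (b.degree - d) (g (monomial b 1)) else 0 := by
  have := (basisMonomials V k).constr_basis k (fun b =>
    if d ≤ b.degree then homogeneousComponent (b.degree - d) (g (monomial b 1)) else 0) b
  rwa [coe_basisMonomials] at this

lemma isFunctional_lowestComponent {Δ : LowerSet (Finset V)} {d : ℕ} {t : V → k}
    {g : MvPolynomial V k →+ MvPolynomial (Fin d) k} (hg : IsFunctional Δ d t g) :
    IsFunctional Δ d t (lowestComponent g).toAddMonoidHom := by
  have hexpand : ∀ p : MvPolynomial V k, p = ∑ b ∈ p.support, coeff b p • monomial b 1 :=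
    fun p => by
      conv_lhs => rw [p.as_sum]
      exact Finset.sum_congr rfl fun b _ => by rw [smul_monomial, smul_eq_mul, mul_one]
  refine ⟨fun p hp => ?_, fun s p => ?_⟩
  · change lowestComponent g p = 0
    rw [hexpand p, map_sum]
    refine Finset.sum_eq_zero fun b hb => ?_
    rw [map_smul, lowestComponent_monomial, hg.map_ideal _
      (monomial_mem_stanleyReisnerIdeal.2 (mem_stanleyReisnerIdeal.1 hp b hb)), map_zero, ite_self,
      smul_zero]
  · change lowestComponent g _ = s * lowestComponent g p
    induction s using MvPolynomial.induction_on generalizing p with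
    | C c =>
      rw [← algebraMap_eq, AlgHom.commutes, ← Algebra.smul_def, ← Algebra.smul_def, map_smul]
    | add s s' hs hs' => rw [map_add, add_mul, map_add, hs, hs', add_mul]
    | mul_X s j hs =>
      rw [map_mul (parameterMap d t), mul_assoc, hs, mul_assoc]
      congr 1
      rw [hexpand p, Finset.mul_sum, map_sum, map_sum, Finset.mul_sum]
      refine Finset.sum_congr rfl fun b _ => ?_
      rw [mul_smul_comm, map_smul, map_smul, mul_smul_comm]
      congr 1
      have hX : parameterMap d t (X j) * monomial b 1 =
          ∑ i, C (t i ^ (j : ℕ)) * monomial (Finsupp.single i 1 + b) 1 := by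
        rw [parameterMap, aeval_X, Finset.sum_mul]
        refine Finset.sum_congr rfl fun i _ => ?_
        rw [mul_assoc, X, monomial_mul, one_mul]
      have hmul := hg.apply_mul (X j) (monomial b 1)
      rw [hX, map_sum] at hmul
      simp only [hg.map_C_mul] at hmul
      rw [hX, map_sum]
      simp only [C_mul', map_smul, lowestComponent_monomial, map_add, Finsupp.degree_single]
      simp only [C_mul'] at hmul
      rcases lt_trichotomy (b.degree + 1) d with hlt | heq | hgt
      · rw [if_neg (by omega), mul_zero]
        exact Finset.sum_eq_zero fun i _ => by rw [if_neg (by omega), smul_zero]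
      · rw [if_neg (by omega : ¬ d ≤ b.degree), mul_zero,
          ← homogeneousComponent_zero_X_mul j (g (monomial b 1)), ← hmul, map_sum]
        refine Finset.sum_congr rfl fun i _ => ?_
        rw [if_pos (by omega), map_smul, show 1 + b.degree - d = 0 by omega]
      · rw [if_pos (by omega : d ≤ b.degree), ← homogeneousComponent_X_mul, ← hmul, map_sum]
        refine Finset.sum_congr rfl fun i _ => ?_
        rw [if_pos (by omega), map_smul, show 1 + b.degree - d = b.degree - d + 1 by omega]

namespace ReversibleShelling

variable {Δ : LowerSet (Finset V)} {d m : ℕ} {F R : ℕ → Finset V}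
  (h : ReversibleShelling Δ d m F R) {t : V → k} (ht : Function.Injective t)

include h

lemma mem_ideal_of_forall {p : MvPolynomial V k}
    (hp : ∀ i < m, p ∈ stanleyReisnerIdeal k (LowerSet.Iic (F i))) :
    p ∈ stanleyReisnerIdeal k Δ := by
  rw [mem_stanleyReisnerIdeal]
  intro b hb hΔ
  obtain ⟨i, hi, hs⟩ := (h.mem_iff _).1 hΔ
  exact mem_stanleyReisnerIdeal.1 (hp i hi) b hb (LowerSet.mem_Iic_iff.2 hs)

include ht

lemma mem_ideal_of_restrictFacet {p : MvPolynomial V k}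
    (hp : ∀ i < m, restrictFacet d t (F i) p = 0) : p ∈ stanleyReisnerIdeal k Δ := by
  refine h.mem_ideal_of_forall fun i hi => ?_
  have := sub_parameterMap_mem ht (h.card_eq i hi) p
  rwa [hp i hi, map_zero, sub_zero] at this

/-- On the ideal generated by the monomial of a facet, a functional is determined by its value at
this monomial. -/
lemma functional_facet_mul {g : MvPolynomial V k →+ MvPolynomial (Fin d) k}
    (hg : IsFunctional Δ d t g) {i : ℕ} (hi : i < m) (p : MvPolynomial V k) :
    g (faceMonomial k (F i) * p) = restrictFacet d t (F i) p * g (faceMonomial k (F i)) := by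
  rw [← hg.apply_mul]
  refine hg.eq_of_sub_mem ?_
  rw [mul_comm (parameterMap d t _), ← mul_sub]
  refine faceMonomial_mul_mem (fun c hc => ?_) (sub_parameterMap_mem ht (h.card_eq i hi) p)
  rw [← h.eq_facet hi hc Finset.subset_union_left]
  exact Finset.subset_union_right

omit ht in
lemma degree_nodal_lt {i : ℕ} (hi : i < m) {v : V} (hv : v ∈ F i) :
    (Lagrange.nodal ((F i).erase v) t).degree < d := by
  rw [Lagrange.degree_nodal, Finset.card_erase_of_mem hv, h.card_eq i hi]
  have : 0 < d := h.card_eq i hi ▸ Finset.card_pos.2 ⟨v, hv⟩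
  exact_mod_cast Nat.sub_lt this one_pos

/-- The relation between the values of a functional at the two facets through a ridge. -/
lemma functional_ridge {i j : ℕ} (hi : i < m) (hj : j < m) (hij : i ≠ j) {v : V} (hv : v ∈ F i)
    (hs : (F i).erase v ⊆ F j) : ∃ a b : k, a ≠ 0 ∧ b ≠ 0 ∧
      ∀ g : MvPolynomial V k →+ MvPolynomial (Fin d) k, IsFunctional Δ d t g →
        C a * g (faceMonomial k (F i)) + C b * g (faceMonomial k (F j)) =
          ridgeForm d t ((F i).erase v) * g (faceMonomial k ((F i).erase v)) := by
  obtain ⟨w, hwj, hwv, herase, honly⟩ := h.exists_neighbour hi hj hij hv hs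
  set ρ := (F i).erase v with hρ
  have hvρ : v ∉ ρ := Finset.notMem_erase v _
  have hwρ : w ∉ ρ := herase ▸ Finset.notMem_erase w _
  have hne : ∀ u ∉ ρ, (Lagrange.nodal ρ t).eval (t u) ≠ 0 := fun u hu =>
    Lagrange.eval_nodal_not_at_node fun x hx e => hu (ht e ▸ hx)
  refine ⟨_, _, hne v hvρ, hne w hwρ, fun g hg => ?_⟩
  rw [← hg.map_C_mul, ← hg.map_C_mul, ← map_add, ← hg.apply_mul]
  refine (hg.eq_of_sub_mem ?_).symm
  rw [ridgeForm, parameterMap_linearForm (h.degree_nodal_lt hi hv), Finset.sum_mul,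
    ← Finset.add_sum_erase _ _ (Finset.mem_univ v), ← Finset.add_sum_erase _ _
    (Finset.mem_erase.2 ⟨hwv, Finset.mem_univ w⟩)]
  have hv' : X v * faceMonomial k ρ = faceMonomial k (F i) := by
    rw [mul_comm, faceMonomial_insert hvρ, hρ, Finset.insert_erase hv]
  have hw' : X w * faceMonomial k ρ = faceMonomial k (F j) := by
    rw [mul_comm, faceMonomial_insert hwρ, ← herase, Finset.insert_erase hwj]
  rw [mul_assoc, hv', mul_assoc, hw', ← add_assoc, add_sub_cancel_left]
  refine sum_mem fun u hu => ?_
  rw [Finset.mem_erase, Finset.mem_erase] at hu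
  by_cases huρ : u ∈ ρ
  · rw [Lagrange.eval_nodal_at_node huρ, C_0, zero_mul, zero_mul]
    exact zero_mem _
  · rw [mul_assoc, mul_comm (X u), faceMonomial_insert huρ]
    refine Ideal.mul_mem_left _ _ (faceMonomial_mem fun hmem => ?_)
    rcases honly u huρ hmem with e | e
    · exact hu.2.1 e
    · exact hu.1 e

/-- There is a functional whose values at the monomials of the facets are nonzero constants. At
the last facet, whose restriction set is everything, this comes from the splitting in
`projective_step`, and `functional_ridge` propagates it to the other facets. -/
lemma exists_functional : ∃ (g : MvPolynomial V k →+ MvPolynomial (Fin d) k) (c : ℕ → k),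
    IsFunctional Δ d t g ∧ ∀ i < m, c i ≠ 0 ∧ g (faceMonomial k (F i)) = C (c i) := by
  let _ : Algebra (MvPolynomial (Fin d) k) (MvPolynomial V k) :=
    (parameterMap d t).toRingHom.toAlgebra
  have hm : m - 1 < m := Nat.sub_lt h.pos one_pos
  have hstep := h.projective_step ht hm (h.projective_initial ht hm.le)
  have hI : initial F (m - 1 + 1) = Δ := by
    rw [Nat.sub_add_cancel h.pos, h.initial_eq]
  rw [hI, h.restriction_last] at hstep
  obtain ⟨-, r, hr⟩ := hstep
  let g₀ : MvPolynomial V k →+ MvPolynomial (Fin d) k :=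
    r.toAddMonoidHom.comp (Ideal.Quotient.mk (stanleyReisnerIdeal k Δ)).toAddMonoidHom
  have hg₀ : IsFunctional Δ d t g₀ := by
    refine ⟨fun p hp => ?_, fun s p => ?_⟩
    · change r (Ideal.Quotient.mk _ p) = 0
      rw [Ideal.Quotient.eq_zero_iff_mem.2 hp, map_zero]
    · change r (Ideal.Quotient.mk _ (algebraMap _ _ s * p)) = s * r (Ideal.Quotient.mk _ p)
      exact (congrArg r (Algebra.smul_def s (Ideal.Quotient.mk _ p)).symm).trans (r.map_smul s _)
  have hconst : ∀ i < m, (lowestComponent g₀).toAddMonoidHom (faceMonomial k (F i)) =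
      C (constantCoeff (g₀ (faceMonomial k (F i)))) := by
    intro i hi
    change lowestComponent g₀ _ = _
    have hd : (∑ v ∈ F i, Finsupp.single v 1 : V →₀ ℕ).degree = d := by
      rw [map_sum]
      simp [h.card_eq i hi]
    rw [faceMonomial_eq, lowestComponent_monomial, hd, if_pos le_rfl, Nat.sub_self,
      homogeneousComponent_zero, constantCoeff_eq]
  refine ⟨_, fun i => constantCoeff (g₀ (faceMonomial k (F i))), isFunctional_lowestComponent hg₀,
    fun i hi => ⟨?_, hconst i hi⟩⟩
  refine h.star_connected (σ := ∅) (fun i => constantCoeff (g₀ (faceMonomial k (F i))) ≠ 0)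
    ?_ hm hi (Finset.empty_subset _) (Finset.empty_subset _) ?_
  · intro i hi j hj v hv _ hij hs _ _
    obtain ⟨a, b, ha, hb, hab⟩ := h.functional_ridge ht hi hj hij hv hs
    have := congrArg constantCoeff (hab g₀ hg₀)
    simp only [map_add, map_mul, constantCoeff_C, ridgeForm, constantCoeff_linearForm,
      zero_mul] at this
    rw [not_iff_not]
    constructor
    · intro h0
      rw [h0, mul_zero, zero_add] at this
      exact (mul_eq_zero.1 this).resolve_left hb
    · intro h0
      rw [h0, mul_zero, add_zero] at this
      exact (mul_eq_zero.1 this).resolve_left ha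
  · change constantCoeff (r (Ideal.Quotient.mk _ _)) ≠ 0
    rw [hr, map_one]
    exact one_ne_zero

/-- Polynomials on the facets that agree on the ridges can be glued. The coefficient of a monomial
with support `σ` does not depend on the facet, because the star of `σ` is strongly connected. -/
lemma exists_glue (s : ℕ → MvPolynomial (Fin d) k)
    (hs : ∀ i < m, ∀ j < m, i ≠ j → ∀ v ∈ F i, (F i).erase v ⊆ F j →
      ridgeForm d t ((F i).erase v) ∣ s i - s j) :
    ∃ a : MvPolynomial V k, ∀ i < m, restrictFacet d t (F i) a = s i := by
  classical
  have hcoeff : ∀ i < m, ∀ j < m, ∀ b : V →₀ ℕ, b.support ⊆ F i → b.support ⊆ F j →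
      coeff b (parameterMap d t (s i)) = coeff b (parameterMap d t (s j)) := by
    intro i hi j hj b hbi hbj
    refine h.star_connected (σ := b.support)
      (fun l => coeff b (parameterMap d t (s i)) = coeff b (parameterMap d t (s l)))
      ?_ hi hj hbi hbj rfl
    intro l hl l' hl' v hv hvb hll hsub hbl _
    obtain ⟨u, hu⟩ := hs l hl l' hl' hll v hv hsub
    have hmem : parameterMap d t (ridgeForm d t ((F l).erase v) * u) ∈
        stanleyReisnerIdeal k (LowerSet.Iic ((F l).erase v)) := by
      rw [map_mul, ridgeForm, parameterMap_linearForm (h.degree_nodal_lt hl hv)]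
      refine Ideal.mul_mem_right _ _ (sum_mem fun x _ => ?_)
      by_cases hx : x ∈ (F l).erase v
      · rw [Lagrange.eval_nodal_at_node hx, C_0, zero_mul]
        exact zero_mem _
      · exact Ideal.mul_mem_left _ _ (X_mem_of_notMem hx)
    have h0 : coeff b (parameterMap d t (s l - s l')) = 0 := by
      by_contra hne
      rw [hu] at hne
      refine mem_stanleyReisnerIdeal.1 hmem b (mem_support_iff.2 hne) (LowerSet.mem_Iic_iff.2 ?_)
      exact fun x hx => Finset.mem_erase.2 ⟨fun e => hvb (e ▸ hx), hbl hx⟩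
    rw [map_sub, coeff_sub, sub_eq_zero] at h0
    rw [h0]
  have hex : ∀ b : V →₀ ℕ, ∃ i, b.support ∈ Δ → i < m ∧ b.support ⊆ F i := fun b => by
    by_cases hb : b.support ∈ Δ
    · obtain ⟨i, hi⟩ := (h.mem_iff _).1 hb
      exact ⟨i, fun _ => hi⟩
    · exact ⟨0, fun hb' => absurd hb' hb⟩
  choose n hn using hex
  let B : Finset (V →₀ ℕ) :=
    (Finset.range m).biUnion fun i => (parameterMap d t (s i)).support
  let a : MvPolynomial V k := ∑ b ∈ B, monomial b (coeff b (parameterMap d t (s (n b))))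
  have ha : ∀ i < m, a - parameterMap d t (s i) ∈ stanleyReisnerIdeal k (LowerSet.Iic (F i)) := by
    intro i hi
    rw [mem_stanleyReisnerIdeal]
    intro b hb hbF
    rw [LowerSet.mem_Iic_iff] at hbF
    obtain ⟨hnm, hnF⟩ := hn b ((h.mem_iff _).2 ⟨i, hi, hbF⟩)
    refine mem_support_iff.1 hb ?_
    rw [coeff_sub, sub_eq_zero, ← hcoeff (n b) hnm i hi b hnF hbF, coeff_sum]
    simp only [coeff_monomial, Finset.sum_ite_eq']
    split_ifs with hB
    · rfl
    · by_contra hne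
      exact hB (Finset.mem_biUnion.2
        ⟨n b, Finset.mem_range.2 hnm, mem_support_iff.2 (Ne.symm hne)⟩)
  refine ⟨a, fun i hi => ?_⟩
  have := restrictFacet_eq_zero (d := d) (t := t) (ha i hi)
  rwa [map_sub, restrictFacet_parameterMap ht (h.card_eq i hi), sub_eq_zero] at this

/-- A functional that vanishes at the monomials of the facets is zero: these monomials generate a
submodule of full rank. -/
lemma functional_eq_zero {g : MvPolynomial V k →+ MvPolynomial (Fin d) k}
    (hg : IsFunctional Δ d t g) (h0 : ∀ i < m, g (faceMonomial k (F i)) = 0)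
    (p : MvPolynomial V k) : g p = 0 := by
  let q : ℕ → MvPolynomial (Fin d) k := fun l => restrictFacet d t (F l) (faceMonomial k (F l))
  have hq : ∀ l ∈ Finset.range m, q l ≠ 0 := fun l hl =>
    restrictFacet_faceMonomial_ne_zero ht (h.card_eq l (Finset.mem_range.1 hl)) subset_rfl
  have hoff : ∀ l < m, ∀ i < m, i ≠ l →
      restrictFacet d t (F l) (faceMonomial k (F i)) = 0 := by
    intro l hl i hi hil
    refine restrictFacet_eq_zero (faceMonomial_mem fun hmem => ?_)
    exact hil (h.facet_injOn hi hl
      (h.eq_facet hi (h.facet_mem hl) (LowerSet.mem_Iic_iff.1 hmem)).symm)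
  have hmem : parameterMap d t (∏ l ∈ Finset.range m, q l) * p -
      ∑ i ∈ Finset.range m, parameterMap d t ((∏ l ∈ (Finset.range m).erase i, q l) *
        restrictFacet d t (F i) p) * faceMonomial k (F i) ∈ stanleyReisnerIdeal k Δ := by
    refine h.mem_ideal_of_restrictFacet ht fun l hl => ?_
    rw [map_sub, map_mul, restrictFacet_parameterMap ht (h.card_eq l hl), map_sum,
      Finset.sum_eq_single l, map_mul, restrictFacet_parameterMap ht (h.card_eq l hl),
      ← Finset.mul_prod_erase _ _ (Finset.mem_range.2 hl)]
    · change q l * _ * _ - _ * q l = 0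
      ring
    · intro i hi hil
      rw [map_mul, hoff l hl i (Finset.mem_range.1 hi) hil, mul_zero]
    · exact fun hl' => absurd (Finset.mem_range.2 hl) hl'
  have := hg.eq_of_sub_mem hmem
  rw [hg.apply_mul, map_sum, Finset.sum_eq_zero fun i hi => by
    rw [hg.apply_mul, h0 i (Finset.mem_range.1 hi), mul_zero]] at this
  exact (mul_eq_zero.1 this).resolve_left (Finset.prod_ne_zero_iff.2 hq)

/-- Every functional is a multiple of one whose values at the facets are nonzero constants. -/
lemma exists_multiplier {g g' : MvPolynomial V k →+ MvPolynomial (Fin d) k} {c : ℕ → k}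
    (hg : IsFunctional Δ d t g) (hc : ∀ i < m, c i ≠ 0 ∧ g (faceMonomial k (F i)) = C (c i))
    (hg' : IsFunctional Δ d t g') : ∃ a, ∀ p, g' p = g (a * p) := by
  obtain ⟨a, ha⟩ := h.exists_glue ht (fun i => C (c i)⁻¹ * g' (faceMonomial k (F i))) (by
    intro i hi j hj hij v hv hs
    obtain ⟨x, y, hx, hy, hxy⟩ := h.functional_ridge ht hi hj hij hv hs
    have h1 := hxy g' hg'
    have h2 := congrArg constantCoeff (hxy g hg)
    rw [(hc i hi).2, (hc j hj).2] at h2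
    simp only [map_add, map_mul, constantCoeff_C, ridgeForm, constantCoeff_linearForm,
      zero_mul] at h2
    have hci := (hc i hi).1
    have hcj := (hc j hj).1
    refine ⟨C (x * c i)⁻¹ * g' (faceMonomial k ((F i).erase v)), ?_⟩
    rw [mul_left_comm, ← h1, mul_add, ← mul_assoc, ← mul_assoc, ← C_mul, ← C_mul, sub_eq_add_neg,
      ← neg_mul, ← C_neg]
    congr 3
    · field_simp
    · rw [eq_comm, eq_neg_iff_add_eq_zero]
      field_simp
      linear_combination h2)
  refine ⟨a, fun p => ?_⟩
  let g'' : MvPolynomial V k →+ MvPolynomial (Fin d) k :=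
    g' - g.comp (AddMonoidHom.mulLeft a)
  have happ : ∀ p, g'' p = g' p - g (a * p) := fun _ => rfl
  have hg'' : IsFunctional Δ d t g'' := by
    refine ⟨fun p hp => ?_, fun s p => ?_⟩
    · rw [happ, hg'.map_ideal p hp, hg.map_ideal _ (Ideal.mul_mem_left _ _ hp), sub_zero]
    · rw [happ, hg'.apply_mul, mul_left_comm, hg.apply_mul, happ, mul_sub]
  have := h.functional_eq_zero ht hg'' (fun i hi => by
    rw [happ, mul_comm, h.functional_facet_mul ht hg hi, ha i hi, (hc i hi).2, mul_right_comm,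
      ← C_mul, inv_mul_cancel₀ (hc i hi).1, C_1, one_mul, sub_self]) p
  rw [happ, sub_eq_zero] at this
  exact this

/-- The form `(a, b) ↦ g (a * b)` on the Stanley–Reisner ring is nondegenerate. -/
lemma mem_ideal_of_functional {g : MvPolynomial V k →+ MvPolynomial (Fin d) k} {c : ℕ → k}
    (hg : IsFunctional Δ d t g) (hc : ∀ i < m, c i ≠ 0 ∧ g (faceMonomial k (F i)) = C (c i))
    {a : MvPolynomial V k} (ha : ∀ p, g (a * p) = 0) : a ∈ stanleyReisnerIdeal k Δ := by
  refine h.mem_ideal_of_restrictFacet ht fun i hi => ?_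
  have := ha (faceMonomial k (F i))
  rw [mul_comm, h.functional_facet_mul ht hg hi, (hc i hi).2] at this
  exact (mul_eq_zero.1 this).resolve_right ((map_ne_zero_iff _ (C_injective _ _)).2 (hc i hi).1)

/-- The Stanley–Reisner ring of a complex with a reversible shelling is Gorenstein: it is a
Frobenius extension of the polynomial ring of the parameters. -/
theorem isGorensteinRing :
    IsGorensteinRing (MvPolynomial V k ⧸ stanleyReisnerIdeal k Δ) := by
  let _ : Algebra (MvPolynomial (Fin d) k) (MvPolynomial V k) :=
    (parameterMap d t).toRingHom.toAlgebra
  obtain ⟨g, c, hg, hc⟩ := h.exists_functional ht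
  let f : MvPolynomial (Fin d) k →+* MvPolynomial V k ⧸ stanleyReisnerIdeal k Δ :=
    (Ideal.Quotient.mk _).comp (parameterMap d t).toRingHom
  let φ : (MvPolynomial V k ⧸ stanleyReisnerIdeal k Δ) →+ MvPolynomial (Fin d) k :=
    QuotientAddGroup.lift _ g fun p hp => hg.map_ideal p hp
  have hφ : ∀ p, φ (Ideal.Quotient.mk _ p) = g p := fun _ => rfl
  refine isGorensteinRing_of_frobenius f (globalDimensionLE_mvPolynomial k d) ?_ φ ?_ ?_ ?_
  · have hproj := h.projective_initial ht le_rfl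
    rw [h.initial_eq] at hproj
    let e : (MvPolynomial V k ⧸ stanleyReisnerIdeal k Δ) ≃ₗ[MvPolynomial (Fin d) k]
        (ModuleCat.restrictScalars f).obj
          (ModuleCat.of _ (MvPolynomial V k ⧸ stanleyReisnerIdeal k Δ)) :=
      { AddEquiv.refl (MvPolynomial V k ⧸ stanleyReisnerIdeal k Δ) with
        map_smul' := fun s a => Algebra.smul_def s a }
    have : Module.Projective (MvPolynomial (Fin d) k)
      (MvPolynomial V k ⧸ stanleyReisnerIdeal k Δ) := hproj
    exact Module.Projective.of_equiv e
  · intro s a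
    obtain ⟨p, rfl⟩ := Ideal.Quotient.mk_surjective a
    exact hg.apply_mul s p
  · intro a ha
    obtain ⟨p, rfl⟩ := Ideal.Quotient.mk_surjective a
    rw [Ideal.Quotient.eq_zero_iff_mem]
    exact h.mem_ideal_of_functional ht hg hc fun q => ha (Ideal.Quotient.mk _ q)
  · intro g' hg'
    obtain ⟨a, ha⟩ := h.exists_multiplier ht hg hc
      (g' := g'.comp (Ideal.Quotient.mk _).toAddMonoidHom) ⟨fun p hp => by
        change g' (Ideal.Quotient.mk _ p) = 0
        rw [Ideal.Quotient.eq_zero_iff_mem.2 hp, map_zero], fun s p =>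
        hg' s (Ideal.Quotient.mk _ p)⟩
    refine ⟨Ideal.Quotient.mk _ a, fun b => ?_⟩
    obtain ⟨p, rfl⟩ := Ideal.Quotient.mk_surjective b
    exact ha p

end ReversibleShelling

end FrobeniusForm

/-! ### The graph and the `u`-equations -/

section Graph

/-- The labels of the positive roots of the `i`-th subsystem. -/
def labels (i : Fin 34) : List ℕ := (subsystemTable.getD i []).flatten

/-- The labels that occur in the table of subsystems. -/
def usedLabels : List ℕ := subsystemTable.flatten.flatten

/-- The type of the `i`-th subsystem, read off from the number of labels. -/
def labelType (i : Fin 34) : SubsystemType :=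
  if (labels i).length = 1 then .A1
  else if (labels i).length = 3 then .A2
  else if (labels i).length = 12 then .A3A3
  else .A7

lemma subsystemType_eq : ∀ i, subsystemType i = labelType i := by decide +kernel

/-- Distinct labels denote distinct roots. -/
lemma rootOfLabel_injOn_dedup : ∀ a ∈ usedLabels.dedup, ∀ b ∈ usedLabels.dedup,
    rootOfLabel a = rootOfLabel b → a = b := by decide +kernel

lemma rootOfLabel_injOn {a b : ℕ} (ha : a ∈ usedLabels) (hb : b ∈ usedLabels)
    (hab : rootOfLabel a = rootOfLabel b) : a = b :=
  rootOfLabel_injOn_dedup a (List.mem_dedup.2 ha) b (List.mem_dedup.2 hb) hab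

lemma mem_usedLabels {m : Fin 34} {c : List ℕ} (hc : c ∈ subsystemTable.getD m []) :
    c ⊆ usedLabels := by
  intro l hl
  have hm : (m : ℕ) < subsystemTable.length := m.2
  rw [List.getD_eq_getElem _ _ hm] at hc
  exact List.mem_flatten.2 ⟨c, List.mem_flatten.2 ⟨_, List.getElem_mem hm, hc⟩, hl⟩

lemma labels_subset_usedLabels (i : Fin 34) : labels i ⊆ usedLabels := by
  intro l hl
  obtain ⟨c, hc, hl⟩ := List.mem_flatten.1 hl
  exact mem_usedLabels hc hl

lemma mem_toFinset_map_rootOfLabel {a : List ℕ} (ha : a ⊆ usedLabels) {l : ℕ}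
    (hl : l ∈ usedLabels) : rootOfLabel l ∈ (a.map rootOfLabel).toFinset ↔ l ∈ a := by
  rw [List.mem_toFinset, List.mem_map]
  constructor
  · rintro ⟨l', hl', he⟩
    exact rootOfLabel_injOn (ha hl') hl he ▸ hl'
  · exact fun h => ⟨l, h, rfl⟩

/-- Containment of lists of labels. -/
def labelSub (a b : List ℕ) : Bool := a.all fun l => b.contains l

lemma subset_iff_labelSub {a b : List ℕ} (ha : a ⊆ usedLabels) (hb : b ⊆ usedLabels) :
    (a.map rootOfLabel).toFinset ⊆ (b.map rootOfLabel).toFinset ↔ labelSub a b = true := by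
  simp only [labelSub, List.all_eq_true, List.contains_iff_mem]
  constructor
  · intro h l hl
    rw [← mem_toFinset_map_rootOfLabel hb (ha hl)]
    exact h ((mem_toFinset_map_rootOfLabel ha (ha hl)).2 hl)
  · intro h x hx
    rw [List.mem_toFinset, List.mem_map] at hx ⊢
    obtain ⟨l, hl, rfl⟩ := hx
    exact ⟨l, h l hl, rfl⟩

lemma posRoots_subset_iff (i j : Fin 34) :
    posRoots i ⊆ posRoots j ↔ labelSub (labels i) (labels j) = true :=
  subset_iff_labelSub (labels_subset_usedLabels i) (labels_subset_usedLabels j)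

lemma disjoint_posRoots_iff (i j : Fin 34) : Disjoint (posRoots i) (posRoots j) ↔
    ((labels i).all fun l => !(labels j).contains l) = true := by
  simp only [List.all_eq_true, Bool.not_eq_true', ← Bool.not_eq_true,
    List.contains_iff_mem]
  rw [Finset.disjoint_left]
  constructor
  · intro h l hl hl'
    exact h (List.mem_toFinset.2 (List.mem_map.2 ⟨l, hl, rfl⟩))
      (List.mem_toFinset.2 (List.mem_map.2 ⟨l, hl', rfl⟩))
  · intro h x hx hx'
    obtain ⟨l, hl, rfl⟩ := List.mem_map.1 (List.mem_toFinset.1 hx)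
    exact h l hl ((mem_toFinset_map_rootOfLabel (labels_subset_usedLabels j)
      (labels_subset_usedLabels i hl)).1 hx')

/-- `InCommon` in terms of labels. -/
def labelCommon (t : SubsystemType) (i j : Fin 34) : Bool :=
  (List.finRange 34).any fun m => decide (labelType m = t) &&
    (labelSub (labels i) (labels m) && labelSub (labels j) (labels m))

lemma inCommon_iff (t : SubsystemType) (i j : Fin 34) :
    InCommon t i j ↔ labelCommon t i j = true := by
  simp [InCommon, labelCommon, subsystemType_eq, posRoots_subset_iff]

/-- `InCommonA3` in terms of labels. -/
def labelCommonA3 (i j : Fin 34) : Bool :=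
  (List.finRange 34).any fun m => decide (labelType m = .A3A3) &&
    (subsystemTable.getD m []).any fun c => labelSub (labels i) c && labelSub (labels j) c

lemma inCommonA3_iff (i j : Fin 34) : InCommonA3 i j ↔ labelCommonA3 i j = true := by
  simp only [InCommonA3, labelCommonA3, subsystemType_eq, components, List.any_eq_true,
    List.mem_finRange, true_and, Bool.and_eq_true, decide_eq_true_eq, List.mem_map]
  refine exists_congr fun m => and_congr_right fun _ => ?_
  constructor
  · rintro ⟨_, ⟨c, hc, rfl⟩, h1, h2⟩
    exact ⟨c, hc, (subset_iff_labelSub (labels_subset_usedLabels i) (mem_usedLabels hc)).1 h1,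
      (subset_iff_labelSub (labels_subset_usedLabels j) (mem_usedLabels hc)).1 h2⟩
  · rintro ⟨c, hc, h1, h2⟩
    exact ⟨_, ⟨c, hc, rfl⟩,
      (subset_iff_labelSub (labels_subset_usedLabels i) (mem_usedLabels hc)).2 h1,
      (subset_iff_labelSub (labels_subset_usedLabels j) (mem_usedLabels hc)).2 h2⟩

/-- `EdgeRule` in terms of labels. -/
def labelEdge (i j : Fin 34) : Bool :=
  match labelType i, labelType j with
  | .A1, .A1 => !labelCommon .A2 i j
  | .A2, .A2 => labelCommon .A3A3 i j && !labelCommonA3 i j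
  | .A1, .A2 => labelSub (labels i) (labels j) || !labelCommonA3 i j
  | .A1, .A3A3 => labelSub (labels i) (labels j) || (!labelCommon .A7 i j &&
      (List.finRange 34).all fun m => !(decide (labelType m = .A2)) ||
        (!labelSub (labels i) (labels m) || (labels m).all fun l => !(labels j).contains l))
  | .A1, .A7 => labelSub (labels i) (labels j)
  | .A2, .A3A3 => labelSub (labels i) (labels j)
  | .A2, .A7 => labelSub (labels i) (labels j)
  | .A3A3, .A7 => labelSub (labels i) (labels j)
  | _, _ => false

lemma edgeRule_iff (i j : Fin 34) : EdgeRule i j ↔ labelEdge i j = true := by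
  unfold EdgeRule labelEdge
  rw [subsystemType_eq, subsystemType_eq]
  cases labelType i <;> cases labelType j <;>
    simp only [inCommon_iff, inCommonA3_iff, posRoots_subset_iff, disjoint_posRoots_iff,
      subsystemType_eq, Bool.or_eq_true, Bool.and_eq_true, Bool.not_eq_true', Bool.not_eq_true,
      Bool.false_eq_true, List.all_eq_true, List.mem_finRange, forall_const,
      decide_eq_false_iff_not, imp_iff_not_or]

lemma labelEdge_iff : ∀ i j : Fin 34, (i ≠ j ∧ (labelEdge i j = true ∨ labelEdge j i = true)) ↔
    (i ≠ j ∧ (j : ℕ) + 1 ∉ uTable.getD i []) := by decide +kernel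

/-- The nonneighbours of `i` are the indices in the `i`-th `u`-equation. -/
lemma graphE7_adj_iff (i j : Fin 34) :
    graphE7.Adj i j ↔ i ≠ j ∧ (j : ℕ) + 1 ∉ uTable.getD i [] := by
  rw [graphE7, SimpleGraph.fromRel_adj, edgeRule_iff, edgeRule_iff, labelEdge_iff]

end Graph

/-! ### A shelling of the clique complex -/

section Table

/-- A shelling of the complex: the pairs of a facet and its restriction set, as bit masks, with bit
`i` for the vertex `i : Fin 34`. -/
def facetTable : List (ℕ × ℕ) := [
  (2684879144, 0), (2148012328, 4096), (2148012384, 64), (2684879200, 536870976),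
  (2689073192, 4194304), (2689073248, 4194368), (1615331424, 1073741824), (1615331368, 1073741832),
  (1611137320, 1073742080), (1611137376, 1073742144), (1610629416, 16384), (1610629472, 16448),
  (1614823520, 4210688), (1614823464, 4210696), (1073758505, 1), (1074266409, 524289),
  (1074266465, 65), (1073758561, 16449), (528681, 4097), (528737, 4161), (2148014400, 2048),
  (530753, 2049), (5372919848, 4294967296), (5368725545, 4294967297), (5369233449, 4295491584),
  (5373427752, 4299685888), (5368725601, 4294967360), (5372919904, 4299161664),
  (5369233505, 4295491648), (5373427808, 4299685952), (2684879172, 4), (1611137348, 1073741828),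
  (2148010308, 2052), (2689073220, 4194308), (1615331396, 1077936132), (1614823492, 16388),
  (1610629444, 16644), (2147486022, 2), (2147490114, 4098), (2147488098, 34),
  (2684354886, 536870914), (2684354914, 536870946), (536887650, 16386), (536887622, 16390),
  (2688548934, 4194306), (2688548962, 4194338), (541081670, 4210690), (541081698, 4210722),
  (2147488042, 10), (2684354858, 536870922), (536887594, 16394), (2688548906, 4194314),
  (541081642, 4210698), (4295492649, 1024), (4295492705, 1088), (4299687008, 4195328),
  (4299686952, 4195336), (2152203360, 2147484672), (2152203304, 2147484680), (529505, 5120),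
  (2148013152, 2147488768), (529449, 5128), (2148013096, 2147488776), (2147488810, 1026),
  (2151679018, 4195330), (2147488866, 1090), (2151679074, 4195394), (2148015168, 3072),
  (2147490882, 3074), (531521, 3073), (4299195488, 32768), (4295001185, 32769), (4228194, 32770),
  (4299195432, 32776), (4295001129, 32777), (4228138, 32778), (4299210848, 49152),
  (4299210792, 49160), (4243498, 49154), (4243554, 49218), (4295016489, 49153), (4295016545, 49217),
  (137538, 131072), (137537, 131073), (135521, 131104), (135522, 131106), (138305, 132096),
  (136289, 132128), (138306, 132098), (136290, 132130), (135466, 131080), (135465, 131081),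
  (136233, 132104), (136234, 132106), (147754, 147456), (147810, 147520), (147809, 147457),
  (147753, 147465), (180266, 163840), (180265, 163841), (164905, 164864), (164906, 164866),
  (180321, 163904), (180322, 163906), (164961, 164928), (164962, 164930), (529929, 512),
  (529161, 768), (136713, 131584), (135945, 131840), (531969, 2560), (531201, 2816),
  (138753, 133632), (137985, 133888), (137986, 514), (138754, 1538), (135946, 522), (136714, 1546),
  (2147490562, 2147484160), (2148014848, 2148008448), (2148012808, 2147484168),
  (2147488522, 2147484170), (2148015616, 2147485184), (2148013576, 2147485192),
  (2147489290, 2147485186), (2147491330, 2147487234), (2148010756, 516), (2147486470, 518),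
  (2148535810, 1048576), (2148534790, 1048580), (2149060096, 1572864), (2149059076, 1572868),
  (2148535362, 1048640), (2148534342, 1048644), (2149058628, 1572928), (2149059648, 1573952),
  (2153250884, 5242880), (2152726598, 5242882), (2152727618, 5243904), (2153251904, 5768192),
  (1107312905, 33554432), (1107820809, 34078720), (34079497, 33554944), (2156398088, 8388608),
  (2160591880, 12582912), (2155873802, 8388610), (2160067594, 12582914), (2161640448, 9437184),
  (2161116162, 9437186), (2156922370, 9437696), (2157446656, 9961984), (2157445636, 8388612),
  (2156921350, 8388614), (2161639428, 12582916), (2161115142, 12582918), (1838144, 262144),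
  (1838592, 262656), (1837124, 262148), (1837572, 262660), (6029380, 4456448), (6030400, 4457472),
  (10225152, 8650752), (14418944, 12845056), (10224132, 8650756), (14417924, 12845060),
  (790017, 262145), (789569, 262209), (4299949120, 4295229440), (4295754817, 4295229441),
  (5637161025, 268435456), (5641355328, 272629760), (1346388036, 268435460),
  (5637668929, 268959744), (5641863232, 273154048), (1346895940, 268959748),
  (4568383552, 268697600), (4564189249, 268697601), (273416260, 268697604), (164945, 16),
  (4295001169, 4294967312), (164946, 18), (4228178, 4194320), (4299195472, 4299161616),
  (180305, 16400), (4295016529, 4294983696), (180306, 16402), (4243538, 4210704),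
  (4299210832, 4299178000), (4210774, 20), (5242966, 1048592), (5243986, 1049616),
  (272646228, 268435472), (4567613520, 4563402768), (4563419217, 268435473), (5505108, 262160),
  (272891988, 268697616), (4567859280, 4295229456), (5506128, 263184), (4299424848, 4295230480),
  (4563664977, 262161), (4295230545, 263185), (134225, 2064), (134226, 2066), (265297, 264208),
  (1313872, 1050640), (1051730, 1050642), (1050710, 2068), (1312852, 264212), (134673, 528),
  (265745, 262672), (1314320, 1049104), (1052178, 530), (134674, 131602), (1313300, 532),
  (1051158, 534), (9700880, 8388624), (13894672, 12582928), (9699860, 8388628),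
  (13893652, 12582932), (13632530, 8388626), (9438738, 8389138), (9437718, 8388630),
  (13631510, 12582934), (4634968080, 67108864), (4634722320, 67125248), (340000788, 67108868),
  (339755028, 67125252), (1413496836, 1140850688), (5708464128, 5435817984), (5708972032, 67633152),
  (4635492352, 67895296), (340525060, 67633156), (1414004740, 1141374980), (4630773777, 67108865),
  (4631298049, 67633153), (4630528017, 67125249), (5704777729, 1140850689),
  (5704269825, 1140867073), (5435834377, 67108872), (5440028680, 71303176), (5440536584, 67633160),
  (5436342281, 67633161), (79953940, 75497472), (80478212, 76021760), (76284420, 67109376),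
  (75760148, 67109392), (1174929417, 100663296), (1174421513, 100679680), (268697809, 128),
  (335806609, 67108992), (264401, 2176), (335806612, 132), (268697812, 196), (264404, 2180),
  (269222081, 524416), (269222084, 524420), (788676, 526464), (788673, 526465),
  (336330884, 67633280), (336330881, 67633281), (1409810561, 1073741952), (1342701761, 1073742016),
  (1409810564, 1073741956), (1342701764, 1073742020), (526785, 384), (526788, 388),
  (1074266564, 1073742208), (1074266561, 1073742209), (527233, 640), (527236, 644),
  (789124, 262784), (789121, 262785), (264849, 656), (264852, 660), (67371668, 67109504),
  (67895940, 67633792), (67895937, 67109377), (67371665, 67109393), (1409302660, 16512),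
  (1409302657, 16513), (335560852, 16528), (335560849, 16529), (268452049, 16576),
  (268452052, 16580), (1342193857, 1073758400), (1342193860, 1073758404), (1073758657, 16768),
  (1073758660, 16772), (1174421633, 33554560), (1107313025, 33554816), (1174929537, 34078848),
  (1107820929, 34079104), (34079617, 33555072), (101188225, 100663808), (101188105, 67109384),
  (1174421636, 33554436), (1174929540, 34078724), (101188228, 33554948), (1107820932, 33554692),
  (1107313028, 33571076), (34079620, 33555204), (1279787012, 134217728), (1749549060, 671088640),
  (2823290884, 2281701376), (1279279108, 134234112), (1749041156, 671105024),
  (1749041160, 134217736), (1279279112, 201326600), (1749549064, 134742024),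
  (1279787016, 201850888), (2823290888, 2281701384), (2819096840, 134217984),
  (2819096836, 134217988), (1745355016, 1207959808), (1745355012, 1207959812),
  (1744847108, 134234368), (1744847112, 134234376), (1242038532, 167772160),
  (1309147140, 234881024), (1308639236, 167788544), (1241530628, 167788800),
  (1308639240, 167772168), (1241530632, 167772424), (1309147144, 168296456),
  (1242038536, 168296712), (2822766602, 134217730), (675299338, 134234114), (675299334, 134217734),
  (2822766598, 2281701382), (2818572550, 134217986), (671105286, 134234370),
  (2818572554, 134217994), (671105290, 134234378), (2294284298, 142606336), (2294808584, 143130624),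
  (2294808580, 142606340), (2294284294, 142606342), (214433796, 209715200), (214433800, 75497480),
  (235405828, 134218240), (168297220, 134218496), (168297224, 134218248), (235405832, 201327112),
  (210240004, 142606848), (2282226440, 2281701888), (2282226436, 2281701892),
  (2290614788, 2290090496), (2290614792, 142606856), (210240008, 75497992), (2281702150, 134218242),
  (2290090502, 142606850), (2281702154, 134218250), (2290090506, 142606858),
  (8757723400, 8589934592), (8824832008, 8657043456), (8623505673, 8589934593),
  (8690614281, 8657043457), (8590082313, 8590065664), (8690614401, 8589934720),
  (8623505793, 8589934976), (8690598409, 8589935104), (8824816136, 8724152832),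
  (8690598529, 8589935232), (8623489801, 8589935360), (8757707528, 8724153088),
  (8623489921, 8589935488), (8590066441, 8590066176), (8824832004, 8589934596),
  (8824816132, 8589935108), (8690598532, 8589934724), (8690614404, 8589951108),
  (8757707524, 8589934852), (8757723396, 8589951236), (8623505796, 8589934980),
  (8623489924, 8589935492), (8657059985, 8589934608), (8657059988, 8589934612),
  (8657044113, 8589935120), (8657044116, 8589935124), (8724168970, 8589934594),
  (8590082314, 8590065666), (8724168966, 8589934598), (8724153098, 8589935106),
  (8590066442, 8590066178), (8724153094, 8589935110), (8590016774, 65536), (8590147842, 196608),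
  (82246, 65600), (213314, 196672), (213313, 65537), (8590147841, 8590000129), (213073, 65552),
  (213074, 65554), (82006, 65556), (67670, 67584), (198738, 198656), (198978, 67840),
  (67910, 67844), (198977, 67585), (198737, 67601), (199426, 66048), (8590131970, 8590000640),
  (8590000902, 66052), (68358, 68100), (8590131969, 66049), (199425, 68097), (68118, 66064),
  (199186, 197136), (199185, 66065), (8590001025, 65664), (68481, 67712), (68241, 65680),
  (8590000785, 8590000144), (8590001028, 65668), (68484, 67716), (68244, 65684),
  (8590000788, 8590000148), (68033, 65728), (68036, 65732), (67796, 65744), (67793, 65745),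
  (82129, 82048), (82369, 82304), (82132, 82052), (82372, 82308), (8590016897, 8590016640),
  (8590016900, 8590016644), (8590016657, 8590016528), (8590016660, 8590016532),
  (8590016534, 8589934610), (8590000662, 8589935122), (8590131730, 8590065680),
  (8590147602, 8590082064), (8590147601, 8590065681), (8590131729, 8590066193), (10486294, 2097152),
  (77595156, 69206016), (8592032278, 8592031744), (8659141140, 8659140608), (144704006, 136314880),
  (8726249990, 8726249472), (211812868, 203423744), (8793358852, 8793358336), (211812872, 2097160),
  (144704010, 2097162), (8793358856, 8592031752), (8726249994, 8592031754), (148897798, 6291456),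
  (216006660, 73400320), (81788948, 6291472), (14680086, 6291474), (148897802, 6291464),
  (216006664, 73400328), (8793374724, 2113536), (8726265862, 2113538), (207634436, 6307840),
  (140525574, 6307842), (8793374728, 2113544), (207634440, 6307848), (140525578, 2113546),
  (8726265866, 8592048138), (8592048150, 2113552), (8659157012, 69222416), (6307862, 6307856),
  (73416724, 73416720), (84148753, 16777216), (92537360, 25165824), (84673025, 17301504),
  (93061632, 25690112), (92799496, 16777224), (84410889, 16777225), (4379639809, 4311744512),
  (4379377673, 4311744520), (4379115537, 4311744528), (4312007697, 16778240),
  (4312531969, 17302528), (4312269833, 16778248), (17565185, 16778752), (17040913, 16778768),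
  (17303049, 16778760), (25429520, 25166848), (25953792, 25691136), (25691656, 25166856),
  (29885448, 20971520), (96993288, 88080384), (4316464136, 4315938816), (4383571976, 4383047680),
  (4316726272, 21233664), (4383834112, 88342528), (97255424, 29622272), (30147584, 29623296),
  (29623312, 20971536), (4316202000, 4315938832), (96731152, 88080400), (4383309840, 4383047696),
  (29369352, 8192), (29369360, 8208), (96477200, 67117056), (96477192, 67117064),
  (4383055888, 4294975488), (4383055880, 4294975496), (4315948040, 4294976512),
  (4315948048, 4294976528), (4378861585, 8193), (4311753745, 9217), (4378861577, 8201),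
  (4311753737, 9225), (4366295056, 24576), (4366295048, 24584), (4362100753, 24577),
  (4362100745, 24585), (83894801, 8704), (16786961, 9728), (25175568, 8397312),
  (92283408, 75506176), (16786953, 8712), (25175560, 8397320), (83894793, 67117576),
  (92283400, 75506184), (73424904, 2105344), (73424912, 2105360), (81797128, 10493952),
  (81797136, 10493968), (77603344, 2105856), (77603336, 2105864), (4299218960, 40960),
  (4295024657, 40961), (4295009297, 41984), (4299203600, 4236288), (4295009289, 40968),
  (4295024649, 57352), (4299203592, 4235272), (4299218952, 4251656), (140817, 139264),
  (173073, 172032), (140809, 139272), (173065, 172040), (188433, 155648), (188425, 155656),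
  (4251666, 8194), (4236306, 9218), (4251658, 8202), (4236298, 9226), (12592146, 8396802),
  (12592138, 8396810), (6316050, 2105346), (6316042, 2105354), (14688266, 10493954),
  (14688274, 10493970), (188426, 139266), (173066, 140290), (173074, 139282), (188434, 155666),
  (8398354, 8706), (8398346, 8714), (140810, 139778), (140818, 139794), (10494482, 2105858),
  (10494474, 2105866), (8590074377, 8589942784), (8657052169, 8657051648), (8590074378, 8589942786),
  (8590074386, 8589942800), (8590074385, 8589942801), (8657052177, 8657051664),
  (8659149328, 8592039936), (8659149320, 8592039944), (8592040466, 8592039938),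
  (8592040458, 8592039946), (8590090250, 8589959168), (8590090258, 8589959184),
  (8590090257, 8589959169), (8590090249, 8589959177), (8657068041, 8657068032),
  (8657068049, 8657068048), (8592056330, 8592056320), (8592056338, 8592056336),
  (8659165192, 8659165184), (8659165200, 8659165200)]

/-- The set of vertices of a bit mask. -/
def maskSet (a : ℕ) : Finset (Fin 34) := Finset.univ.filter fun i => a.testBit i

lemma mem_maskSet {a : ℕ} {i : Fin 34} : i ∈ maskSet a ↔ a.testBit i = true := by
  simp [maskSet]

/-- The number of vertices of a bit mask. -/
def popcount (a : ℕ) : ℕ := ((List.range 34).filter a.testBit).length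

lemma card_maskSet (a : ℕ) : (maskSet a).card = popcount a := by
  have h : (maskSet a).map Fin.valEmbedding = (Finset.range 34).filter fun i => a.testBit i := by
    ext n
    simp only [Finset.mem_map, mem_maskSet, Fin.valEmbedding_apply, Finset.mem_filter,
      Finset.mem_range]
    constructor
    · rintro ⟨i, hi, rfl⟩
      exact ⟨i.2, hi⟩
    · rintro ⟨hn, h⟩
      exact ⟨⟨n, hn⟩, h, rfl⟩
  rw [← Finset.card_map Fin.valEmbedding, h, popcount]
  simp only [Finset.card, Finset.filter, Finset.range, Multiset.range, Multiset.filter_coe,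
    Multiset.coe_card, Bool.decide_eq_true]

lemma maskSet_subset_of_land {a b : ℕ} (h : a &&& b = a) : maskSet a ⊆ maskSet b := by
  intro i hi
  rw [mem_maskSet] at hi ⊢
  rw [← h, Nat.testBit_and, Bool.and_eq_true] at hi
  exact hi.2

lemma land_of_maskSet_subset {a b : ℕ} (ha : a < 2 ^ 34) (h : maskSet a ⊆ maskSet b) :
    a &&& b = a := by
  refine Nat.eq_of_testBit_eq fun n => ?_
  rw [Nat.testBit_and]
  by_cases hn : n < 34
  · cases han : a.testBit n
    · rfl
    · have := h (mem_maskSet.2 han : (⟨n, hn⟩ : Fin 34) ∈ maskSet a)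
      rw [mem_maskSet] at this
      rw [this]
      rfl
  · rw [Nat.testBit_lt_two_pow (ha.trans_le (Nat.pow_le_pow_right two_pos (not_lt.1 hn)))]
    rfl

lemma maskSet_sdiff {a b : ℕ} (h : b &&& a = b) :
    maskSet a \ maskSet b = maskSet (a ^^^ b) := by
  ext i
  have := maskSet_subset_of_land h
  rw [Finset.mem_sdiff, mem_maskSet, mem_maskSet, mem_maskSet, Nat.testBit_xor]
  by_cases hb : b.testBit i
  · have := this (mem_maskSet.2 hb)
    rw [mem_maskSet] at this
    simp [hb, this]
  · simp [hb]

/-- The bit mask of the neighbours of a vertex. -/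
def adjMask (i : ℕ) : ℕ :=
  ((List.range 34).filter fun j => i ≠ j ∧ j + 1 ∉ uTable.getD i []).foldr
    (fun j a => a ||| 2 ^ j) 0

lemma testBit_foldr_or (l : List ℕ) (n : ℕ) :
    (l.foldr (fun j a => a ||| 2 ^ j) 0).testBit n = true ↔ n ∈ l := by
  induction l with
  | nil => simp
  | cons a l ih =>
    rw [List.foldr_cons, Nat.testBit_or, Bool.or_eq_true, ih, Nat.testBit_two_pow, List.mem_cons,
      decide_eq_true_eq, or_comm, eq_comm]

lemma testBit_adjMask (i j : Fin 34) : (adjMask i).testBit j = true ↔ graphE7.Adj i j := by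
  rw [adjMask, testBit_foldr_or, List.mem_filter, graphE7_adj_iff, decide_eq_true_eq,
    Ne, Ne, Fin.ext_iff]
  simp

/-- The row `(F, R)` consists of a clique with six vertices and a subset of it. -/
def rowCheck (p : ℕ × ℕ) : Bool :=
  p.1 < 2 ^ 34 && p.2 &&& p.1 == p.2 && popcount p.1 == 6 &&
    (List.range 34).all fun i => !p.1.testBit i || p.1 &&& (adjMask i ||| 2 ^ i) == p.1

/-- The restriction sets of a table are not contained in earlier facets, and their complements are
not contained in later facets. -/
def shellingCheck : List (ℕ × ℕ) → Bool
  | [] => true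
  | (F, R) :: l => (l.all fun q => !((q.2.land F).beq q.2 ||
      ((F.xor R).land q.1).beq (F.xor R))) && shellingCheck l

/-- Every clique that consists of `σ` and some of the first `n` vertices, which have to be
in `c`, is the intersection of those members of `L` that contain it; here `L` is a list of sets that
contain `σ`. -/
def cliqueCheck (adj : ℕ → ℕ) : ℕ → ℕ → ℕ → List ℕ → Bool
  | 0, σ, _, L => L.foldr (fun a b => a &&& b) (2 ^ 34 - 1) == σ
  | n + 1, σ, c, L => cliqueCheck adj n σ c L && (!c.testBit n ||
      cliqueCheck adj n (σ ||| 2 ^ n) (c &&& adj n) (L.filter fun a => a.testBit n))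

lemma facetTable_row : facetTable.all rowCheck = true := by decide +kernel

set_option maxRecDepth 10000 in
lemma facetTable_shelling : shellingCheck facetTable = true := by decide +kernel

set_option maxRecDepth 10000 in
lemma facetTable_clique :
    cliqueCheck adjMask 34 0 (2 ^ 34 - 1) (facetTable.map Prod.fst) = true := by decide +kernel

lemma facetTable_length : facetTable.length = 579 := by decide +kernel

lemma testBit_foldr_and (L : List ℕ) {v : ℕ} (hv : v < 34) (h : ∀ a ∈ L, a.testBit v = true) :
    (L.foldr (fun a b => a &&& b) (2 ^ 34 - 1)).testBit v = true := by
  induction L with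
  | nil => rw [List.foldr_nil, Nat.testBit_two_pow_sub_one, decide_eq_true_eq]; exact hv
  | cons a L ih =>
    rw [List.foldr_cons, Nat.testBit_and, Bool.and_eq_true]
    exact ⟨h a List.mem_cons_self, ih fun b hb => h b (List.mem_cons_of_mem _ hb)⟩

/-- If the check succeeds, a vertex `v` that lies in all members of `L` that contain the clique `τ`
is in `σ` or in `τ`. -/
lemma cliqueCheck_spec {adj : ℕ → ℕ} {n σ c : ℕ} {L : List ℕ} (h : cliqueCheck adj n σ c L = true)
    {τ : Finset ℕ} (hτ : ∀ i ∈ τ, i < n ∧ c.testBit i = true)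
    (hadj : ∀ i ∈ τ, ∀ j ∈ τ, j < i → (adj i).testBit j = true) {v : ℕ} (hv : v < 34)
    (hL : ∀ a ∈ L, (∀ i ∈ τ, a.testBit i = true) → a.testBit v = true) :
    σ.testBit v = true ∨ v ∈ τ := by
  induction n generalizing σ c L τ with
  | zero =>
    have h0 : ∀ i, i ∉ τ := fun i hi => Nat.not_lt_zero _ (hτ i hi).1
    rw [cliqueCheck, beq_iff_eq] at h
    left
    rw [← h]
    exact testBit_foldr_and L hv fun a ha => hL a ha fun i hi => absurd hi (h0 i)
  | succ n ih =>
    rw [cliqueCheck, Bool.and_eq_true, Bool.or_eq_true, Bool.not_eq_true'] at h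
    by_cases hn : n ∈ τ
    · have h2 := h.2.resolve_left (by rw [(hτ n hn).2]; simp)
      have := ih h2 (τ := τ.erase n) (fun i hi => ?_) (fun i hi j hj => ?_) (fun a ha hs => ?_)
      · rw [Nat.testBit_or, Bool.or_eq_true, Nat.testBit_two_pow, decide_eq_true_eq,
          Finset.mem_erase] at this
        rcases this with (h1 | h1) | h1
        · exact Or.inl h1
        · exact Or.inr (h1 ▸ hn)
        · exact Or.inr h1.2
      · rw [Finset.mem_erase] at hi
        have hin : i < n := lt_of_le_of_ne (Nat.lt_succ_iff.1 (hτ i hi.2).1) hi.1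
        rw [Nat.testBit_and, Bool.and_eq_true]
        exact ⟨hin, (hτ i hi.2).2, hadj n hn i hi.2 hin⟩
      · exact hadj i (Finset.mem_of_mem_erase hi) j (Finset.mem_of_mem_erase hj)
      · rw [List.mem_filter] at ha
        refine hL a ha.1 fun i hi => ?_
        by_cases hin : i = n
        · exact hin ▸ ha.2
        · exact hs i (Finset.mem_erase.2 ⟨hin, hi⟩)
    · refine ih h.1 (fun i hi => ⟨?_, (hτ i hi).2⟩) hadj hL
      exact lt_of_le_of_ne (Nat.lt_succ_iff.1 (hτ i hi).1) fun e => hn (e ▸ hi)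

/-- The facets of the shelling. -/
def facetE7 (i : ℕ) : Finset (Fin 34) := maskSet (facetTable.getD i (0, 0)).1

/-- The restriction sets of the shelling. -/
def restrictionE7 (i : ℕ) : Finset (Fin 34) := maskSet (facetTable.getD i (0, 0)).2

lemma facetTable_getD_mem {i : ℕ} (hi : i < 579) : facetTable.getD i (0, 0) ∈ facetTable := by
  rw [List.getD_eq_getElem _ _ (facetTable_length.symm ▸ hi)]
  exact List.getElem_mem _

lemma rowCheck_getD {i : ℕ} (hi : i < 579) : rowCheck (facetTable.getD i (0, 0)) = true :=
  List.all_eq_true.1 facetTable_row _ (facetTable_getD_mem hi)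

lemma restrictionE7_land {i : ℕ} (hi : i < 579) : (facetTable.getD i (0, 0)).2 &&&
    (facetTable.getD i (0, 0)).1 = (facetTable.getD i (0, 0)).2 := by
  have := rowCheck_getD hi
  simp only [rowCheck, Bool.and_eq_true, beq_iff_eq] at this
  exact this.1.1.2

lemma facetE7_lt {i : ℕ} (hi : i < 579) : (facetTable.getD i (0, 0)).1 < 2 ^ 34 := by
  have := rowCheck_getD hi
  simp only [rowCheck, Bool.and_eq_true, decide_eq_true_eq] at this
  exact this.1.1.1

lemma card_facetE7 {i : ℕ} (hi : i < 579) : (facetE7 i).card = 6 := by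
  have := rowCheck_getD hi
  simp only [rowCheck, Bool.and_eq_true, beq_iff_eq] at this
  rw [facetE7, card_maskSet, this.1.2]

lemma isClique_facetE7 {i : ℕ} (hi : i < 579) : facetE7 i ∈ dualComplexE7 := by
  have := rowCheck_getD hi
  simp only [rowCheck, Bool.and_eq_true, List.all_eq_true] at this
  intro u hu v hv huv
  rw [Finset.mem_coe, facetE7, mem_maskSet] at hu hv
  have hrow := this.2 u (List.mem_range.2 u.2)
  rw [hu, Bool.not_true, Bool.false_or, beq_iff_eq] at hrow
  rw [← hrow, Nat.testBit_and, Bool.and_eq_true, Nat.testBit_or, Bool.or_eq_true,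
    Nat.testBit_two_pow, decide_eq_true_eq, testBit_adjMask] at hv
  exact hv.2.resolve_right fun e => huv (Fin.ext e)

lemma shellingCheck_spec {l : List (ℕ × ℕ)} (h : shellingCheck l = true) {i j : ℕ} (hij : i < j)
    (hj : j < l.length) :
    ¬ (l.getD j (0, 0)).2 &&& (l.getD i (0, 0)).1 = (l.getD j (0, 0)).2 ∧
    ¬ ((l.getD i (0, 0)).1 ^^^ (l.getD i (0, 0)).2) &&& (l.getD j (0, 0)).1 =
      (l.getD i (0, 0)).1 ^^^ (l.getD i (0, 0)).2 := by
  induction l generalizing i j with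
  | nil => simp at hj
  | cons p l ih =>
    obtain ⟨F, R⟩ := p
    rw [shellingCheck, Bool.and_eq_true, List.all_eq_true] at h
    obtain ⟨j, rfl⟩ : ∃ j', j = j' + 1 := ⟨j - 1, by omega⟩
    rw [List.length_cons, Nat.add_lt_add_iff_right] at hj
    cases i with
    | zero =>
      have := h.1 (l.getD j (0, 0)) (by
        rw [List.getD_eq_getElem _ _ hj]
        exact List.getElem_mem _)
      rw [Bool.not_eq_true', Bool.or_eq_false_iff, ← Bool.not_eq_true, ← Bool.not_eq_true,
        Nat.beq_eq, Nat.beq_eq] at this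
      exact this
    | succ i =>
      simp only [List.getD_cons_succ]
      exact ih h.2 (Nat.lt_of_succ_lt_succ hij) hj

/-- Every clique is the intersection of the facets in the table that contain it. -/
lemma exists_facetE7 {σ : Finset (Fin 34)} (hσ : σ ∈ dualComplexE7) {v : Fin 34} (hv : v ∉ σ) :
    ∃ i < 579, σ ⊆ facetE7 i ∧ v ∉ facetE7 i := by
  by_contra! hcon
  have := cliqueCheck_spec facetTable_clique (τ := σ.map Fin.valEmbedding) (v := v) ?_ ?_ v.2 ?_
  · rcases this with h | h
    · simp at h
    · obtain ⟨u, hu, huv⟩ := Finset.mem_map.1 h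
      exact hv (Fin.ext huv ▸ hu)
  · intro i hi
    obtain ⟨i, -, rfl⟩ := Finset.mem_map.1 hi
    rw [Nat.testBit_two_pow_sub_one, decide_eq_true_eq]
    exact ⟨i.2, i.2⟩
  · intro i hi j hj hij
    obtain ⟨u, hu, rfl⟩ := Finset.mem_map.1 hi
    obtain ⟨w, hw, rfl⟩ := Finset.mem_map.1 hj
    exact (testBit_adjMask u w).2 (hσ hu hw fun e => hij.ne (congrArg Fin.val e.symm))
  · intro a ha hs
    obtain ⟨p, hp, rfl⟩ := List.mem_map.1 ha
    obtain ⟨i, hi, hip⟩ := List.mem_iff_getElem.1 hp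
    have hF : facetE7 i = maskSet p.1 := by
      rw [facetE7, List.getD_eq_getElem _ _ hi, hip]
    have := hcon i (facetTable_length ▸ hi) fun u hu => by
      rw [hF, mem_maskSet]
      exact hs u (Finset.mem_map.2 ⟨u, hu, rfl⟩)
    rwa [hF, mem_maskSet] at this

lemma exists_notMem {σ : Finset (Fin 34)} (hσ : σ ∈ dualComplexE7) : ∃ v, v ∉ σ := by
  by_contra! hall
  have := (graphE7_adj_iff 0 1).1 (hσ (hall 0) (hall 1) (by decide))
  exact this.2 (by decide)

/-- The clique complex of `𝒢(E₇)` has a reversible shelling. -/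
theorem reversibleShelling_dualComplexE7 :
    ReversibleShelling dualComplexE7 6 579 facetE7 restrictionE7 where
  mem_iff σ := by
    constructor
    · intro hσ
      obtain ⟨v, hv⟩ := exists_notMem hσ
      obtain ⟨i, hi, hs, -⟩ := exists_facetE7 hσ hv
      exact ⟨i, hi, hs⟩
    · rintro ⟨i, hi, hs⟩
      exact dualComplexE7.lower hs (isClique_facetE7 hi)
  card_eq _ hi := card_facetE7 hi
  subset _ hi := maskSet_subset_of_land (restrictionE7_land hi)
  forward i j hij hj hs := by
    refine (shellingCheck_spec facetTable_shelling hij (facetTable_length.symm ▸ hj)).1 ?_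
    refine land_of_maskSet_subset (lt_of_le_of_lt ?_ (facetE7_lt hj)) hs
    rw [← restrictionE7_land hj]
    exact Nat.and_le_right
  backward i j hij hj hs := by
    refine (shellingCheck_spec facetTable_shelling hij (facetTable_length.symm ▸ hj)).2 ?_
    have hi := hij.trans hj
    rw [facetE7, restrictionE7, maskSet_sdiff (restrictionE7_land hi)] at hs
    refine land_of_maskSet_subset (Nat.xor_lt_two_pow (facetE7_lt hi)
      (lt_of_le_of_lt ?_ (facetE7_lt hi))) hs
    rw [← restrictionE7_land hi]
    exact Nat.and_le_right
  ridge i hi v hv := by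
    obtain ⟨j, hj, hs, hvj⟩ := exists_facetE7
      (dualComplexE7.lower (Finset.erase_subset v _) (isClique_facetE7 hi))
      (Finset.notMem_erase v (facetE7 i))
    exact ⟨j, hj, fun e => hvj (e ▸ hv), hs⟩
  pos := by norm_num

end Table

/-! ### Faces, facets and the amplitude -/

section Faces

namespace ReversibleShelling

variable {V : Type} [DecidableEq V] {Δ : LowerSet (Finset V)} {d m : ℕ} {F R : ℕ → Finset V}
  (h : ReversibleShelling Δ d m F R)

/-- The number of sets with `s` elements in an interval. -/
lemma card_interval {A B : Finset V} (hAB : A ⊆ B) (s : ℕ) :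
    (B.powerset.filter fun σ => A ⊆ σ ∧ σ.card = s).card =
      if A.card ≤ s then (B.card - A.card).choose (s - A.card) else 0 := by
  split_ifs with hs
  · rw [← Finset.card_sdiff_of_subset hAB, ← Finset.card_powersetCard]
    refine Finset.card_bij' (fun σ _ => σ \ A) (fun τ _ => τ ∪ A) ?_ ?_ ?_ ?_
    · intro σ hσ
      rw [Finset.mem_filter, Finset.mem_powerset] at hσ
      rw [Finset.mem_powersetCard, Finset.card_sdiff_of_subset hσ.2.1, hσ.2.2]
      exact ⟨Finset.sdiff_subset_sdiff hσ.1 subset_rfl, rfl⟩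
    · intro τ hτ
      rw [Finset.mem_powersetCard, Finset.subset_sdiff] at hτ
      rw [Finset.mem_filter, Finset.mem_powerset, Finset.card_union_of_disjoint hτ.1.2, hτ.2]
      exact ⟨Finset.union_subset hτ.1.1 hAB, Finset.subset_union_right, Nat.sub_add_cancel hs⟩
    · intro σ hσ
      rw [Finset.mem_filter] at hσ
      exact Finset.sdiff_union_of_subset hσ.2.1
    · intro τ hτ
      rw [Finset.mem_powersetCard, Finset.subset_sdiff] at hτ
      exact Finset.union_sdiff_cancel_right hτ.1.2
  · rw [Finset.card_eq_zero, Finset.filter_eq_empty_iff]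
    rintro σ - ⟨hA, rfl⟩
    exact hs (Finset.card_le_card hA)

include h

/-- The numbers of faces, from the partition of the complex into intervals. -/
theorem card_faces (s : ℕ) : Nat.card {σ : Finset V // σ ∈ Δ ∧ σ.card = s} =
    ∑ j ∈ Finset.range m,
      if (R j).card ≤ s then (d - (R j).card).choose (s - (R j).card) else 0 := by
  rw [Nat.subtype_card ((Finset.range m).biUnion fun j =>
    (F j).powerset.filter fun σ => R j ⊆ σ ∧ σ.card = s)]
  · rw [Finset.card_biUnion]
    · refine Finset.sum_congr rfl fun j hj => ?_
      rw [Finset.mem_range] at hj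
      rw [card_interval (h.subset j hj), h.card_eq j hj]
    · intro i hi j hj hij
      refine Finset.disjoint_left.2 fun σ hσi hσj => ?_
      rw [Finset.mem_filter, Finset.mem_powerset] at hσi hσj
      exact hij (h.interval_unique (Finset.mem_range.1 hi) (Finset.mem_range.1 hj)
        hσi.2.1 hσi.1 hσj.2.1 hσj.1)
  · intro σ
    simp only [Finset.mem_biUnion, Finset.mem_range, Finset.mem_filter, Finset.mem_powerset]
    constructor
    · rintro ⟨j, hj, hF, -, hs⟩
      exact ⟨(h.mem_iff σ).2 ⟨j, hj, hF⟩, hs⟩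
    · rintro ⟨hσ, hs⟩
      obtain ⟨j, hj, hR, hF⟩ := h.exists_interval hσ
      exact ⟨j, hj, hF, hR, hs⟩

lemma facets_eq [Fintype V] : facets Δ = ((Finset.range m).image F : Finset (Finset V)) := by
  ext σ
  simp only [Finset.coe_image, Set.mem_image, Finset.mem_coe, Finset.mem_range]
  constructor
  · intro hσ
    have hmax : Maximal (· ∈ Δ) σ := hσ
    obtain ⟨i, hi, hs⟩ := (h.mem_iff σ).1 hmax.prop
    exact ⟨i, hi, (hmax.eq_of_le (h.facet_mem hi) hs).symm⟩
  · rintro ⟨i, hi, rfl⟩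
    exact ⟨h.facet_mem hi, fun τ hτ hs => (h.eq_facet hi hτ hs).le⟩

lemma injOn_facet : Set.InjOn F (Finset.range m) := fun _ hi _ hj =>
  h.facet_injOn (Finset.mem_range.1 hi) (Finset.mem_range.1 hj)

lemma ncard_facets [Fintype V] : (facets Δ).ncard = m := by
  rw [h.facets_eq, Set.ncard_coe_finset, Finset.card_image_of_injOn h.injOn_facet,
    Finset.card_range]

end ReversibleShelling

open MvPolynomial

variable {V : Type} [Fintype V] [LinearOrder V]

lemma monomial_mem_dual_iff {Δ : LowerSet (Finset V)} {k : Type} [Field k] {b : V →₀ ℕ} :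
    monomial b (1 : k) ∈ stanleyReisnerIdeal k (alexanderDual Δ) ↔ b.supportᶜ ∈ Δ := by
  rw [monomial_mem_stanleyReisnerIdeal]
  exact not_not

namespace ReversibleShelling

variable {Δ : LowerSet (Finset V)} {d m : ℕ} {F R : ℕ → Finset V}
  (h : ReversibleShelling Δ d m F R)

include h

/-- The minimal generators of the Alexander dual are the monomials of the complements of facets. -/
lemma minimalMonomials_eq (k : Type) [Field k] :
    minimalMonomials (stanleyReisnerIdeal k (alexanderDual Δ)) =
      ((Finset.range m).image fun i => ∑ v ∈ (F i)ᶜ, Finsupp.single v 1 : Finset (V →₀ ℕ)) := by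
  ext b
  simp only [minimalMonomials, Set.mem_ofPred_eq, monomial_mem_dual_iff, Finset.coe_image,
    Set.mem_image, Finset.mem_coe, Finset.mem_range]
  constructor
  · intro hb
    obtain ⟨i, hi, hs⟩ := (h.mem_iff _).1 hb.prop
    refine ⟨i, hi, (hb.eq_of_le ?_ ((sum_single_one_le _ b).2 ?_))⟩
    · rw [support_sum_single, compl_compl]
      exact h.facet_mem hi
    · exact compl_le_iff_compl_le.1 hs
  · rintro ⟨i, hi, rfl⟩
    refine ⟨?_, fun b hb hle => (sum_single_one_le _ b).2 ?_⟩
    · change (Finsupp.support _)ᶜ ∈ Δ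
      rw [support_sum_single, compl_compl]
      exact h.facet_mem hi
    · have hs := Finsupp.support_mono hle
      rw [support_sum_single] at hs
      rw [← h.eq_facet hi hb (le_compl_comm.1 hs), compl_compl]

/-- The amplitude as a sum over the facets. -/
theorem amplitude_eq : amplitude Δ = ∑ᶠ σ ∈ facets Δ, ∏ i ∈ σ,
    (algebraMap (MvPolynomial V ℚ) (FractionRing (MvPolynomial V ℚ)) (X i))⁻¹ := by
  have hinj : Set.InjOn (fun i => ∑ v ∈ (F i)ᶜ, Finsupp.single v 1 : ℕ → V →₀ ℕ)
      (Finset.range m) := fun i hi j hj hij => by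
    have := congrArg Finsupp.support hij
    simp only [support_sum_single, compl_inj_iff] at this
    exact h.injOn_facet hi hj this
  have hX : ∀ i : V, algebraMap (MvPolynomial V ℚ) (FractionRing (MvPolynomial V ℚ)) (X i) ≠ 0 :=
    fun i => (map_ne_zero_iff _ (IsFractionRing.injective _ _)).2 (X_ne_zero i)
  rw [amplitude, h.minimalMonomials_eq, h.facets_eq, finsum_mem_coe_finset, finsum_mem_coe_finset,
    Finset.sum_image hinj, Finset.sum_image h.injOn_facet, map_sum, Finset.sum_div]
  refine Finset.sum_congr rfl fun i _ => ?_
  rw [← prod_X_eq_monomial, map_prod, map_prod, Finset.prod_inv_distrib,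
    ← Finset.prod_compl_mul_prod (F i), div_mul_eq_div_div, div_self, one_div]
  exact Finset.prod_ne_zero_iff.2 fun v _ => hX v

end ReversibleShelling

end Faces

/-! ### The complex of the `E₇` pezzotope -/

section PezzotopeComplex

open MvPolynomial

lemma notMem_uTable : ∀ i : Fin 34, (i : ℕ) + 1 ∉ uTable.getD i [] := by decide +kernel

lemma not_adj_iff (i j : Fin 34) :
    j ≠ i ∧ ¬ graphE7.Adj i j ↔ (j : ℕ) + 1 ∈ uTable.getD i [] := by
  rw [graphE7_adj_iff, not_and_not_right]
  refine ⟨fun hij => hij.2 hij.1.symm, fun hj => ⟨?_, fun _ => hj⟩⟩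
  rintro rfl
  exact notMem_uTable j hj

theorem uPoly_eq (i : Fin 34) : uPoly i =
    X i + (∏ᶠ (j : Fin 34) (_ : j ≠ i ∧ ¬ graphE7.Adj i j), X j) - 1 := by
  rw [uPoly, finprod_cond_eq_prod_of_cond_iff]
  intro j _
  rw [not_adj_iff, Finset.mem_filter, and_iff_right (Finset.mem_univ j)]

lemma mem_vars_uPoly {i j : Fin 34} (hij : i ≠ j) :
    j ∈ (uPoly i).vars ↔ (j : ℕ) + 1 ∈ uTable.getD i [] := by
  rw [uPoly]
  set T := Finset.univ.filter fun j : Fin 34 => (j : ℕ) + 1 ∈ uTable.getD i []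
  have hT : (j : ℕ) + 1 ∈ uTable.getD i [] ↔ j ∈ T := by simp [T]
  rw [hT]
  constructor
  · intro hj
    rcases Finset.mem_union.1 (vars_sub_subset _ hj) with hj | hj
    · rcases Finset.mem_union.1 (vars_add_subset _ _ hj) with hj | hj
      · rw [vars_X, Finset.mem_singleton] at hj
        exact absurd hj.symm hij
      · obtain ⟨l, hl, hj⟩ := Finset.mem_biUnion.1 (vars_prod _ hj)
        rw [vars_X, Finset.mem_singleton] at hj
        exact hj ▸ hl
    · rw [vars_one] at hj
      simp at hj
  · intro hj
    rw [mem_vars_iff_mem_support]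
    have hsupp : (∑ l ∈ T, Finsupp.single l 1 : Fin 34 →₀ ℕ).support = T := support_sum_single T
    refine ⟨∑ l ∈ T, Finsupp.single l 1, ?_, hsupp.symm ▸ hj⟩
    have h1 : Finsupp.single i 1 ≠ (∑ l ∈ T, Finsupp.single l 1 : Fin 34 →₀ ℕ) := fun e => by
      rw [← e, Finsupp.support_single _ one_ne_zero] at hsupp
      rw [← hsupp, Finset.mem_singleton] at hj
      exact hij hj.symm
    have h0 : 0 ≠ (∑ l ∈ T, Finsupp.single l 1 : Fin 34 →₀ ℕ) := fun e => by
      rw [← e, Finsupp.support_zero] at hsupp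
      rw [← hsupp] at hj
      simp at hj
    have hprod : (∏ l ∈ T, X l : MvPolynomial (Fin 34) ℤ) =
        monomial (∑ l ∈ T, Finsupp.single l 1) 1 := by
      rw [monomial_sum_one]
      rfl
    rw [mem_support_iff, coeff_sub, coeff_add, coeff_X, if_neg h1, coeff_one, if_neg h0, hprod,
      coeff_monomial, if_pos rfl]
    norm_num

theorem graphE7_adj_iff_vars (i j : Fin 34) :
    graphE7.Adj i j ↔ i ≠ j ∧ j ∉ (uPoly i).vars := by
  rw [graphE7_adj_iff]
  exact and_congr_right fun hij => not_congr (mem_vars_uPoly hij).symm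

lemma sum_degrees_uTable : ∑ i : Fin 34, (Finset.univ.filter fun j : Fin 34 =>
    i ≠ j ∧ (j : ℕ) + 1 ∉ uTable.getD i []).card = 2 * 297 := by decide +kernel

theorem ncard_edgeSet_graphE7 : graphE7.edgeSet.ncard = 297 := by
  classical
  have h := graphE7.sum_degrees_eq_twice_card_edges
  have hdeg : ∀ i, graphE7.degree i = (Finset.univ.filter fun j : Fin 34 =>
      i ≠ j ∧ (j : ℕ) + 1 ∉ uTable.getD i []).card := fun i => by
    rw [← SimpleGraph.card_neighborFinset_eq_degree]
    congr 1
    ext j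
    simp [graphE7_adj_iff]
  simp only [hdeg] at h
  rw [sum_degrees_uTable] at h
  rw [← SimpleGraph.coe_edgeFinset, Set.ncard_coe_finset]
  omega

/-- The numbers that form a pair of the list with `n`. -/
def partners (n : ℕ) : List ℕ :=
  (monomialPairs.filter fun p => p.1 == n).map Prod.snd ++
    (monomialPairs.filter fun p => p.2 == n).map Prod.fst

lemma mem_partners {n l : ℕ} :
    l ∈ partners n ↔ (n, l) ∈ monomialPairs ∨ (l, n) ∈ monomialPairs := by
  simp [partners]

lemma partners_eq : ∀ i : Fin 34, (partners (i + 1)).foldr (fun j a => a ||| 2 ^ j) 0 =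
    (uTable.getD i []).foldr (fun j a => a ||| 2 ^ j) 0 := by decide +kernel

lemma mem_monomialPairs_iff (i j : Fin 34) : (((i : ℕ) + 1, (j : ℕ) + 1) ∈ monomialPairs ∨
    ((j : ℕ) + 1, (i : ℕ) + 1) ∈ monomialPairs) ↔ (j : ℕ) + 1 ∈ uTable.getD i [] := by
  rw [← mem_partners, ← testBit_foldr_or, partners_eq, testBit_foldr_or]

theorem stanleyReisnerIdeal_dualComplexE7 : stanleyReisnerIdeal ℚ dualComplexE7 = idealM := by
  refine le_antisymm (Ideal.span_le.2 ?_) (Ideal.span_le.2 ?_)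
  · rintro _ ⟨σ, hσ, rfl⟩
    have : ¬ ∀ i ∈ σ, ∀ j ∈ σ, i ≠ j → graphE7.Adj i j := hσ
    push Not at this
    obtain ⟨i, hi, j, hj, hij, hadj⟩ := this
    have hdvd : (X i * X j : MvPolynomial (Fin 34) ℚ) ∣ ∏ l ∈ σ, X l := by
      rw [← Finset.prod_pair hij]
      exact Finset.prod_dvd_prod_of_subset _ _ _
        (Finset.insert_subset hi (Finset.singleton_subset_iff.2 hj))
    refine Ideal.mem_of_dvd _ hdvd ?_
    rcases (mem_monomialPairs_iff i j).2 ((not_adj_iff i j).1 ⟨hij.symm, hadj⟩) with h | h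
    · exact Ideal.subset_span ⟨i, j, h, rfl⟩
    · exact Ideal.subset_span ⟨j, i, h, mul_comm _ _⟩
  · rintro _ ⟨i, j, h, rfl⟩
    have hij := (not_adj_iff i j).2 ((mem_monomialPairs_iff i j).1 (Or.inl h))
    refine Ideal.subset_span ⟨{i, j}, fun hc => hij.2 (hc ?_ ?_ hij.1.symm), ?_⟩
    · simp
    · simp
    · rw [Finset.prod_pair hij.1.symm]

lemma sum_range_getD {α : Type} (l : List α) (a : α) (f : α → ℕ) :
    ∑ i ∈ Finset.range l.length, f (l.getD i a) = (l.map f).sum := by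
  induction l with
  | nil => simp
  | cons b l ih =>
    rw [List.length_cons, Finset.sum_range_succ', List.map_cons, List.sum_cons, ← ih, add_comm]
    rfl

/-- The face numbers of the complex, from the sizes of the restriction sets. -/
lemma sum_choose_facetTable : ∀ n : Fin 7, (facetTable.map fun p =>
    if popcount p.2 ≤ 6 - n then (6 - popcount p.2).choose (6 - n - popcount p.2) else 0).sum =
      ([579, 1737, 2000, 1105, 297, 34, 1] : List ℕ).getD n 0 := by decide +kernel

theorem card_faces_dualComplexE7 (n : ℕ) :
    Nat.card {σ : Finset (Fin 34) // σ ∈ dualComplexE7 ∧ σ.card + n = 6} =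
      ([579, 1737, 2000, 1105, 297, 34, 1] : List ℕ).getD n 0 := by
  by_cases hn : n < 7
  · have hset : {σ : Finset (Fin 34) // σ ∈ dualComplexE7 ∧ σ.card + n = 6} =
        {σ : Finset (Fin 34) // σ ∈ dualComplexE7 ∧ σ.card = 6 - n} := by
      congr 1
      ext σ
      exact and_congr_right fun _ => by omega
    rw [hset, reversibleShelling_dualComplexE7.card_faces, ← sum_choose_facetTable ⟨n, hn⟩,
      ← sum_range_getD _ (0, 0), facetTable_length]
    simp only [restrictionE7, card_maskSet]
  · have : IsEmpty {σ : Finset (Fin 34) // σ ∈ dualComplexE7 ∧ σ.card + n = 6} :=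
      ⟨fun σ => by have := σ.2.2; omega⟩
    rw [Nat.card_of_isEmpty, List.getD_eq_default]
    simpa using hn

end PezzotopeComplex

end Pezzotope

open Pezzotope in
theorem theorem9p3 :
    -- the `u`-equations encode the graph with its 297 edges, and so the pezzotope
    (∀ i : Fin 34, uPoly i =
      MvPolynomial.X i
        + (∏ᶠ (j : Fin 34) (_ : j ≠ i ∧ ¬ graphE7.Adj i j), MvPolynomial.X j) - 1) ∧
    (∀ i j : Fin 34, graphE7.Adj i j ↔ i ≠ j ∧ j ∉ (uPoly i).vars) ∧
    graphE7.edgeSet.ncard = 297 ∧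
    -- the Stanley–Reisner ideal of the clique complex
    stanleyReisnerIdeal ℚ dualComplexE7 = idealM ∧
    -- the linear resolution of the Alexander dual ideal and its Betti numbers
    (∃ F : MinimalFreeResolution (stanleyReisnerIdeal ℚ (alexanderDual dualComplexE7)),
      (∀ n c, F.degree n c = 28 + n) ∧
      ∀ n, F.rank n = ([579, 1737, 2000, 1105, 297, 34, 1] : List ℕ).getD n 0) ∧
    -- the Gorenstein property
    IsGorensteinRing (MvPolynomial (Fin 34) ℚ ⧸ stanleyReisnerIdeal ℚ dualComplexE7) ∧
    -- the homology sphere, over the rational numbers and over the integers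
    IsHomologySphere ℚ dualComplexE7 5 ∧
    IsHomologySphere ℤ dualComplexE7 5 ∧
    -- the amplitude
    (facets dualComplexE7).ncard = 579 ∧
    (∀ F ∈ facets dualComplexE7, F.card = 6) ∧
    amplitude dualComplexE7 =
      ∑ᶠ F ∈ facets dualComplexE7, ∏ i ∈ F,
        (algebraMap (MvPolynomial (Fin 34) ℚ) (FractionRing (MvPolynomial (Fin 34) ℚ))
          (MvPolynomial.X i))⁻¹ := by
  have h := reversibleShelling_dualComplexE7
  obtain ⟨ε, hε, hbd, hne⟩ := h.exists_orientation ℚ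
  refine ⟨uPoly_eq, graphE7_adj_iff_vars, ncard_edgeSet_graphE7,
    stanleyReisnerIdeal_dualComplexE7, ?_, ?_, h.isHomologySphere ℚ, h.isHomologySphere ℤ,
    h.ncard_facets, ?_, h.amplitude_eq⟩
  · exact ⟨h.resolution hε hbd hne fun n =>
      (Finite.equivFinOfCardEq (card_faces_dualComplexE7 n)).symm, fun _ _ => rfl, fun _ => rfl⟩
  · refine h.isGorensteinRing (t := fun i => ((i : ℕ) : ℚ)) fun i j hij => ?_
    exact Fin.ext (Nat.cast_injective hij)
  · intro F hF
    rw [h.facets_eq] at hF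
    obtain ⟨i, hi, rfl⟩ := Finset.mem_image.1 (Finset.mem_coe.1 hF)
    exact h.card_eq i (Finset.mem_range.1 hi)
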